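/- **Theorem (Strichartz inequality for orthonormal functions).** Let $d\ge 1$ be an integer and let $1<q\le 1+\frac2d$. There is a constant $C_{d,q}>0$, depending only on $d$ and $q$, such that the following holds for the exponent $p\ge1$ with $\frac2p+\frac dq=d$, for every (finite or infinite) orthonormal system $(u_j)$ in $L^2(\mathbb R^d)$ and all complex coefficients $(n_j)$. Here $e^{it\Delta}$ denotes the free Schrödinger propagator on $L^2(\mathbb R^d)$, i.e. the unitary Fourier multiplier such that $u(t)=e^{it\Delta}u$ solves $i\,\partial_t u=-\Delta u$, $u(0)=u$. (i) If $\sum_j|n_j|^{\frac{2q}{q+1}}<\infty$, then for almost every $t\in\mathbb R$ the series $$\rho(t,x):=\sum_j n_j\,\big|(e^{it\Delta}u_j)(x)\big|^2$$ converges absolutely for almost every $x\in\mathbb R^d$, the function $\rho(t,\cdot)$ is measurable for every $t$ (being set to $0$ where the series diverges), and $t\mapsto\int_{\mathbb R^d}|\rho(t,x)|^q\,dx$ is Lebesgue measurable. (ii) $$\int_{\mathbb R}\left(\int_{\mathbb R^d}\Big|\sum_j n_j\big|(e^{it\Delta}u_j)(x)\big|^2\Big|^q dx\right)^{\frac pq}dt\;\le\;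 C_{d,q}^{\,p}\left(\sum_j|n_j|^{\frac{2q}{q+1}}\right)^{\frac{p(q+1)}{2q}},$$ the right-hand side being $+\infty$ if the sum diverges. (iii) In operator form: if $\gamma$ is a bounded operator on $L^2(\mathbb R^d)$ with $\gamma=\sum_j n_j|u_j\rangle\langle u_j|$ (strongly convergent, where $|u\rangle\langle u|f=\langle u,f\rangle u$), then $\gamma(t):=e^{it\Delta}\gamma e^{-it\Delta}=\sum_j n_j|e^{it\Delta}u_j\rangle\langle e^{it\Delta}u_j|$ for every $t$, and its density $\rho_{\gamma(t)}:=\sum_j n_j|e^{it\Delta}u_j|^2$ satisfies $$\|\rho_{\gamma(t)}\|_{L^p_t(\mathbb R,L^q_x(\mathbb R^d))}\le C_{d,q}\,\|\gamma\|_{\mathfrak S^{\frac{2q}{q+1}}},$$ where $\|\gamma\|_{\mathfrak S^r}=\big(\sum_{k\ge0}s_k(\gamma)^r\big)^{1/r}\in[0,\infty]$ is the Schatten norm, $s_0(\gamma)\ge s_1(\gamma)\ge\cdots$ being the singular values of $\gamma$ ($s_k(\gamma)$ is the operator-norm distance from $\gamma$ to the operators of rank at most $k$). -/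

import Mathlib

open MeasureTheory FourierTransform
open scoped ENNReal

/-- The Hilbert space `L²(ℝᵈ; ℂ)`. -/
abbrev L2 (d : ℕ) : Type :=
  Lp (α := EuclideanSpace ℝ (Fin d)) ℂ 2 volume

/-- The Fourier symbol of `e^{itΔ}`. With the normalisation
`𝓕 f ξ = ∫ e^{-2πi x·ξ} f x dx`, the operator `-Δ` is multiplication by `4π²|ξ|²` on the
Fourier side, so that `e^{itΔ}` is multiplication by `e^{-4π²it|ξ|²}`. -/
noncomputable def phase (d : ℕ) (t : ℝ) (ξ : EuclideanSpace ℝ (Fin d)) : ℂ :=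
  Complex.exp (((-(4 * Real.pi ^ 2 * t * ‖ξ‖ ^ 2) : ℝ) : ℂ) * Complex.I)

theorem norm_phase (d : ℕ) (t : ℝ) (ξ : EuclideanSpace ℝ (Fin d)) : ‖phase d t ξ‖ = 1 :=
  Complex.norm_exp_ofReal_mul_I _

theorem continuous_phase (d : ℕ) (t : ℝ) : Continuous (phase d t) := by
  unfold phase
  fun_prop

theorem memLp_phase_mul (d : ℕ) (t : ℝ) (f : L2 d) :
    MemLp (fun ξ => phase d t ξ * f ξ) 2 volume := by
  refine (Lp.memLp f).of_le
    ((continuous_phase d t).aestronglyMeasurable.mul (Lp.memLp f).aestronglyMeasurable) ?_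
  filter_upwards with ξ
  rw [norm_mul, norm_phase, one_mul]

/-- Multiplication by the symbol of `e^{itΔ}`, as a linear isometry of `L²(ℝᵈ)`. -/
noncomputable def phaseMul (d : ℕ) (t : ℝ) : L2 d →ₗᵢ[ℂ] L2 d where
  toFun f := (memLp_phase_mul d t f).toLp
  map_add' f g := by
    rw [← MemLp.toLp_add, MemLp.toLp_eq_toLp_iff]
    filter_upwards [Lp.coeFn_add f g] with ξ h
    simp only [h, Pi.add_apply, mul_add]
  map_smul' c f := by
    rw [RingHom.id_apply, ← MemLp.toLp_const_smul, MemLp.toLp_eq_toLp_iff]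
    filter_upwards [Lp.coeFn_smul c f] with ξ h
    simp only [h, Pi.smul_apply, smul_eq_mul]
    ring
  norm_map' f := by
    change ‖(memLp_phase_mul d t f).toLp‖ = ‖f‖
    rw [Lp.norm_toLp, Lp.norm_def]
    congr 1
    refine eLpNorm_congr_norm_ae ?_
    filter_upwards with ξ
    rw [norm_mul, norm_phase, one_mul]

/-- The free Schrödinger propagator `e^{itΔ}` on `L²(ℝᵈ)`, that is
`e^{itΔ} u = 𝓕⁻¹ (e^{-4π²it|ξ|²} 𝓕 u)` with the Fourier transform on `L²`. -/
noncomputable def propagator (d : ℕ) (t : ℝ) : L2 d →L[ℂ] L2 d :=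
  (Lp.fourierTransformₗᵢ (EuclideanSpace ℝ (Fin d)) ℂ).symm.toLinearIsometry.toContinuousLinearMap ∘L
    (phaseMul d t).toContinuousLinearMap ∘L
      (Lp.fourierTransformₗᵢ (EuclideanSpace ℝ (Fin d)) ℂ).toLinearIsometry.toContinuousLinearMap

/-- The evolved operator `γ(t) = e^{itΔ} γ e^{-itΔ}`. -/
noncomputable def evolve (d : ℕ) (t : ℝ) (γ : L2 d →L[ℂ] L2 d) : L2 d →L[ℂ] L2 d :=
  propagator d t ∘L γ ∘L propagator d (-t)

/-- The density `x ↦ ∑ⱼ nⱼ |uⱼ(x)|²`. -/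
noncomputable def density {d : ℕ} {ι : Type*} (n : ι → ℂ) (u : ι → L2 d)
    (x : EuclideanSpace ℝ (Fin d)) : ℂ :=
  ∑' j, n j * ((‖u j x‖ ^ 2 : ℝ) : ℂ)

/-- `T = ∑ⱼ nⱼ |uⱼ⟩⟨uⱼ|`, the series converging strongly. -/
def IsDiagonalSum {H : Type*} [NormedAddCommGroup H] [InnerProductSpace ℂ H] {ι : Type*}
    (T : H →L[ℂ] H) (n : ι → ℂ) (u : ι → H) : Prop :=
  ∀ f : H, HasSum (fun j => (n j * inner ℂ (u j) f) • u j) (T f)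

/-- The `k`-th singular value (counted from `k = 0`, in decreasing order, with multiplicity) of a
bounded operator on a Hilbert space: the distance to the operators of rank at most `k`. -/
noncomputable def singularValue {H : Type*} [NormedAddCommGroup H] [InnerProductSpace ℂ H]
    (T : H →L[ℂ] H) (k : ℕ) : ℝ≥0∞ :=
  ⨅ (F : H →L[ℂ] H) (_ : (F : H →ₗ[ℂ] H).rank ≤ (k : Cardinal)), ‖T - F‖ₑ

/-- The Schatten norm `(∑ₖ sₖ(T)^r)^{1/r}`, with value `∞` outside the Schatten class. -/
noncomputable def schattenNorm {H : Type*} [NormedAddCommGroup H] [InnerProductSpace ℂ H]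
    (r : ℝ) (T : H →L[ℂ] H) : ℝ≥0∞ :=
  (∑' k : ℕ, singularValue T k ^ r) ^ (1 / r)

/-- The mixed norm of `L^p_t(ℝ, L^q_x(ℝᵈ))`. -/
noncomputable def mixedNorm {d : ℕ} (p q : ℝ)
    (ρ : ℝ → EuclideanSpace ℝ (Fin d) → ℂ) : ℝ≥0∞ :=
  (∫⁻ t : ℝ, ((∫⁻ x, ‖ρ t x‖ₑ ^ q) ^ (1 / q)) ^ p) ^ (1 / p)

/-! The heart is the endpoint q = p = 1 + 2/d, proved in dual form. For a weight V ≥ 0 on space-time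
put A = ∫ e^{-itΔ} V(t) e^{itΔ} dt and αᵢ = ⟨uᵢ, A uᵢ⟩ = ∫ V |e^{itΔ}uᵢ|². The dual estimate is ∑
αᵢ^{d+2} ≤ C (∫ V^{1+d/2})² for orthonormal uᵢ (`exists_sum_rpow_le`). No complex interpolation is
used; its role is played by a level-by-level splitting of the kernel.

Suppose first that the functions fᵢ = √V e^{itΔ}uᵢ are orthogonal in L² of space-time. The TT*
argument gives αᵢ² ≤ ‖A uᵢ‖² = ⟨fᵢ, K fᵢ⟩, where K has kernel √V(t) e^{i(t-s)Δ} √V(s). For a level λ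
> 0, replace V(t,x)V(s,y) by its minimum with m(t,s)², m = λκ. A layer-cake formula and unitarity
alone show that this low part has norm at most m(t,s) for fixed times
(`enorm_integral_kernel_min_le`); with κ(t,s) proportional to |t-s|^{-δ}(ν(t)ν(s))^{(1-δ)/2}, δ =
d/(d+1), where ν is a positive majorant of t ↦ ∫ V(t,x)^{1+d/2} dx, the Hardy–Littlewood–Sobolev
inequality makes its form at fᵢ at most λαᵢ/2. The rest is Hilbert–Schmidt by the dispersive bound
|t-s|^{-d/2}, and when αᵢ ≥ λ its form at fᵢ is at least λαᵢ/2. Bessel's inequality for the tensors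
of the normalised fᵢ then bounds (λ²/4) #{αᵢ ≥ λ} by the squared Hilbert–Schmidt norm
(`sum_threshold_le`). Integrating against λ^{d-1} dλ turns the left side into ∑ αᵢ^{d+2} and the
right side into a second Hardy–Littlewood–Sobolev integral with the same δ
(`exists_sum_rpow_le_of_orthogonal`). An arbitrary orthonormal system is rotated by the unitary
matrix that diagonalises the Gram matrix of the fᵢ; by convexity this does not decrease ∑ αᵢ^{d+2}.

Testing the dual estimate on truncations of ρ^{2/d} gives the endpoint for finite systems with
nonnegative weights, and monotone convergence gives it for countable ones. For 1 < q < 1 + 2/d one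
interpolates with the conservation law ∫ |e^{itΔ}u|² = 1 by Hölder's inequality, splitting the
weights as well as the functions. Finally, the uⱼ are eigenvectors of γ with eigenvalues nⱼ, and a
dimension count gives ∑ |nⱼ|^r ≤ ∑ sₖ(γ)^r, the only direction needed for the operator form. -/

section

open Filter Topology ComplexConjugate


/-! ### Fourier integrals and the dispersive kernel bound -/

/-- On `L¹ ∩ L²` the `L²` Fourier transform is given by the Fourier integral. -/
theorem fourierTransform_toLp_ae_eq {d : ℕ} {f : EuclideanSpace ℝ (Fin d) → ℂ}
    (h1 : Integrable f) (h2 : MemLp f 2) :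
    (Lp.fourierTransformₗᵢ (EuclideanSpace ℝ (Fin d)) ℂ h2.toLp : EuclideanSpace ℝ (Fin d) → ℂ)
      =ᵐ[volume] 𝓕 f := by
  have hcont : Continuous (𝓕 f) :=
    VectorFourier.fourierIntegral_continuous Real.continuous_fourierChar
      (by exact continuous_inner) h1
  refine ae_eq_of_integral_contDiff_smul_eq
    ((Lp.memLp _).locallyIntegrable one_le_two) hcont.locallyIntegrable ?_
  intro g hg hgs
  have hgs' : HasCompactSupport (fun x => (g x : ℂ)) :=
    hgs.comp_left (g := fun r : ℝ => (r : ℂ)) (by simp)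
  have hg' : ContDiff ℝ (⊤ : ℕ∞) (fun x => (g x : ℂ)) := by
    exact Complex.ofRealCLM.contDiff.comp hg
  let φ : SchwartzMap (EuclideanSpace ℝ (Fin d)) ℂ := hgs'.toSchwartzMap hg'
  have hφ : ∀ x, φ x = (g x : ℂ) := fun x => rfl
  -- Both sides are compared as tempered distributions: the L² transform is the distributional one,
  -- and the Fourier integral satisfies the same duality ∫ 𝓕φ · f = ∫ φ · 𝓕f.
  have e1 := congrArg (fun T => T φ) (Lp.fourier_toTemperedDistribution_eq (h2.toLp (μ := volume)))
  simp only [TemperedDistribution.fourier_apply, Lp.toTemperedDistribution_apply] at e1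
  have e2 : ∫ x, (𝓕 φ : SchwartzMap _ ℂ) x • (h2.toLp (μ := volume)) x = ∫ x, (𝓕 φ : SchwartzMap _ ℂ) x • f x := by
    refine integral_congr_ae ?_
    filter_upwards [h2.coeFn_toLp] with x hx
    rw [hx]
  have e3 : ∫ x, (𝓕 φ : SchwartzMap _ ℂ) x • f x = ∫ x, φ x • (𝓕 f) x := by
    have := VectorFourier.integral_fourierIntegral_smul_eq_flip (L := innerₗ (EuclideanSpace ℝ (Fin d)))
      (μ := volume) (ν := volume) Real.continuous_fourierChar (by exact continuous_inner)
      (f := φ) (g := f) φ.integrable h1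
    simpa [SchwartzMap.fourier_coe] using! this
  have e4 : ∀ F : EuclideanSpace ℝ (Fin d) → ℂ, ∫ x, g x • F x = ∫ x, φ x • F x := by
    intro F
    refine integral_congr_ae (.of_forall fun x => ?_)
    simp [hφ]
  rw [e4, e4, ← e3, ← e2, e1]
  rfl

/-- The integral kernel of `e^{iτΔ}`. -/
noncomputable def schrodingerKernel (d : ℕ) (τ : ℝ) (z : EuclideanSpace ℝ (Fin d)) : ℂ :=
  (Real.pi / (4 * Real.pi ^ 2 * τ * Complex.I)) ^ (d / 2 : ℂ) *
    Complex.exp ((2 * Real.pi * Complex.I) ^ 2 * ‖z‖ ^ 2 / (4 * (4 * Real.pi ^ 2 * τ * Complex.I)))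

/-- The Gaussian kernel with complex parameter `b`. -/
noncomputable def gaussianKernel (d : ℕ) (b : ℂ) (z : EuclideanSpace ℝ (Fin d)) : ℂ :=
  (Real.pi / b) ^ (d / 2 : ℂ) *
    Complex.exp ((2 * Real.pi * Complex.I) ^ 2 * ‖z‖ ^ 2 / (4 * b))

/-- Re(1/b) ≥ 0 makes the exponential at most 1, so only the prefactor counts. The bound is uniform
up to the imaginary axis, so it serves both as a dominating constant for the regularised kernels and
as the bound for their limit. -/
theorem norm_gaussianKernel_le (d : ℕ) {b : ℂ} (hb : 0 ≤ b.re) (hb0 : b ≠ 0) {r : ℝ} (hr : 0 < r)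
    (hbr : r ≤ ‖b‖) (z : EuclideanSpace ℝ (Fin d)) :
    ‖gaussianKernel d b z‖ ≤ (Real.pi / r) ^ ((d : ℝ) / 2) := by
  unfold gaussianKernel
  rw [norm_mul]
  have h1 : ‖(Real.pi / b : ℂ) ^ (d / 2 : ℂ)‖ = ‖(Real.pi / b : ℂ)‖ ^ ((d : ℝ) / 2) := by
    have : (d / 2 : ℂ) = (((d : ℝ) / 2 : ℝ) : ℂ) := by push_cast; rfl
    rw [this, Complex.norm_cpow_real]
  have h2 : ‖Complex.exp ((2 * Real.pi * Complex.I) ^ 2 * ‖z‖ ^ 2 / (4 * b))‖ ≤ 1 := by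
    rw [Complex.norm_exp, Real.exp_le_one_iff]
    have : ((2 * Real.pi * Complex.I) ^ 2 * ‖z‖ ^ 2 / (4 * b) : ℂ)
        = ((-(Real.pi ^ 2 * ‖z‖ ^ 2) : ℝ) : ℂ) * b⁻¹ := by
      rw [mul_pow, Complex.I_sq]
      push_cast
      field_simp
      ring
    rw [this, Complex.re_ofReal_mul, Complex.inv_re]
    have : 0 ≤ b.re / Complex.normSq b := div_nonneg hb (Complex.normSq_nonneg _)
    nlinarith [mul_nonneg (mul_nonneg (sq_nonneg Real.pi) (sq_nonneg ‖z‖)) this]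
  rw [h1]
  have h3 : ‖(Real.pi / b : ℂ)‖ ≤ Real.pi / r := by
    rw [norm_div, Complex.norm_real, Real.norm_of_nonneg Real.pi_pos.le]
    gcongr
  calc _ ≤ (Real.pi / r) ^ ((d : ℝ) / 2) * 1 := by gcongr
    _ = _ := mul_one _

theorem schrodingerKernel_eq_gaussianKernel (d : ℕ) (τ : ℝ) :
    schrodingerKernel d τ = gaussianKernel d (4 * Real.pi ^ 2 * τ * Complex.I) := rfl

/-- The dispersive estimate, with the constant (4π)^{-d/2} coarsened to 1. -/
theorem norm_schrodingerKernel_le (d : ℕ) {τ : ℝ} (hτ : τ ≠ 0) (z : EuclideanSpace ℝ (Fin d)) :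
    ‖schrodingerKernel d τ z‖ ≤ |τ| ^ (-((d : ℝ) / 2)) := by
  rw [schrodingerKernel_eq_gaussianKernel]
  have hpi := Real.pi_pos
  have h0 : 0 < |τ| := abs_pos.2 hτ
  refine (norm_gaussianKernel_le d (r := 4 * Real.pi ^ 2 * |τ|) ?_ ?_ (by positivity) ?_ z).trans ?_
  · simp [← Complex.ofReal_pow]
  · simp [hτ, hpi.ne']
  · simp [abs_of_pos hpi]
  · rw [Real.rpow_neg h0.le, ← Real.inv_rpow h0.le]
    refine Real.rpow_le_rpow (by positivity) ?_ (by positivity)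
    rw [div_le_iff₀ (by positivity)]
    field_simp
    nlinarith [Real.pi_gt_three]

@[fun_prop]
theorem measurable_schrodingerKernel (d : ℕ) :
    Measurable (fun p : ℝ × EuclideanSpace ℝ (Fin d) => schrodingerKernel d p.1 p.2) := by
  unfold schrodingerKernel
  fun_prop


/-! ### The unitary group -/

theorem fourier_propagator (d : ℕ) (t : ℝ) (u : L2 d) :
    Lp.fourierTransformₗᵢ (EuclideanSpace ℝ (Fin d)) ℂ (propagator d t u) =
      phaseMul d t (Lp.fourierTransformₗᵢ (EuclideanSpace ℝ (Fin d)) ℂ u) := by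
  simp [propagator]

theorem norm_propagator (d : ℕ) (t : ℝ) (u : L2 d) : ‖propagator d t u‖ = ‖u‖ := by
  simp [propagator]

theorem phaseMul_ae_eq (d : ℕ) (t : ℝ) (u : L2 d) :
    (phaseMul d t u : EuclideanSpace ℝ (Fin d) → ℂ) =ᵐ[volume] fun ξ => phase d t ξ * u ξ :=
  (memLp_phase_mul d t u).coeFn_toLp

theorem phaseMul_phaseMul (d : ℕ) (s t : ℝ) (u : L2 d) :
    phaseMul d s (phaseMul d t u) = phaseMul d (s + t) u := by
  refine Lp.ext ?_
  filter_upwards [phaseMul_ae_eq d s (phaseMul d t u), phaseMul_ae_eq d t u,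
    phaseMul_ae_eq d (s + t) u] with ξ h1 h2 h3
  rw [h1, h2, h3, ← mul_assoc, phase, phase, phase, ← Complex.exp_add]
  congr 2
  push_cast
  ring

theorem propagator_propagator (d : ℕ) (s t : ℝ) (u : L2 d) :
    propagator d s (propagator d t u) = propagator d (s + t) u := by
  apply (Lp.fourierTransformₗᵢ (EuclideanSpace ℝ (Fin d)) ℂ).injective
  simp only [fourier_propagator, phaseMul_phaseMul]

theorem propagator_zero (d : ℕ) (u : L2 d) : propagator d 0 u = u := by
  apply (Lp.fourierTransformₗᵢ (EuclideanSpace ℝ (Fin d)) ℂ).injective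
  rw [fourier_propagator]
  refine Lp.ext ?_
  filter_upwards [phaseMul_ae_eq d 0 (Lp.fourierTransformₗᵢ (EuclideanSpace ℝ (Fin d)) ℂ u)] with ξ h
  rw [h]
  simp [phase]

theorem inner_propagator_propagator (d : ℕ) (t : ℝ) (u v : L2 d) :
    inner ℂ (propagator d t u) (propagator d t v) = inner ℂ u v :=
  LinearIsometry.inner_map_map
    (⟨(propagator d t : L2 d →ₗ[ℂ] L2 d), norm_propagator d t⟩ : L2 d →ₗᵢ[ℂ] L2 d) u v

theorem inner_propagator_left (d : ℕ) (t : ℝ) (u v : L2 d) :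
    inner ℂ (propagator d t u) v = inner ℂ u (propagator d (-t) v) := by
  rw [← inner_propagator_propagator d (-t), propagator_propagator, neg_add_cancel,
    propagator_zero]

/-! ### The kernel representation of the propagator -/

/-- The only danger is the branch cut of the complex power: the limit of π/b is a nonzero imaginary
number, hence off the cut. -/
theorem tendsto_gaussianKernel (d : ℕ) {τ : ℝ} (hτ : τ ≠ 0) (z : EuclideanSpace ℝ (Fin d)) :
    Tendsto (fun n : ℕ => gaussianKernel d
      (((1 / ((n : ℝ) + 1) : ℝ) : ℂ) + 4 * Real.pi ^ 2 * τ * Complex.I) z) atTop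
      (𝓝 (schrodingerKernel d τ z)) := by
  rw [schrodingerKernel_eq_gaussianKernel]
  have hb : Tendsto (fun n : ℕ => (((1 / ((n : ℝ) + 1) : ℝ) : ℂ) + 4 * Real.pi ^ 2 * τ * Complex.I))
      atTop (𝓝 (4 * Real.pi ^ 2 * τ * Complex.I)) := by
    have h := tendsto_one_div_add_atTop_nhds_zero_nat (𝕜 := ℝ)
    have h2 := (Complex.continuous_ofReal.tendsto 0).comp h
    simpa using h2.add_const (4 * Real.pi ^ 2 * τ * Complex.I : ℂ)
  have hb0 : (4 * Real.pi ^ 2 * τ * Complex.I : ℂ) ≠ 0 := by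
    simp [hτ, Real.pi_ne_zero]
  have hs : (Real.pi / (4 * Real.pi ^ 2 * τ * Complex.I) : ℂ) ∈ Complex.slitPlane := by
    have : (Real.pi / (4 * Real.pi ^ 2 * τ * Complex.I) : ℂ)
        = ((-(1 / (4 * Real.pi * τ)) : ℝ) : ℂ) * Complex.I := by
      have : (τ : ℂ) ≠ 0 := by simpa using hτ
      have : (Real.pi : ℂ) ≠ 0 := by simp [Real.pi_ne_zero]
      push_cast
      field_simp
      simp
    rw [this, Complex.mem_slitPlane_iff]
    right
    simp [hτ, Real.pi_ne_zero]
  refine ContinuousAt.tendsto (f := fun b => gaussianKernel d b z) ?_ |>.comp hb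
  unfold gaussianKernel
  refine ContinuousAt.mul ?_ ?_
  · exact ((continuousAt_const.div continuousAt_id hb0).cpow continuousAt_const hs)
  · refine Complex.continuous_exp.continuousAt.comp ?_
    exact continuousAt_const.div (by fun_prop) (by simpa using hb0)

theorem inner_toLp_eq_integral {α : Type*} {m : MeasurableSpace α} {μ : Measure α}
    {f g : α → ℂ} (hf : MemLp f 2 μ) (hg : MemLp g 2 μ) :
    inner ℂ hf.toLp hg.toLp = ∫ x, conj (f x) * g x ∂μ := by
  rw [L2.inner_def]
  refine integral_congr_ae ?_
  filter_upwards [hf.coeFn_toLp, hg.coeFn_toLp] with x h1 h2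
  rw [h1, h2]
  simp [mul_comm]

theorem inner_eq_integral {α : Type*} {m : MeasurableSpace α} {μ : Measure α} (f g : Lp ℂ 2 μ) :
    inner ℂ f g = ∫ x, conj (f x) * g x ∂μ := by
  rw [L2.inner_def]
  refine integral_congr_ae (.of_forall fun x => ?_)
  simp [mul_comm]

/-- The Gaussian-regularised sesquilinear form in terms of its integral kernel. -/
theorem integral_conj_fourier_gaussian {d : ℕ} {f g : EuclideanSpace ℝ (Fin d) → ℂ}
    (hf : Integrable f) (hg : Integrable g) {b : ℂ} (hb : 0 < b.re) :
    ∫ ξ, conj (𝓕 f ξ) * (Complex.exp (-b * ‖ξ‖ ^ 2) * 𝓕 g ξ) =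
      ∫ p : EuclideanSpace ℝ (Fin d) × EuclideanSpace ℝ (Fin d),
        conj (f p.1) * gaussianKernel d b (p.1 - p.2) * g p.2 := by
  have hgauss : Integrable (fun ξ : EuclideanSpace ℝ (Fin d) => Complex.exp (-b * ‖ξ‖ ^ 2)) := by
    simpa using GaussianFourier.integrable_cexp_neg_mul_sq_norm_add hb 0
      (0 : EuclideanSpace ℝ (Fin d))
  have hfg : Integrable (fun p : EuclideanSpace ℝ (Fin d) × EuclideanSpace ℝ (Fin d) =>
      conj (f p.1) * g p.2) :=
    Integrable.mul_prod (f := fun x => conj (f x)) (LinearIsometryEquiv.integrable_comp_iff Complex.conjLIE |>.2 hf) hg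
  have h3 : Integrable (fun q : EuclideanSpace ℝ (Fin d) ×
      (EuclideanSpace ℝ (Fin d) × EuclideanSpace ℝ (Fin d)) =>
      Complex.exp (-b * ‖q.1‖ ^ 2) * (conj (f q.2.1) * g q.2.2)) := hgauss.mul_prod hfg
  let e : EuclideanSpace ℝ (Fin d) → EuclideanSpace ℝ (Fin d) × EuclideanSpace ℝ (Fin d) → ℂ :=
    fun ξ p => Complex.exp (2 * Real.pi * Complex.I * inner ℝ (p.1 - p.2) ξ)
  have he : ∀ ξ p, ‖e ξ p‖ = 1 := by
    intro ξ p
    have : (2 * Real.pi * Complex.I * inner ℝ (p.1 - p.2) ξ : ℂ) =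
      ((2 * Real.pi * inner ℝ (p.1 - p.2) ξ : ℝ) : ℂ) * Complex.I := by push_cast; ring
    simp only [e]
    rw [this, Complex.norm_exp_ofReal_mul_I]
  have h4 : Integrable (fun q : EuclideanSpace ℝ (Fin d) ×
      (EuclideanSpace ℝ (Fin d) × EuclideanSpace ℝ (Fin d)) =>
      e q.1 q.2 * (Complex.exp (-b * ‖q.1‖ ^ 2) * (conj (f q.2.1) * g q.2.2))) := by
    refine h3.bdd_mul (c := 1) ?_ (.of_forall fun q => (he _ _).le)
    exact Continuous.aestronglyMeasurable (by fun_prop)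
  have h5 := integral_integral_swap (f := fun ξ p => e ξ p * (Complex.exp (-b * ‖ξ‖ ^ 2) *
    (conj (f p.1) * g p.2))) h4
  -- After both Fourier integrals are opened, the ξ-integral for fixed (x, y) is that of a Gaussian
  -- with a linear phase, which is `gaussianKernel`. Fubini applies because the phase `e` has
  -- modulus 1.
  have h6 : ∀ ξ, conj (𝓕 f ξ) * (Complex.exp (-b * ‖ξ‖ ^ 2) * 𝓕 g ξ) =
      ∫ p : EuclideanSpace ℝ (Fin d) × EuclideanSpace ℝ (Fin d),
        e ξ p * (Complex.exp (-b * ‖ξ‖ ^ 2) * (conj (f p.1) * g p.2)) := by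
    intro ξ
    rw [Real.fourier_eq', Real.fourier_eq', ← integral_conj, ← integral_const_mul,
      ← integral_prod_mul]
    refine integral_congr_ae (.of_forall fun p => ?_)
    simp only [e, smul_eq_mul, ← Complex.exp_conj, map_mul, Complex.conj_ofReal, Complex.conj_I]
    have : (2 * Real.pi * Complex.I * inner ℝ (p.1 - p.2) ξ : ℂ) =
       ((-2 * Real.pi * inner ℝ p.1 ξ : ℝ) : ℂ) * (-Complex.I) +
        (((-2 * Real.pi * inner ℝ p.2 ξ : ℝ) : ℂ) * Complex.I) := by
      rw [inner_sub_left]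
      push_cast
      ring
    rw [this, Complex.exp_add]
    ring
  simp_rw [h6]
  rw [h5]
  refine integral_congr_ae (.of_forall fun p => ?_)
  have h7 := GaussianFourier.integral_cexp_neg_mul_sq_norm_add hb (2 * Real.pi * Complex.I)
    (p.1 - p.2)
  have h8 : ∀ ξ, e ξ p * (Complex.exp (-b * ‖ξ‖ ^ 2) * (conj (f p.1) * g p.2)) =
      Complex.exp (-b * ‖ξ‖ ^ 2 + 2 * Real.pi * Complex.I * inner ℝ (p.1 - p.2) ξ) *
        (conj (f p.1) * g p.2) := by
    intro ξ
    rw [Complex.exp_add]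
    simp only [e]
    ring
  simp only [h8]
  rw [integral_mul_const, h7, gaussianKernel]
  simp
  ring

/-- The sesquilinear form of `e^{iτΔ}` on `L¹ ∩ L²` in terms of the integral kernel. -/
theorem inner_propagator_eq_integral {d : ℕ} {f g : EuclideanSpace ℝ (Fin d) → ℂ}
    (hf1 : Integrable f) (hf2 : MemLp f 2) (hg1 : Integrable g) (hg2 : MemLp g 2)
    {τ : ℝ} (hτ : τ ≠ 0) :
    inner ℂ hf2.toLp (propagator d τ hg2.toLp) =
      ∫ p : EuclideanSpace ℝ (Fin d) × EuclideanSpace ℝ (Fin d),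
        conj (f p.1) * schrodingerKernel d τ (p.1 - p.2) * g p.2 := by
  have hpi := Real.pi_pos
  -- The oscillating symbol is approached by Gaussians from the right half-plane. Convergence is
  -- dominated on both sides: by |𝓕f 𝓕g| in frequency, and by the uniform kernel bound, coming from
  -- the fixed imaginary part of `b n`, times |f ⊗ g| in space.
  let b : ℕ → ℂ := fun n => ((1 / ((n : ℝ) + 1) : ℝ) : ℂ) + 4 * Real.pi ^ 2 * τ * Complex.I
  have hbre : ∀ n, (b n).re = 1 / ((n : ℝ) + 1) := by
    intro n
    simp only [b, Complex.add_re, Complex.ofReal_re]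
    simp [← Complex.ofReal_pow]
  have hbim : ∀ n, (b n).im = 4 * Real.pi ^ 2 * τ := by
    intro n; simp [b, ← Complex.ofReal_pow]
  have hpos : ∀ n : ℕ, 0 < 1 / ((n : ℝ) + 1) := fun n => by positivity
  have hL : inner ℂ hf2.toLp (propagator d τ hg2.toLp) =
      ∫ ξ, conj (𝓕 f ξ) * (phase d τ ξ * 𝓕 g ξ) := by
    rw [← (Lp.fourierTransformₗᵢ (EuclideanSpace ℝ (Fin d)) ℂ).inner_map_map,
      fourier_propagator, inner_eq_integral]
    refine integral_congr_ae ?_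
    filter_upwards [fourierTransform_toLp_ae_eq hf1 hf2, fourierTransform_toLp_ae_eq hg1 hg2,
      phaseMul_ae_eq d τ (Lp.fourierTransformₗᵢ (EuclideanSpace ℝ (Fin d)) ℂ hg2.toLp)]
      with ξ h1 h2 h3
    rw [h1, h3, h2]
  have hFf : MemLp (𝓕 f) 2 := (Lp.memLp _).ae_eq (fourierTransform_toLp_ae_eq hf1 hf2)
  have hFg : MemLp (𝓕 g) 2 := (Lp.memLp _).ae_eq (fourierTransform_toLp_ae_eq hg1 hg2)
  have hprod : Integrable (fun ξ => conj (𝓕 f ξ) * 𝓕 g ξ) := hFf.star.integrable_mul hFg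
  have hT1 : Tendsto (fun n : ℕ => ∫ ξ, conj (𝓕 f ξ) * (Complex.exp (-(b n) * ‖ξ‖ ^ 2) * 𝓕 g ξ))
      atTop (𝓝 (∫ ξ, conj (𝓕 f ξ) * (phase d τ ξ * 𝓕 g ξ))) := by
    refine tendsto_integral_of_dominated_convergence (fun ξ => ‖conj (𝓕 f ξ) * 𝓕 g ξ‖) ?_
      hprod.norm ?_ ?_
    · intro n
      exact hFf.star.1.mul ((Continuous.aestronglyMeasurable (by fun_prop)).mul hFg.1)
    · intro n
      refine .of_forall fun ξ => ?_
      have : ‖Complex.exp (-(b n) * ‖ξ‖ ^ 2)‖ ≤ 1 := by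
        rw [Complex.norm_exp, Real.exp_le_one_iff, ← Complex.ofReal_pow, Complex.re_mul_ofReal,
          Complex.neg_re, hbre]
        have := hpos n
        nlinarith [sq_nonneg ‖ξ‖, mul_nonneg this.le (sq_nonneg ‖ξ‖)]
      rw [norm_mul, norm_mul, norm_mul]
      gcongr
      calc _ ≤ 1 * ‖𝓕 g ξ‖ := by gcongr
        _ = _ := one_mul _
    · refine .of_forall fun ξ => ?_
      refine Tendsto.const_mul _ (Tendsto.mul_const _ ?_)
      have h := tendsto_one_div_add_atTop_nhds_zero_nat (𝕜 := ℝ)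
      have h2 := (Complex.continuous_ofReal.tendsto 0).comp h
      have h3 : Tendsto b atTop (𝓝 (4 * Real.pi ^ 2 * τ * Complex.I)) := by
        simpa [b] using h2.add_const (4 * Real.pi ^ 2 * τ * Complex.I : ℂ)
      have h4 : phase d τ ξ = Complex.exp (-(4 * Real.pi ^ 2 * τ * Complex.I) * ‖ξ‖ ^ 2) := by
        rw [phase]; congr 1; push_cast; ring
      rw [h4]
      exact (Complex.continuous_exp.tendsto _).comp (h3.neg.mul_const _)
  have hfg : Integrable (fun p : EuclideanSpace ℝ (Fin d) × EuclideanSpace ℝ (Fin d) =>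
      conj (f p.1) * g p.2) :=
    Integrable.mul_prod (f := fun x => conj (f x))
      (LinearIsometryEquiv.integrable_comp_iff Complex.conjLIE |>.2 hf1) hg1
  have hT2 : Tendsto (fun n : ℕ => ∫ p : EuclideanSpace ℝ (Fin d) × EuclideanSpace ℝ (Fin d),
        conj (f p.1) * gaussianKernel d (b n) (p.1 - p.2) * g p.2) atTop
      (𝓝 (∫ p : EuclideanSpace ℝ (Fin d) × EuclideanSpace ℝ (Fin d),
        conj (f p.1) * schrodingerKernel d τ (p.1 - p.2) * g p.2)) := by
    refine tendsto_integral_of_dominated_convergence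
      (fun p => (Real.pi / (4 * Real.pi ^ 2 * |τ|)) ^ ((d : ℝ) / 2) * ‖conj (f p.1) * g p.2‖) ?_
      (hfg.norm.const_mul _) ?_ ?_
    · intro n
      have : (fun p : EuclideanSpace ℝ (Fin d) × EuclideanSpace ℝ (Fin d) =>
        conj (f p.1) * gaussianKernel d (b n) (p.1 - p.2) * g p.2) =
        fun p => gaussianKernel d (b n) (p.1 - p.2) * (conj (f p.1) * g p.2) := by
        ext p; ring
      rw [this]
      refine AEStronglyMeasurable.mul (Continuous.aestronglyMeasurable ?_) hfg.1
      unfold gaussianKernel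
      fun_prop
    · intro n
      refine .of_forall fun p => ?_
      have hK := norm_gaussianKernel_le d (b := b n) (r := 4 * Real.pi ^ 2 * |τ|)
        (by rw [hbre]; exact (hpos n).le)
        (by intro h; have := hbre n; rw [h] at this; simp at this; have := hpos n; simp at this; linarith)
        (by have := abs_pos.2 hτ; positivity)
        (by
          refine le_trans (le_of_eq ?_) (Complex.abs_im_le_norm _)
          rw [hbim, abs_mul, abs_of_pos (a := 4 * Real.pi ^ 2) (by positivity)]) (p.1 - p.2)
      rw [norm_mul, norm_mul, norm_mul, mul_comm ‖conj (f p.1)‖, mul_assoc]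
      gcongr
    · refine .of_forall fun p => ?_
      exact ((tendsto_gaussianKernel d hτ _).const_mul _).mul_const _
  rw [hL]
  refine tendsto_nhds_unique hT1 ?_
  refine hT2.congr fun n => ?_
  exact (integral_conj_fourier_gaussian hf1 hg1 (by rw [hbre]; exact hpos n)).symm

theorem integrable_conj_mul_schrodingerKernel_mul {d : ℕ} {f g : EuclideanSpace ℝ (Fin d) → ℂ}
    (hf : Integrable f) (hg : Integrable g) {τ : ℝ} (hτ : τ ≠ 0) :
    Integrable (fun p : EuclideanSpace ℝ (Fin d) × EuclideanSpace ℝ (Fin d) =>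
        conj (f p.1) * schrodingerKernel d τ (p.1 - p.2) * g p.2) := by
  have hfg : Integrable (fun p : EuclideanSpace ℝ (Fin d) × EuclideanSpace ℝ (Fin d) =>
      conj (f p.1) * g p.2) :=
    Integrable.mul_prod (f := fun x => conj (f x))
      (LinearIsometryEquiv.integrable_comp_iff Complex.conjLIE |>.2 hf) hg
  have : (fun p : EuclideanSpace ℝ (Fin d) × EuclideanSpace ℝ (Fin d) =>
        conj (f p.1) * schrodingerKernel d τ (p.1 - p.2) * g p.2) =
        fun p => schrodingerKernel d τ (p.1 - p.2) * (conj (f p.1) * g p.2) := by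
    ext p; ring
  rw [this]
  refine hfg.bdd_mul (c := |τ| ^ (-((d : ℝ) / 2))) ?_
    (.of_forall fun p => norm_schrodingerKernel_le d hτ _)
  exact (Measurable.comp (measurable_schrodingerKernel d)
    (measurable_const.prodMk (measurable_fst.sub measurable_snd))).aestronglyMeasurable

/-- `e^{iτΔ}` is given by its integral kernel on `L¹ ∩ L²`. -/
theorem propagator_toLp_ae_eq {d : ℕ} {g : EuclideanSpace ℝ (Fin d) → ℂ}
    (hg1 : Integrable g) (hg2 : MemLp g 2) {τ : ℝ} (hτ : τ ≠ 0) :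
    (propagator d τ hg2.toLp : EuclideanSpace ℝ (Fin d) → ℂ) =ᵐ[volume]
      fun x => ∫ y, schrodingerKernel d τ (x - y) * g y := by
  have hbound : ∀ x, ‖∫ y, schrodingerKernel d τ (x - y) * g y‖ ≤
      ∫ y, |τ| ^ (-((d : ℝ) / 2)) * ‖g y‖ := by
    intro x
    refine norm_integral_le_of_norm_le (hg1.norm.const_mul _) (.of_forall fun y => ?_)
    rw [norm_mul]
    gcongr
    exact norm_schrodingerKernel_le d hτ _
  have hmeas : AEStronglyMeasurable (fun x => ∫ y, schrodingerKernel d τ (x - y) * g y) volume := by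
    refine AEStronglyMeasurable.integral_prod_right'
      (f := fun p : EuclideanSpace ℝ (Fin d) × EuclideanSpace ℝ (Fin d) =>
        schrodingerKernel d τ (p.1 - p.2) * g p.2) ?_
    refine AEStronglyMeasurable.mul ?_ hg1.1.comp_snd
    exact (Measurable.comp (measurable_schrodingerKernel d)
      (measurable_const.prodMk (measurable_fst.sub measurable_snd))).aestronglyMeasurable
  refine ae_eq_of_integral_contDiff_smul_eq
    ((Lp.memLp _).locallyIntegrable one_le_two)
    ((memLp_top_of_bound hmeas _ (.of_forall hbound)).locallyIntegrable le_top) ?_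
  intro φ hφ hφs
  have hφs' : HasCompactSupport (fun x => (φ x : ℂ)) :=
    hφs.comp_left (g := fun r : ℝ => (r : ℂ)) (by simp)
  have hφc : Continuous (fun x => (φ x : ℂ)) := Complex.continuous_ofReal.comp hφ.continuous
  have h1 : Integrable (fun x => (φ x : ℂ)) := hφc.integrable_of_hasCompactSupport hφs'
  have h2 : MemLp (fun x => (φ x : ℂ)) 2 := hφc.memLp_of_hasCompactSupport hφs'
  have key := inner_propagator_eq_integral h1 h2 hg1 hg2 hτ
  rw [inner_eq_integral, Measure.volume_eq_prod, integral_prod] at key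
  · calc ∫ x, φ x • (propagator d τ hg2.toLp) x
        = ∫ x, conj ((h2.toLp (μ := volume) : L2 d) x) * (propagator d τ hg2.toLp) x := by
          refine integral_congr_ae ?_
          filter_upwards [h2.coeFn_toLp] with x hx
          simp [hx, Complex.conj_ofReal]
      _ = _ := key
      _ = _ := by
          refine integral_congr_ae (.of_forall fun x => ?_)
          simp [Complex.conj_ofReal, mul_assoc, integral_const_mul]
  · exact integrable_conj_mul_schrodingerKernel_mul h1 hg1 hτ

/-! ### Jointly measurable versions of the evolution -/

/-- ∑ₖ |Fₖ - f|² has finite integral, so it is finite almost everywhere and its terms tend to 0. No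
subsequence is extracted, which lets one approximating sequence serve all times at once. -/
theorem tendsto_ae_of_summable_norm_sq {α : Type*} {m : MeasurableSpace α} {μ : Measure α}
    {F : ℕ → Lp ℂ 2 μ} {f : Lp ℂ 2 μ} (h : ∑' k, ‖F k - f‖ₑ ^ 2 ≠ ∞) :
    ∀ᵐ x ∂μ, Tendsto (fun k => F k x) atTop (𝓝 (f x)) := by
  have hsum : ∫⁻ x, ∑' k, ‖(F k - f : Lp ℂ 2 μ) x‖ₑ ^ 2 ∂μ ≠ ∞ := by
    rw [lintegral_tsum (fun k => ((Lp.aestronglyMeasurable _).enorm.pow_const _))]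
    convert h with k
    rw [Lp.enorm_def, eLpNorm_eq_lintegral_rpow_enorm_toReal (by simp) (by simp), ← ENNReal.rpow_natCast,
      ← ENNReal.rpow_mul]
    simp
  have hfin := ae_lt_top' (AEMeasurable.tsum
    (fun k => ((Lp.aestronglyMeasurable (F k - f)).enorm.pow_const 2))) hsum
  filter_upwards [hfin, ae_all_iff.2 fun k => Lp.coeFn_sub (F k) f] with x hx h2
  have h3 := ENNReal.tendsto_atTop_zero_of_tsum_ne_top hx.ne
  rw [tendsto_iff_edist_tendsto_0]
  have h4 : Tendsto (fun k => (‖(F k - f : Lp ℂ 2 μ) x‖ₑ ^ 2) ^ (1 / 2 : ℝ)) atTop (𝓝 0) := by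
    have := (ENNReal.continuous_rpow_const (y := (1 / 2 : ℝ))).tendsto 0 |>.comp h3
    rwa [ENNReal.zero_rpow_of_pos (by norm_num)] at this
  refine h4.congr fun k => ?_
  rw [h2 k, edist_eq_enorm_sub, Pi.sub_apply, ← ENNReal.rpow_natCast, ← ENNReal.rpow_mul]
  simp

/-- A jointly measurable version of `(t, x) ↦ (e^{itΔ} u)(x)`. -/
theorem exists_measurable_propagator {d : ℕ} (u : L2 d) :
    ∃ w : ℝ × EuclideanSpace ℝ (Fin d) → ℂ, Measurable w ∧
      ∀ t : ℝ, t ≠ 0 → (propagator d t u : EuclideanSpace ℝ (Fin d) → ℂ) =ᵐ[volume]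
        fun x => w (t, x) := by
  have hε : ∀ k : ℕ, ENNReal.ofReal ((1 / 2 : ℝ) ^ k) ≠ 0 := fun k => by
    simp
  -- Continuous compactly supported approximants at L² distance 2^{-k}: by unitarity the propagated
  -- errors keep this size, so their squares sum to a finite total at every time.
  choose g hgs hge hgc hg2 using fun k : ℕ =>
    (Lp.memLp u).exists_hasCompactSupport_eLpNorm_sub_le (by simp) (hε k)
  have hg1 : ∀ k, Integrable (g k) := fun k => (hgc k).integrable_of_hasCompactSupport (hgs k)
  let W : ℕ → ℝ × EuclideanSpace ℝ (Fin d) → ℂ := fun k p =>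
    ∫ y, schrodingerKernel d p.1 (p.2 - y) * g k y
  have hW : ∀ k, StronglyMeasurable (W k) := by
    intro k
    refine StronglyMeasurable.integral_prod_right'
      (f := fun q : (ℝ × EuclideanSpace ℝ (Fin d)) × EuclideanSpace ℝ (Fin d) =>
        schrodingerKernel d q.1.1 (q.1.2 - q.2) * g k q.2) ?_
    refine StronglyMeasurable.mul ?_ ((hgc k).stronglyMeasurable.comp_measurable measurable_snd)
    exact (Measurable.comp (measurable_schrodingerKernel d)
      ((measurable_fst.comp measurable_fst).prodMk
        ((measurable_snd.comp measurable_fst).sub measurable_snd))).stronglyMeasurable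
  -- `limUnder` is measurable everywhere, with a default value where the sequence diverges; for each
  -- t ≠ 0 that concerns only a null set of x.
  refine ⟨fun p => limUnder atTop (fun k => W k p), (StronglyMeasurable.limUnder hW).measurable, ?_⟩
  intro t ht
  have hlim : ∀ᵐ x, Tendsto (fun k => propagator d t (hg2 k).toLp x) atTop
      (𝓝 (propagator d t u x)) := by
    refine tendsto_ae_of_summable_norm_sq (ne_top_of_le_ne_top
      (b := ∑' k : ℕ, ENNReal.ofReal ((1 / 4 : ℝ) ^ k)) ?_ (ENNReal.tsum_le_tsum fun k => ?_))
    · rw [← ENNReal.ofReal_tsum_of_nonneg (fun k => by positivity)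
        (summable_geometric_of_lt_one (by norm_num) (by norm_num))]
      exact ENNReal.ofReal_ne_top
    · have h1 : ‖propagator d t (hg2 k).toLp - propagator d t u‖ₑ = ‖(hg2 k).toLp - u‖ₑ := by
        rw [← map_sub, ← ofReal_norm, norm_propagator, ofReal_norm]
      have h2 : ‖(hg2 k).toLp - u‖ₑ ≤ ENNReal.ofReal ((1 / 2 : ℝ) ^ k) := by
        rw [← enorm_neg, neg_sub]
        nth_rw 1 [← Lp.toLp_coeFn u (Lp.memLp u)]
        rw [← MemLp.toLp_sub, Lp.enorm_toLp]
        exact hge k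
      calc _ ≤ ENNReal.ofReal ((1 / 2 : ℝ) ^ k) ^ 2 := by rw [h1]; gcongr
        _ = ENNReal.ofReal ((1 / 4 : ℝ) ^ k) := by
          rw [← ENNReal.ofReal_pow (by positivity), ← pow_mul, mul_comm, pow_mul]
          norm_num
  filter_upwards [hlim, ae_all_iff.2 fun k => propagator_toLp_ae_eq (hg1 k) (hg2 k) ht]
    with x h1 h2
  refine (Tendsto.limUnder_eq ?_).symm
  exact h1.congr h2

/-! ### The Hardy–Littlewood–Sobolev inequality on the line -/

theorem lintegral_comp_abs_le (F : ℝ → ℝ≥0∞) (t : ℝ) :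
    ∫⁻ s, F |t - s| ≤ 2 * ∫⁻ x in Set.Ioi 0, F x := by
  rw [lintegral_sub_left_eq_self (fun x => F |x|) t]
  have h1 : ∫⁻ x in Set.Ioi 0, F |x| = ∫⁻ x in Set.Ioi 0, F x :=
    setLIntegral_congr_fun measurableSet_Ioi fun x hx => by rw [abs_of_pos hx]
  have h2 : ∫⁻ x in Set.Iio 0, F |x| = ∫⁻ x in Set.Ioi 0, F x := by
    rw [← h1]
    have := (Measure.measurePreserving_neg (volume : Measure ℝ)).setLIntegral_comp_emb
      (MeasurableEquiv.neg ℝ).measurableEmbedding (fun x => F |x|) (Set.Iio 0)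
    simpa using this
  calc ∫⁻ x, F |x| = ∫⁻ x in Set.Iio 0 ∪ Set.Ioi 0, F |x| := by
        rw [← setLIntegral_univ]
        refine setLIntegral_congr ?_
        rw [Set.Iio_union_Ioi]
        exact (ae_eq_univ.2 (by simp)).symm
    _ ≤ _ := lintegral_union_le _ _ _
    _ = _ := by rw [h1, h2, two_mul]

/-- The exponent δ may be negative: besides the singular kernel, the formula also serves the
integrals of λ^{a-1} over thresholds, with δ = 1 - a. -/
theorem lintegral_Ioc_rpow_neg {δ R : ℝ} (hδ1 : δ < 1) (hR : 0 < R) :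
    ∫⁻ x in Set.Ioc 0 R, ENNReal.ofReal (x ^ (-δ)) = ENNReal.ofReal (R ^ (1 - δ) / (1 - δ)) := by
  rw [← ofReal_integral_eq_lintegral_ofReal, ← intervalIntegral.integral_of_le hR.le,
    integral_rpow (Or.inl (by linarith)), Real.zero_rpow (by linarith)]
  · congr 2 <;> ring_nf
  · exact (intervalIntegral.intervalIntegrable_rpow' (by linarith)).1
  · filter_upwards [ae_restrict_mem measurableSet_Ioc] with x hx
    exact Real.rpow_nonneg hx.1.le _

theorem lintegral_Ioi_rpow_neg_two {R : ℝ} (hR : 0 < R) :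
    ∫⁻ x in Set.Ioi R, ENNReal.ofReal (x ^ (-2 : ℝ)) = ENNReal.ofReal R⁻¹ := by
  rw [← ofReal_integral_eq_lintegral_ofReal, integral_Ioi_rpow_of_lt (by norm_num) hR]
  · norm_num [Real.rpow_neg_one]
  · exact integrableOn_Ioi_rpow_of_lt (by norm_num) hR
  · filter_upwards [ae_restrict_mem measurableSet_Ioi] with x hx
    exact Real.rpow_nonneg (hR.trans hx).le _

/-- The truncated potential estimate behind the Hardy–Littlewood–Sobolev inequality. -/
theorem lintegral_truncated_mul_rpow_le {δ : ℝ} (hδ0 : 0 < δ) (hδ1 : δ < 1) {f : ℝ → ℝ≥0∞}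
    (hf : Measurable f) (a : ℝ≥0∞) {R : ℝ} (hR : 0 < R) (t : ℝ) :
    ∫⁻ s, {s | f s ≤ a}.indicator (fun s => f s * ENNReal.ofReal (|t - s| ^ (-δ))) s ≤
      a * (2 * ENNReal.ofReal (R ^ (1 - δ) / (1 - δ))) +
        (∫⁻ s, f s ^ (2 / (2 - δ))) ^ (1 / (2 / (2 - δ))) *
          (2 * ENNReal.ofReal R⁻¹) ^ (1 / (2 / δ)) := by
  -- The kernel is cut at distance R. Near the diagonal f is replaced by its bound a; away from it
  -- Hölder is used.
  let k₁ : ℝ → ℝ≥0∞ := fun x => (Set.Ioc 0 R).indicator (fun x => ENNReal.ofReal (x ^ (-δ))) x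
  let k₂ : ℝ → ℝ≥0∞ := fun x => (Set.Ioi R).indicator (fun x => ENNReal.ofReal (x ^ (-δ))) x
  have hm1 : Measurable k₁ := by
    refine Measurable.indicator ?_ measurableSet_Ioc
    fun_prop
  have hm2 : Measurable k₂ := by
    refine Measurable.indicator ?_ measurableSet_Ioi
    fun_prop
  have hm2' : Measurable fun s => k₂ |t - s| := hm2.comp (by fun_prop)
  have hpt : ∀ s, {s | f s ≤ a}.indicator (fun s => f s * ENNReal.ofReal (|t - s| ^ (-δ))) s ≤
      a * k₁ |t - s| + f s * k₂ |t - s| := by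
    intro s
    by_cases hs : f s ≤ a
    · rw [Set.indicator_of_mem (by exact hs)]
      rcases eq_or_lt_of_le (abs_nonneg (t - s)) with h0 | h0
      -- On the diagonal the real power 0^{-δ} is 0 by convention, so this point contributes
      -- nothing.
      · rw [← h0, Real.zero_rpow (by linarith)]; simp
      · rcases le_or_gt |t - s| R with h | h
        · have : k₁ |t - s| = ENNReal.ofReal (|t - s| ^ (-δ)) :=
            Set.indicator_of_mem (s := Set.Ioc 0 R) (by exact ⟨h0, h⟩) _
          rw [this]
          exact le_add_right (by gcongr)
        · have : k₂ |t - s| = ENNReal.ofReal (|t - s| ^ (-δ)) :=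
            Set.indicator_of_mem (s := Set.Ioi R) (by exact h) _
          rw [this]
          exact le_add_left le_rfl
    · rw [Set.indicator_of_notMem (by exact hs)]
      exact zero_le
  refine (lintegral_mono hpt).trans ?_
  rw [lintegral_add_right _ (by exact hf.mul hm2'), lintegral_const_mul _
    (show Measurable fun s => k₁ |t - s| from hm1.comp (by fun_prop))]
  gcongr ?_ + ?_
  · gcongr
    refine (lintegral_comp_abs_le k₁ t).trans (le_of_eq ?_)
    congr 1
    rw [← lintegral_Ioc_rpow_neg hδ1 hR]
    simp only [k₁]
    rw [setLIntegral_indicator measurableSet_Ioc]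
    congr 2
    ext x
    simp +contextual
  -- The conjugate exponent 2/δ turns |x|^{-δ} into |x|^{-2}, integrable at infinity.
  · have hconj : (2 / (2 - δ)).HolderConjugate (2 / δ) := by
      rw [Real.holderConjugate_iff]
      constructor
      · rw [lt_div_iff₀ (by linarith)]; linarith
      · have : 2 - δ ≠ 0 := by linarith
        field_simp
        ring
    refine (ENNReal.lintegral_mul_le_Lp_mul_Lq volume hconj hf.aemeasurable
      hm2'.aemeasurable).trans ?_
    gcongr
    refine (lintegral_comp_abs_le (fun x => k₂ x ^ (2 / δ)) t).trans (le_of_eq ?_)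
    congr 1
    rw [← lintegral_Ioi_rpow_neg_two hR]
    have : ∀ x, k₂ x ^ (2 / δ) = (Set.Ioi R).indicator (fun x => ENNReal.ofReal (x ^ (-2 : ℝ))) x := by
      intro x
      simp only [k₂]
      by_cases hx : x ∈ Set.Ioi R
      · rw [Set.indicator_of_mem hx, Set.indicator_of_mem hx,
          ENNReal.ofReal_rpow_of_pos (Real.rpow_pos_of_pos (hR.trans hx) _),
          ← Real.rpow_mul (hR.trans hx).le]
        congr 2
        field_simp
      · rw [Set.indicator_of_notMem hx, Set.indicator_of_notMem hx,
          ENNReal.zero_rpow_of_pos (by positivity)]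
    simp only [this]
    rw [setLIntegral_indicator measurableSet_Ioi]
    congr 2
    ext x
    simp
    intro h
    exact hR.trans h

/-- The symmetric Hardy–Littlewood–Sobolev inequality on the line. -/
theorem exists_hardyLittlewoodSobolev {δ : ℝ} (hδ0 : 0 < δ) (hδ1 : δ < 1) :
    ∃ C : ℝ, 0 < C ∧ ∀ f : ℝ → ℝ≥0∞, Measurable f →
      ∫⁻ t, ∫⁻ s, f t * f s * ENNReal.ofReal (|t - s| ^ (-δ)) ≤
        ENNReal.ofReal C * (∫⁻ t, f t ^ (2 / (2 - δ))) ^ (2 - δ) := by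
  have h2δ : 0 < 2 - δ := by linarith
  have hr : 0 < 2 / (2 - δ) := by positivity
  have h1δ : 0 < 1 - δ := by linarith
  -- The two summands are the near and far contributions; the outer 2 pays for the symmetrisation to
  -- the region f(s) ≤ f(t).
  refine ⟨2 * (2 / (1 - δ) + 2 ^ (δ / 2)), by positivity, fun f hf => ?_⟩
  set r := 2 / (2 - δ) with hrdef
  set A := ∫⁻ t, f t ^ r with hA
  have hrδ : r * δ = 2 * r - 2 := by rw [hrdef]; field_simp; ring
  rcases eq_or_ne A 0 with hA0 | hA0
  · have : f =ᵐ[volume] 0 := by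
      have := (lintegral_eq_zero_iff (hf.pow_const r)).1 hA0
      filter_upwards [this] with t ht
      simpa [ENNReal.rpow_eq_zero_iff, hr, hr.le, not_lt.2 hr.le] using ht
    have h0 : ∫⁻ t, ∫⁻ s, f t * f s * ENNReal.ofReal (|t - s| ^ (-δ)) = 0 := by
      rw [lintegral_congr_ae (g := fun _ => 0)]
      · simp
      · filter_upwards [this] with t ht
        simp [ht]
    rw [h0]
    exact zero_le
  rcases eq_or_ne A ∞ with hAt | hAt
  · rw [hAt, ENNReal.top_rpow_of_pos h2δ, ENNReal.mul_top]
    · exact le_top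
    · rw [ENNReal.ofReal_ne_zero_iff]
      have : 0 < 1 - δ := by linarith
      positivity
  have hk : Measurable fun p : ℝ × ℝ => ENNReal.ofReal (|p.1 - p.2| ^ (-δ)) := by fun_prop
  let g : ℝ → ℝ → ℝ≥0∞ := fun t s =>
    {s | f s ≤ f t}.indicator (fun s => f s * ENNReal.ofReal (|t - s| ^ (-δ))) s
  have hg : Measurable fun p : ℝ × ℝ => f p.1 * g p.1 p.2 := by
    refine (hf.comp measurable_fst).mul ?_
    have : (fun p : ℝ × ℝ => g p.1 p.2) = {p : ℝ × ℝ | f p.2 ≤ f p.1}.indicator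
        (fun p => f p.2 * ENNReal.ofReal (|p.1 - p.2| ^ (-δ))) := by
      ext p
      simp [g, Set.indicator_apply]
    rw [this]
    exact ((hf.comp measurable_snd).mul hk).indicator
      (measurableSet_le (hf.comp measurable_snd) (hf.comp measurable_fst))
  have hsymm : ∀ t s, f t * f s * ENNReal.ofReal (|t - s| ^ (-δ)) ≤ f t * g t s + f s * g s t := by
    intro t s
    rcases le_total (f s) (f t) with h | h
    · refine le_add_right (le_of_eq ?_)
      simp only [g]
      rw [Set.indicator_of_mem (by exact h), mul_assoc]
    · refine le_add_left (le_of_eq ?_)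
      simp only [g]
      rw [Set.indicator_of_mem (by exact h), abs_sub_comm]
      ring
  have hinner : ∀ᵐ t, f t * ∫⁻ s, g t s ≤
      ENNReal.ofReal (2 / (1 - δ) + 2 ^ (δ / 2)) * A ^ (1 - δ) * f t ^ r := by
    filter_upwards [ae_lt_top (hf.pow_const r) hAt] with t ht
    rcases eq_or_ne (f t) 0 with h0 | h0
    · simp [h0]
    have htop : f t ≠ ∞ := by
      intro h
      rw [h, ENNReal.top_rpow_of_pos hr] at ht
      exact lt_irrefl _ ht
    -- R = A f(t)^{-r} balances the near and far terms: both become multiples of A^{1-δ} f(t)^{r-1}.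
    -- This is why f(t) must be neither 0 nor ∞ here.
    have hR : 0 < (A * f t ^ (-r)).toReal := by
      refine ENNReal.toReal_pos ?_ ?_
      · refine mul_ne_zero hA0 ?_
        simp [ENNReal.rpow_eq_zero_iff, h0, htop]
      · refine ENNReal.mul_ne_top hAt ?_
        simp [ENNReal.rpow_eq_top_iff, h0, htop]
    have hRe : ENNReal.ofReal (A * f t ^ (-r)).toReal = A * f t ^ (-r) := by
      refine ENNReal.ofReal_toReal (ENNReal.mul_ne_top hAt ?_)
      simp [ENNReal.rpow_eq_top_iff, h0, htop]
    have h := lintegral_truncated_mul_rpow_le hδ0 hδ1 hf (f t) hR t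
    have e1 : f t * (2 * ENNReal.ofReal ((A * f t ^ (-r)).toReal ^ (1 - δ) / (1 - δ))) =
        ENNReal.ofReal (2 / (1 - δ)) * (A ^ (1 - δ) * f t ^ (r - 1)) := by
      rw [div_eq_mul_inv, ENNReal.ofReal_mul (by positivity), div_eq_mul_inv,
        ENNReal.ofReal_mul (by positivity), ← ENNReal.ofReal_rpow_of_pos hR, hRe,
        ENNReal.mul_rpow_of_nonneg _ _ h1δ.le, ← ENNReal.rpow_mul]
      have : r - 1 = 1 + (-r * (1 - δ)) := by linarith
      rw [this, ENNReal.rpow_add _ _ h0 htop, ENNReal.rpow_one]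
      simp only [ENNReal.ofReal_ofNat]
      ring
    have e2 : A ^ (1 / r) * (2 * ENNReal.ofReal ((A * f t ^ (-r)).toReal)⁻¹) ^ (1 / (2 / δ)) =
        ENNReal.ofReal (2 ^ (δ / 2)) * (A ^ (1 - δ) * f t ^ (r - 1)) := by
      rw [ENNReal.ofReal_inv_of_pos hR, hRe, show 1 / (2 / δ) = δ / 2 from one_div_div _ _,
        ENNReal.mul_rpow_of_nonneg _ _ (by positivity), ← ENNReal.rpow_neg_one,
        ENNReal.mul_rpow_of_ne_top hAt (by simp [ENNReal.rpow_eq_top_iff, h0, htop]),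
        ENNReal.mul_rpow_of_ne_zero (by simp [hAt])
        (by simp [ENNReal.rpow_eq_zero_iff, ENNReal.rpow_eq_top_iff, h0, htop]),
        ← ENNReal.rpow_mul, ← ENNReal.rpow_mul, ← ENNReal.rpow_mul,
        ← ENNReal.ofReal_rpow_of_pos two_pos, ENNReal.ofReal_ofNat]
      have e3 : r - 1 = -r * (-1 * (δ / 2)) := by linarith
      have e4 : 1 - δ = 1 / r + -1 * (δ / 2) := by
        rw [hrdef]; field_simp; ring
      rw [← e3, e4, ENNReal.rpow_add _ _ hA0 hAt]
      ring
    rw [← hrdef, ← hA, e1, e2, ← add_mul, ← ENNReal.ofReal_add (by positivity) (by positivity)] at h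
    calc f t * ∫⁻ s, g t s ≤ f t * (ENNReal.ofReal (2 / (1 - δ) + 2 ^ (δ / 2)) *
          (A ^ (1 - δ) * f t ^ (r - 1))) := by gcongr
      _ = ENNReal.ofReal (2 / (1 - δ) + 2 ^ (δ / 2)) * A ^ (1 - δ) * (f t ^ (1 : ℝ) * f t ^ (r - 1)) := by
        rw [ENNReal.rpow_one]; ring
      _ = _ := by
        rw [← ENNReal.rpow_add _ _ h0 htop]
        congr 2
        ring
  have hone : ∫⁻ t, ∫⁻ s, f t * g t s ≤
      ENNReal.ofReal (2 / (1 - δ) + 2 ^ (δ / 2)) * A ^ (2 - δ) := by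
    calc ∫⁻ t, ∫⁻ s, f t * g t s = ∫⁻ t, f t * ∫⁻ s, g t s := by
          refine lintegral_congr fun t => ?_
          refine lintegral_const_mul _ ?_
          exact (hf.mul (by fun_prop)).indicator (measurableSet_le hf measurable_const)
      _ ≤ ∫⁻ t, ENNReal.ofReal (2 / (1 - δ) + 2 ^ (δ / 2)) * A ^ (1 - δ) * f t ^ r :=
          lintegral_mono_ae hinner
      _ = ENNReal.ofReal (2 / (1 - δ) + 2 ^ (δ / 2)) * (A ^ (1 - δ) * A ^ (1 : ℝ)) := by
          rw [lintegral_const_mul _ (hf.pow_const r), ← hA, ENNReal.rpow_one, mul_assoc]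
      _ = _ := by
          rw [← ENNReal.rpow_add _ _ hA0 hAt]
          congr 2
          ring
  calc ∫⁻ t, ∫⁻ s, f t * f s * ENNReal.ofReal (|t - s| ^ (-δ))
      ≤ ∫⁻ t, ∫⁻ s, (f t * g t s + f s * g s t) := by
        gcongr with t s
        exact hsymm t s
    _ = ∫⁻ t, ((∫⁻ s, f t * g t s) + ∫⁻ s, f s * g s t) := by
        refine lintegral_congr fun t => ?_
        exact lintegral_add_left (hg.comp (measurable_const.prodMk measurable_id)) _
    _ = (∫⁻ t, ∫⁻ s, f t * g t s) + ∫⁻ t, ∫⁻ s, f s * g s t :=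
        lintegral_add_left (Measurable.lintegral_prod_right hg) _
    _ = (∫⁻ t, ∫⁻ s, f t * g t s) + ∫⁻ t, ∫⁻ s, f t * g t s := by
        congr 1
        exact lintegral_lintegral_swap (f := fun t s => f s * g s t)
          (hg.comp measurable_swap).aemeasurable
    _ ≤ ENNReal.ofReal (2 / (1 - δ) + 2 ^ (δ / 2)) * A ^ (2 - δ) +
        ENNReal.ofReal (2 / (1 - δ) + 2 ^ (δ / 2)) * A ^ (2 - δ) := add_le_add hone hone
    _ = _ := by
        rw [← two_mul, ← mul_assoc, ENNReal.ofReal_mul two_pos.le, ENNReal.ofReal_ofNat]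

/-! ### The operator norm of the truncated kernel -/

/-- The point is the form of the integrand: for each σ it is 1_{σ<a} · b 1_{σb<m}, a product of a
function of a and a function of b. Thus min(V₁(x)V₂(y), m) is a superposition of products of
multipliers, which can be absorbed into the two vectors on either side of a unitary operator. -/
theorem integral_Ioc_ite_eq_min {M a b m : ℝ} (ha : 0 ≤ a) (haM : a ≤ M) (hb : 0 ≤ b)
    (hm : 0 < m) :
    ∫ σ in Set.Ioc 0 M, (if σ < a ∧ σ * b < m then b else 0) = min (a * b) m := by
  rcases hb.eq_or_lt with rfl | hb
  · simp [hm.le]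
  have hc : 0 ≤ min a (m / b) := le_min ha (by positivity)
  have h1 : ∀ σ, 0 < σ → (if σ < a ∧ σ * b < m then b else 0) =
      (Set.Ioo 0 (min a (m / b))).indicator (fun _ => b) σ := by
    intro σ hσ
    simp only [Set.indicator_apply, Set.mem_Ioo, lt_min_iff, hσ, true_and, lt_div_iff₀ hb]
  rw [setIntegral_congr_fun measurableSet_Ioc (fun σ hσ => h1 σ hσ.1),
    setIntegral_indicator measurableSet_Ioo]
  have h2 : Set.Ioc 0 M ∩ Set.Ioo 0 (min a (m / b)) = Set.Ioo 0 (min a (m / b)) := by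
    refine Set.inter_eq_right.2 fun σ hσ => ⟨hσ.1, ?_⟩
    exact (hσ.2.le.trans (min_le_left _ _)).trans haM
  rw [h2, setIntegral_const, measureReal_def, Real.volume_Ioo, sub_zero, ENNReal.toReal_ofReal hc,
    smul_eq_mul, min_mul_of_nonneg _ _ hb.le, div_mul_cancel₀ _ hb.ne']

theorem lintegral_Ioi_indicator_lt_le (c : ℝ≥0∞) (a : ℝ) :
    ∫⁻ σ in Set.Ioi (0 : ℝ), c * (if σ < a then 1 else 0 : ℝ≥0∞) ≤ c * ENNReal.ofReal a := by
  rw [lintegral_const_mul _ (show Measurable fun σ : ℝ => (if σ < a then 1 else 0 : ℝ≥0∞) from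
    Measurable.ite (measurableSet_lt measurable_id measurable_const)
      measurable_const measurable_const)]
  gcongr
  have : ∀ σ : ℝ, (if σ < a then 1 else 0 : ℝ≥0∞) = (Set.Iio a).indicator 1 σ := by
    intro σ; simp [Set.indicator_apply]
  simp_rw [this]
  rw [setLIntegral_indicator measurableSet_Iio]
  simp [Set.Iio_inter_Ioi]

theorem enorm_sq_toLp {α : Type*} {m : MeasurableSpace α} {μ : Measure α} {f : α → ℂ}
    (hf : MemLp f 2 μ) : ‖hf.toLp‖ₑ ^ 2 = ∫⁻ x, ‖f x‖ₑ ^ 2 ∂μ := by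
  rw [Lp.enorm_toLp, eLpNorm_eq_lintegral_rpow_enorm_toReal (by simp) (by simp), ← ENNReal.rpow_natCast,
      ← ENNReal.rpow_mul]
  simp

theorem enorm_inner_le {H : Type*} [NormedAddCommGroup H] [InnerProductSpace ℂ H] (a b : H) :
    ‖inner ℂ a b‖ₑ ≤ ‖a‖ₑ * ‖b‖ₑ := by
  rw [← ofReal_norm, ← ofReal_norm, ← ofReal_norm, ← ENNReal.ofReal_mul (norm_nonneg _)]
  exact ENNReal.ofReal_le_ofReal (norm_inner_le_norm a b)

/-- The part of `√V₁ e^{iτΔ} √V₂` where `√(V₁(x) V₂(y))` is cut off at height `μ` has operator norm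
at most `μ`. -/
theorem enorm_integral_kernel_min_le {d : ℕ} {V₁ V₂ : EuclideanSpace ℝ (Fin d) → ℝ}
    (hV₁ : Measurable V₁) (hV₂ : Measurable V₂) {M : ℝ} (h₁0 : ∀ x, 0 ≤ V₁ x) (h₂0 : ∀ x, 0 ≤ V₂ x)
    (h₁M : ∀ x, V₁ x ≤ M) (h₂M : ∀ x, V₂ x ≤ M) {S : Set (EuclideanSpace ℝ (Fin d))}
    (hS : MeasurableSet S) (hSf : volume S ≠ ∞) (h₁S : ∀ x ∉ S, V₁ x = 0) (h₂S : ∀ x ∉ S, V₂ x = 0)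
    {w₁ w₂ : EuclideanSpace ℝ (Fin d) → ℂ} (hw₁ : MemLp w₁ 2) (hw₂ : MemLp w₂ 2)
    (hw₁m : Measurable w₁) (hw₂m : Measurable w₂)
    {τ : ℝ} (hτ : τ ≠ 0) {m : ℝ} (hm : 0 < m) :
    ‖∫ p : EuclideanSpace ℝ (Fin d) × EuclideanSpace ℝ (Fin d),
      conj (w₁ p.1) * schrodingerKernel d τ (p.1 - p.2) * w₂ p.2 *
        (min (V₁ p.1 * V₂ p.2) (m ^ 2) : ℝ)‖ₑ ≤
      ENNReal.ofReal m * ((∫⁻ x, ‖w₁ x‖ₑ ^ 2 * ENNReal.ofReal (V₁ x)) ^ (1 / 2 : ℝ) *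
        (∫⁻ x, ‖w₂ x‖ₑ ^ 2 * ENNReal.ofReal (V₂ x)) ^ (1 / 2 : ℝ)) := by
  have hm2 : 0 < m ^ 2 := by positivity
  have hM : 0 ≤ M := (h₁0 0).trans (h₁M 0)
  have : IsFiniteMeasure (volume.restrict S : Measure (EuclideanSpace ℝ (Fin d))) :=
    ⟨by simpa [Measure.restrict_apply_univ] using hSf.lt_top⟩
  -- The vectors at layer σ, carrying the two factors of the layer-cake formula. The support of V₁
  -- in a set of finite measure makes `a σ` integrable for σ > 0, as the kernel representation
  -- requires.
  let a : ℝ → EuclideanSpace ℝ (Fin d) → ℂ := fun σ x => if σ < V₁ x then w₁ x else 0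
  let b : ℝ → EuclideanSpace ℝ (Fin d) → ℂ := fun σ x =>
    if σ * V₂ x < m ^ 2 then (V₂ x : ℂ) * w₂ x else 0
  have int_ind : ∀ w : EuclideanSpace ℝ (Fin d) → ℂ, MemLp w 2 → Integrable (S.indicator w) := by
    intro w hw
    rw [integrable_indicator_iff hS]
    exact (hw.restrict S).integrable one_le_two
  have ha2 : ∀ σ, MemLp (a σ) 2 := by
    intro σ
    refine hw₁.of_le (Measurable.aestronglyMeasurable (Measurable.ite (measurableSet_lt measurable_const hV₁)
      hw₁m measurable_const)) (.of_forall fun x => ?_)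
    simp only [a]; split_ifs <;> simp
  have ha1 : ∀ σ, 0 < σ → Integrable (a σ) := by
    intro σ hσ
    refine (int_ind _ hw₁).mono (ha2 σ).1 (.of_forall fun x => ?_)
    simp only [a]
    split_ifs with h
    · rw [Set.indicator_of_mem]
      by_contra hx
      rw [h₁S x hx] at h
      linarith
    · simp
  have hVw2 : MemLp (fun x => (V₂ x : ℂ) * w₂ x) 2 := by
    refine hw₂.of_le_mul (c := M) (by fun_prop) (.of_forall fun x => ?_)
    rw [norm_mul, Complex.norm_real, Real.norm_of_nonneg (h₂0 x)]
    gcongr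
    exact h₂M x
  have hVw1 : Integrable (fun x => (V₂ x : ℂ) * w₂ x) := by
    refine (int_ind _ hVw2).congr (.of_forall fun x => ?_)
    by_cases hx : x ∈ S
    · simp [hx]
    · simp [hx, h₂S x hx]
  have hbm : ∀ σ, Measurable (b σ) := fun σ =>
    Measurable.ite (measurableSet_lt (by fun_prop) measurable_const)
      (by fun_prop) measurable_const
  have hb2 : ∀ σ, MemLp (b σ) 2 := by
    intro σ
    refine hVw2.of_le (hbm σ).aestronglyMeasurable (.of_forall fun x => ?_)
    simp only [b]; split_ifs <;> simp [mul_nonneg]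
  have hb1 : ∀ σ, Integrable (b σ) := by
    intro σ
    refine hVw1.mono (hbm σ).aestronglyMeasurable (.of_forall fun x => ?_)
    simp only [b]; split_ifs <;> simp [mul_nonneg]
  have hE : ∫ p : EuclideanSpace ℝ (Fin d) × EuclideanSpace ℝ (Fin d),
      conj (w₁ p.1) * schrodingerKernel d τ (p.1 - p.2) * w₂ p.2 *
        (min (V₁ p.1 * V₂ p.2) (m ^ 2) : ℝ) =
      ∫ σ in Set.Ioc 0 M, inner ℂ (ha2 σ).toLp (propagator d τ (hb2 σ).toLp) := by
    have e1 : ∀ p : EuclideanSpace ℝ (Fin d) × EuclideanSpace ℝ (Fin d),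
        conj (w₁ p.1) * schrodingerKernel d τ (p.1 - p.2) * w₂ p.2 *
          (min (V₁ p.1 * V₂ p.2) (m ^ 2) : ℝ) =
        ∫ σ in Set.Ioc 0 M, conj (a σ p.1) * schrodingerKernel d τ (p.1 - p.2) * b σ p.2 := by
      intro p
      rw [← integral_Ioc_ite_eq_min (h₁0 p.1) (h₁M p.1) (h₂0 p.2) hm2, ← integral_complex_ofReal,
        ← integral_const_mul]
      refine integral_congr_ae (.of_forall fun σ => ?_)
      simp only [a, b]
      by_cases h1 : σ < V₁ p.1 <;> by_cases h2 : σ * V₂ p.2 < m ^ 2 <;> simp [h1, h2]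
      ring
    simp_rw [e1]
    rw [integral_integral_swap]
    · refine setIntegral_congr_fun measurableSet_Ioc fun σ hσ => ?_
      exact (inner_propagator_eq_integral (ha1 σ hσ.1) (ha2 σ) (hb1 σ) (hb2 σ) hτ).symm
    · have h0 := integrable_conj_mul_schrodingerKernel_mul (int_ind _ hw₁) hVw1 hτ
      have h1 : Integrable (fun q : (EuclideanSpace ℝ (Fin d) × EuclideanSpace ℝ (Fin d)) × ℝ =>
          (conj (S.indicator w₁ q.1.1) * schrodingerKernel d τ (q.1.1 - q.1.2) *
            ((V₂ q.1.2 : ℂ) * w₂ q.1.2)) * (1 : ℂ)) (volume.prod (volume.restrict (Set.Ioc 0 M))) :=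
        h0.mul_prod (integrable_const (1 : ℂ))
      refine (h1.indicator (s := {q | 0 < q.2 ∧ q.2 < V₁ q.1.1 ∧ q.2 * V₂ q.1.2 < m ^ 2}) ?_).congr ?_
      · refine (measurableSet_lt measurable_const measurable_snd).inter
          ((measurableSet_lt measurable_snd (hV₁.comp (measurable_fst.comp measurable_fst))).inter
          (measurableSet_lt (measurable_snd.mul (hV₂.comp (measurable_snd.comp measurable_fst)))
            measurable_const))
      · have hpos : ∀ᵐ q : (EuclideanSpace ℝ (Fin d) × EuclideanSpace ℝ (Fin d)) × ℝ
            ∂(volume.prod (volume.restrict (Set.Ioc 0 M))), 0 < q.2 := by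
          refine Measure.quasiMeasurePreserving_snd.ae ?_
          filter_upwards [ae_restrict_mem measurableSet_Ioc] with σ hσ using hσ.1
        filter_upwards [hpos] with q hq
        simp only [Function.uncurry, a, b]
        by_cases h1 : q.2 < V₁ q.1.1 <;> by_cases h2 : q.2 * V₂ q.1.2 < m ^ 2
        · have hxS : q.1.1 ∈ S := by
            by_contra hx
            rw [h₁S _ hx] at h1
            linarith
          simp [h1, h2, hq, hxS]
        all_goals simp [h1, h2]
  rw [hE]
  -- Only unitarity of e^{iτΔ} enters the bound on each layer; the size of its kernel plays no role.
  have h1 : ‖∫ σ in Set.Ioc 0 M, inner ℂ (ha2 σ).toLp (propagator d τ (hb2 σ).toLp)‖ₑ ≤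
      ∫⁻ σ in Set.Ioi 0, (∫⁻ x, ‖a σ x‖ₑ ^ 2) ^ (1 / 2 : ℝ) * (∫⁻ x, ‖b σ x‖ₑ ^ 2) ^ (1 / 2 : ℝ) := by
    refine (enorm_integral_le_lintegral_enorm _).trans ?_
    refine (lintegral_mono_set Set.Ioc_subset_Ioi_self).trans (lintegral_mono fun σ => ?_)
    refine (enorm_inner_le _ _).trans (le_of_eq ?_)
    have hp : ‖propagator d τ (hb2 σ).toLp‖ₑ = ‖(hb2 σ).toLp‖ₑ := by
      rw [← ofReal_norm, norm_propagator, ofReal_norm]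
    rw [hp, ← enorm_sq_toLp (ha2 σ), ← enorm_sq_toLp (hb2 σ), ← ENNReal.rpow_natCast,
      ← ENNReal.rpow_mul, ← ENNReal.rpow_natCast, ← ENNReal.rpow_mul]
    simp
  have hma : Measurable fun q : ℝ × EuclideanSpace ℝ (Fin d) => ‖a q.1 q.2‖ₑ ^ 2 :=
    (Measurable.ite (measurableSet_lt measurable_fst (hV₁.comp measurable_snd))
      (hw₁m.comp measurable_snd) measurable_const).enorm.pow_const 2
  have hmb : Measurable fun q : ℝ × EuclideanSpace ℝ (Fin d) => ‖b q.1 q.2‖ₑ ^ 2 :=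
    (Measurable.ite (measurableSet_lt (by fun_prop) measurable_const)
      (by fun_prop) measurable_const).enorm.pow_const 2
  have hA : ∫⁻ σ in Set.Ioi 0, ∫⁻ x, ‖a σ x‖ₑ ^ 2 ≤ ∫⁻ x, ‖w₁ x‖ₑ ^ 2 * ENNReal.ofReal (V₁ x) := by
    rw [lintegral_lintegral_swap (by exact hma.aemeasurable)]
    refine lintegral_mono fun x => ?_
    calc ∫⁻ σ in Set.Ioi 0, ‖a σ x‖ₑ ^ 2
        = ∫⁻ σ in Set.Ioi 0, ‖w₁ x‖ₑ ^ 2 * (if σ < V₁ x then 1 else 0) := by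
          refine lintegral_congr fun σ => ?_
          simp only [a]; split_ifs <;> simp
      _ ≤ _ := lintegral_Ioi_indicator_lt_le _ _
  -- At each x the layer lives on 0 < σ < m²/V₂(x) with weight V₂(x)², which gives m² V₂(x). The
  -- square root in the final Cauchy–Schwarz in σ turns m² into m.
  have hB : ∫⁻ σ in Set.Ioi 0, ∫⁻ x, ‖b σ x‖ₑ ^ 2 ≤
      ENNReal.ofReal (m ^ 2) * ∫⁻ x, ‖w₂ x‖ₑ ^ 2 * ENNReal.ofReal (V₂ x) := by
    rw [lintegral_lintegral_swap (by exact hmb.aemeasurable),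
      ← lintegral_const_mul _ (by fun_prop)]
    refine lintegral_mono fun x => ?_
    rcases (h₂0 x).eq_or_lt with h0 | h0
    · simp [b, ← h0]
    calc ∫⁻ σ in Set.Ioi 0, ‖b σ x‖ₑ ^ 2
        = ∫⁻ σ in Set.Ioi 0, (ENNReal.ofReal (V₂ x) ^ 2 * ‖w₂ x‖ₑ ^ 2) *
            (if σ < m ^ 2 / V₂ x then 1 else 0) := by
          refine lintegral_congr fun σ => ?_
          simp only [b, lt_div_iff₀ h0]
          split_ifs
          · rw [enorm_mul, mul_pow, mul_one, ← ofReal_norm (V₂ x : ℂ), Complex.norm_real,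
              Real.norm_of_nonneg h0.le]
          · simp
      _ ≤ (ENNReal.ofReal (V₂ x) ^ 2 * ‖w₂ x‖ₑ ^ 2) * ENNReal.ofReal (m ^ 2 / V₂ x) :=
          lintegral_Ioi_indicator_lt_le _ _
      _ = _ := by
          have : ENNReal.ofReal (m ^ 2) = ENNReal.ofReal (V₂ x) * ENNReal.ofReal (m ^ 2 / V₂ x) := by
            rw [← ENNReal.ofReal_mul h0.le, mul_div_cancel₀ _ h0.ne']
          rw [this]
          ring
  refine h1.trans ?_
  refine (ENNReal.lintegral_mul_le_Lp_mul_Lq _ Real.HolderConjugate.two_two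
    (f := fun σ => (∫⁻ x, ‖a σ x‖ₑ ^ 2) ^ (1 / 2 : ℝ))
    (g := fun σ => (∫⁻ x, ‖b σ x‖ₑ ^ 2) ^ (1 / 2 : ℝ))
    (hma.lintegral_prod_right'.pow_const _).aemeasurable
    (hmb.lintegral_prod_right'.pow_const _).aemeasurable).trans ?_
  simp only [← ENNReal.rpow_mul]
  norm_num
  calc _ ≤ (∫⁻ x, ‖w₁ x‖ₑ ^ 2 * ENNReal.ofReal (V₁ x)) ^ (1 / 2 : ℝ) *
        (ENNReal.ofReal (m ^ 2) * ∫⁻ x, ‖w₂ x‖ₑ ^ 2 * ENNReal.ofReal (V₂ x)) ^ (1 / 2 : ℝ) := by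
        gcongr
    _ = _ := by
        rw [ENNReal.mul_rpow_of_nonneg _ _ (by norm_num), ENNReal.ofReal_rpow_of_pos hm2,
          ← Real.sqrt_eq_rpow, Real.sqrt_sq hm.le]
        ring

/-! ### The averaged operator and its TT* form -/

/-- In a second countable space every open set is a countable union of balls, so distances to fixed
vectors decide measurability. For L²-valued functions of time these distances are integrals of
jointly measurable functions. -/
theorem stronglyMeasurable_of_measurable_norm_sub {α F : Type*} [MeasurableSpace α]
    [NormedAddCommGroup F] [SecondCountableTopology F] {f : α → F}
    (h : ∀ g : F, Measurable fun a => ‖f a - g‖) : StronglyMeasurable f := by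
  borelize F
  refine Measurable.stronglyMeasurable (measurable_of_isOpen fun O hO => ?_)
  choose ε hε hεO using fun x : O => Metric.isOpen_iff.1 hO x x.2
  obtain ⟨T, hT, hTO⟩ := TopologicalSpace.isOpen_iUnion_countable
    (fun x : O => Metric.ball (x : F) (ε x)) fun x => Metric.isOpen_ball
  have hO' : O = ⋃ x ∈ T, Metric.ball (x : F) (ε x) := by
    rw [hTO]
    refine Set.Subset.antisymm (fun x hx => ?_) (Set.iUnion_subset hεO)
    exact Set.mem_iUnion.2 ⟨⟨x, hx⟩, Metric.mem_ball_self (hε _)⟩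
  rw [hO', Set.preimage_iUnion₂]
  refine MeasurableSet.biUnion hT fun x _ => ?_
  have : f ⁻¹' Metric.ball (x : F) (ε x) = {a | ‖f a - x‖ < ε x} := by
    ext a; simp [dist_eq_norm]
  rw [this]
  exact measurableSet_lt (h x) measurable_const

/-- `V` is a bounded nonnegative measurable function on space-time with bounded support. -/
structure IsCutoff {d : ℕ} (V : ℝ × EuclideanSpace ℝ (Fin d) → ℝ) (M : ℝ) : Prop where
  measurable : Measurable V
  nonneg : ∀ p, 0 ≤ V p
  le : ∀ p, V p ≤ M
  eq_zero_of_time : ∀ p, M < |p.1| → V p = 0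
  eq_zero_of_space : ∀ p, M < ‖p.2‖ → V p = 0

/-- `w` is a jointly measurable version of `(t, x) ↦ (e^{itΔ} u)(x)`. -/
structure IsVersion {d : ℕ} (w : ℝ × EuclideanSpace ℝ (Fin d) → ℂ) (u : L2 d) : Prop where
  measurable : Measurable w
  ae_eq : ∀ t : ℝ, t ≠ 0 → (propagator d t u : EuclideanSpace ℝ (Fin d) → ℂ) =ᵐ[volume]
        fun x => w (t, x)

section

variable {d : ℕ} {V : ℝ × EuclideanSpace ℝ (Fin d) → ℝ} {M : ℝ}
  {w : ℝ × EuclideanSpace ℝ (Fin d) → ℂ} {u : L2 d}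

theorem IsVersion.memLp (hw : IsVersion w u) {t : ℝ} (ht : t ≠ 0) : MemLp (fun x => w (t, x)) 2 :=
  (Lp.memLp _).ae_eq (hw.ae_eq t ht)

theorem IsVersion.measurable_slice (hw : IsVersion w u) (t : ℝ) : Measurable (fun x => w (t, x)) :=
  hw.measurable.comp measurable_prodMk_left

theorem IsCutoff.measurable_slice (hV : IsCutoff V M) (t : ℝ) : Measurable (fun x => V (t, x)) :=
  hV.measurable.comp measurable_prodMk_left

theorem IsCutoff.bound_nonneg (hV : IsCutoff V M) : 0 ≤ M := (hV.nonneg 0).trans (hV.le 0)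

theorem enorm_sq_eq_lintegral {α : Type*} {m : MeasurableSpace α} {μ : Measure α}
    (f : Lp ℂ 2 μ) : ‖f‖ₑ ^ 2 = ∫⁻ x, ‖f x‖ₑ ^ 2 ∂μ := by
  conv_lhs => rw [← Lp.toLp_coeFn f (Lp.memLp f)]
  exact enorm_sq_toLp _

theorem IsVersion.lintegral_slice (hw : IsVersion w u) {t : ℝ} (ht : t ≠ 0) :
    ∫⁻ x, ‖w (t, x)‖ₑ ^ 2 = ‖u‖ₑ ^ 2 := by
  have h : ‖propagator d t u‖ₑ = ‖u‖ₑ := by rw [← ofReal_norm, norm_propagator, ofReal_norm]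
  rw [← h, enorm_sq_eq_lintegral]
  refine lintegral_congr_ae ?_
  filter_upwards [hw.ae_eq t ht] with x hx
  rw [hx]

theorem IsCutoff.memLp_mul (hV : IsCutoff V M) (t : ℝ) {f : EuclideanSpace ℝ (Fin d) → ℂ}
    (hf : MemLp f 2) : MemLp (fun x => (V (t, x) : ℂ) * f x) 2 := by
  refine hf.of_le_mul (c := M) ?_ (.of_forall fun x => ?_)
  · exact (Complex.measurable_ofReal.comp (hV.measurable_slice t)).aestronglyMeasurable.mul hf.1
  · rw [norm_mul, Complex.norm_real, Real.norm_of_nonneg (hV.nonneg _)]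
    gcongr
    exact hV.le _

theorem IsCutoff.integrable_mul (hV : IsCutoff V M) (t : ℝ) {f : EuclideanSpace ℝ (Fin d) → ℂ}
    (hf : MemLp f 2) : Integrable (fun x => (V (t, x) : ℂ) * f x) := by
  have h1 := (hV.memLp_mul t hf).restrict (Metric.closedBall 0 M)
  have : IsFiniteMeasure (volume.restrict (Metric.closedBall (0 : EuclideanSpace ℝ (Fin d)) M)) :=
    ⟨by simpa using measure_closedBall_lt_top⟩
  have h2 : IntegrableOn (fun x => (V (t, x) : ℂ) * f x) (Metric.closedBall 0 M) :=
    h1.integrable one_le_two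
  refine (integrable_indicator_iff Metric.isClosed_closedBall.measurableSet |>.2 h2).congr
    (.of_forall fun x => ?_)
  by_cases hx : x ∈ Metric.closedBall (0 : EuclideanSpace ℝ (Fin d)) M
  · simp only [Set.indicator_of_mem hx]
  · simp only [Set.indicator_of_notMem hx]
    rw [hV.eq_zero_of_space (t, x) (by simpa using hx)]
    simp

/-- The sesquilinear form of `V(t) e^{i(t-s)Δ} V(s)` evaluated at the slices of `w`. -/
noncomputable def timeForm (V : ℝ × EuclideanSpace ℝ (Fin d) → ℝ)
    (w : ℝ × EuclideanSpace ℝ (Fin d) → ℂ) (z : ℝ × ℝ) : ℂ :=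
  ∫ p : EuclideanSpace ℝ (Fin d) × EuclideanSpace ℝ (Fin d),
    conj (w (z.1, p.1)) * schrodingerKernel d (z.1 - z.2) (p.1 - p.2) * w (z.2, p.2) *
      ((V (z.1, p.1) * V (z.2, p.2) : ℝ) : ℂ)

/-- The vector `e^{-itΔ} V(t) e^{itΔ} u`. -/
noncomputable def pullback (hV : IsCutoff V M) (u : L2 d) (t : ℝ) : L2 d :=
  -- Versions of the evolution are unspecified at t = 0, where the kernel is singular; the value at
  -- this single time does not affect the integrals.
  if t = 0 then 0 else
  propagator d (-t) (hV.memLp_mul t (Lp.memLp (propagator d t u))).toLp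

/-- The group law merges e^{itΔ} and e^{-isΔ} into e^{i(t-s)Δ}, acting between V(t)u(t) and
V(s)u(s). These are in L¹ ∩ L² because V is bounded with bounded support, so the kernel
representation applies. -/
theorem timeForm_eq_inner (hV : IsCutoff V M) (hw : IsVersion w u) {t s : ℝ} (ht : t ≠ 0)
    (hs : s ≠ 0) (hts : t ≠ s) :
    timeForm V w (t, s) = inner ℂ (pullback hV u t) (pullback hV u s) := by
  have hm : ∀ r, ∀ hr : r ≠ 0, (hV.memLp_mul r (Lp.memLp (propagator d r u))).toLp =
      (hV.memLp_mul r (hw.memLp hr)).toLp := by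
    intro r hr
    rw [MemLp.toLp_eq_toLp_iff]
    filter_upwards [hw.ae_eq r hr] with x hx
    rw [hx]
  rw [pullback, pullback, if_neg ht, if_neg hs, inner_propagator_left, propagator_propagator,
    hm t ht, hm s hs, neg_neg, ← sub_eq_add_neg, inner_propagator_eq_integral
    (hV.integrable_mul t (hw.memLp ht)) _ (hV.integrable_mul s (hw.memLp hs)) _ (sub_ne_zero.2 hts)]
  refine integral_congr_ae (.of_forall fun p => ?_)
  simp only [map_mul, Complex.conj_ofReal]
  push_cast
  ring

theorem norm_pullback_le (hV : IsCutoff V M) (u : L2 d) (t : ℝ) :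
    ‖pullback hV u t‖ ≤ (Set.Icc (-M) M).indicator (fun _ => M * ‖u‖) t := by
  have hM := hV.bound_nonneg
  by_cases ht : t ∈ Set.Icc (-M) M
  · rw [Set.indicator_of_mem ht, pullback]
    split_ifs with h0
    · simp; positivity
    · rw [norm_propagator, ← norm_propagator d t u]
      refine Lp.norm_le_mul_norm_of_ae_le_mul ?_
      filter_upwards [MemLp.coeFn_toLp (hV.memLp_mul t (Lp.memLp (propagator d t u)))] with x hx
      rw [hx, norm_mul, Complex.norm_real, Real.norm_of_nonneg (hV.nonneg _)]
      gcongr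
      exact hV.le _
  · rw [Set.indicator_of_notMem ht, pullback]
    split_ifs with h0
    · simp
    · rw [norm_propagator, Lp.norm_toLp]
      have : (fun x => (V (t, x) : ℂ) * (propagator d t u) x) = 0 := by
        ext x
        rw [hV.eq_zero_of_time (t, x) (by
          rw [← not_le, abs_le]; exact ht)]
        simp
      rw [this]
      simp

theorem stronglyMeasurable_pullback (hV : IsCutoff V M) (u : L2 d) :
    StronglyMeasurable (pullback hV u) := by
  have : Fact ((2 : ℝ≥0∞) ≠ ∞) := ⟨by simp⟩
  refine stronglyMeasurable_of_measurable_norm_sub fun g => ?_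
  obtain ⟨w, hwm, hw⟩ := exists_measurable_propagator u
  obtain ⟨v, hvm, hv⟩ := exists_measurable_propagator g
  -- Applying the isometry e^{itΔ} moves the distance to the evolved side, where it is the L² norm
  -- of V w - v with jointly measurable w and v.
  have : (fun t => ‖pullback hV u t - g‖) = fun t => if t = 0 then ‖g‖ else
      ((∫⁻ x, ‖(V (t, x) : ℂ) * w (t, x) - v (t, x)‖ₑ ^ 2) ^ (1 / 2 : ℝ)).toReal := by
    ext t
    split_ifs with h0
    · simp [pullback, h0]
    · rw [pullback, if_neg h0, ← norm_propagator d t, map_sub, propagator_propagator,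
        add_neg_cancel, propagator_zero, ← toReal_enorm]
      congr 1
      set f := (hV.memLp_mul t (Lp.memLp (propagator d t u))).toLp with hf
      have h1 : ∫⁻ x, ‖(V (t, x) : ℂ) * w (t, x) - v (t, x)‖ₑ ^ 2 =
          ∫⁻ x, ‖(f - propagator d t g : L2 d) x‖ₑ ^ 2 := by
        refine lintegral_congr_ae ?_
        filter_upwards [MemLp.coeFn_toLp (hV.memLp_mul t (Lp.memLp (propagator d t u))),
          hw t h0, hv t h0, Lp.coeFn_sub f (propagator d t g)] with x h1 h2 h3 h4
        rw [h4, Pi.sub_apply, hf, h1, h2, h3]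
      rw [h1, ← enorm_sq_eq_lintegral, ← ENNReal.rpow_natCast, ← ENNReal.rpow_mul]
      simp
  rw [this]
  refine Measurable.ite (measurableSet_singleton 0) measurable_const ?_
  refine ENNReal.measurable_toReal.comp (Measurable.pow_const ?_ _)
  refine Measurable.lintegral_prod_right' (f := fun p : ℝ × EuclideanSpace ℝ (Fin d) =>
    ‖(V p : ℂ) * w p - v p‖ₑ ^ 2) ?_
  exact (((Complex.measurable_ofReal.comp hV.measurable).mul hwm).sub hvm).enorm.pow_const 2

theorem integrable_pullback (hV : IsCutoff V M) (u : L2 d) : Integrable (pullback hV u) := by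
  have h : Integrable ((Set.Icc (-M) M).indicator (fun _ => M * ‖u‖)) := by
    rw [integrable_indicator_iff measurableSet_Icc]
    exact integrableOn_const (by simp)
  exact h.mono' (stronglyMeasurable_pullback hV u).aestronglyMeasurable
    (.of_forall (norm_pullback_le hV u))

theorem ae_time_pair_ne : ∀ᵐ z : ℝ × ℝ, z.1 ≠ 0 ∧ z.2 ≠ 0 ∧ z.1 ≠ z.2 := by
  have h1 : ∀ a : ℝ, ∀ᵐ t : ℝ, t ≠ a := fun a => by simp [ae_iff]
  have h2 : ∀ᵐ z : ℝ × ℝ, z.1 ≠ 0 := Measure.quasiMeasurePreserving_fst.ae (h1 0)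
  have h3 : ∀ᵐ z : ℝ × ℝ, z.2 ≠ 0 := Measure.quasiMeasurePreserving_snd.ae (h1 0)
  have h4 : ∀ᵐ z : ℝ × ℝ, z.1 ≠ z.2 := by
    rw [Measure.volume_eq_prod, Measure.ae_prod_iff_ae_ae
      (show MeasurableSet {z : ℝ × ℝ | z.1 ≠ z.2} from
        (measurableSet_eq_fun measurable_fst measurable_snd).compl)]
    exact .of_forall fun t => (h1 t).mono fun s hs => hs.symm
  filter_upwards [h2, h3, h4] with z a b c using ⟨a, b, c⟩

theorem ae_timeForm_eq_inner (hV : IsCutoff V M) (hw : IsVersion w u) :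
    ∀ᵐ z : ℝ × ℝ, timeForm V w z = inner ℂ (pullback hV u z.1) (pullback hV u z.2) := by
  filter_upwards [ae_time_pair_ne] with z hz
  exact timeForm_eq_inner hV hw hz.1 hz.2.1 hz.2.2

theorem integrable_timeForm (hV : IsCutoff V M) (hw : IsVersion w u) :
    Integrable (timeForm V w) := by
  have hn := (integrable_pullback hV u).norm.mul_prod (integrable_pullback hV u).norm
  refine hn.mono' ?_ ?_
  · refine AEStronglyMeasurable.congr ?_ (Filter.EventuallyEq.symm (ae_timeForm_eq_inner hV hw))
    exact ((stronglyMeasurable_pullback hV u).comp_measurable measurable_fst).inner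
      ((stronglyMeasurable_pullback hV u).comp_measurable measurable_snd) |>.aestronglyMeasurable
  · filter_upwards [ae_timeForm_eq_inner hV hw] with z hz
    rw [hz]
    exact norm_inner_le_norm _ _

/-- Up to a null set of times the form is ⟨ψ(t), ψ(s)⟩ with ψ Bochner integrable, so the double
integral is ⟨∫ψ, ∫ψ⟩. -/
theorem integral_timeForm (hV : IsCutoff V M) (hw : IsVersion w u) :
    ∫ z, timeForm V w z = ((‖∫ t, pullback hV u t‖ ^ 2 : ℝ) : ℂ) := by
  have hi := integrable_pullback hV u
  rw [integral_congr_ae (ae_timeForm_eq_inner hV hw), Measure.volume_eq_prod, integral_prod]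
  · simp only [integral_inner hi]
    have : ∀ t, inner ℂ (pullback hV u t) (∫ s, pullback hV u s) =
        conj (inner ℂ (∫ s, pullback hV u s) (pullback hV u t)) := fun t => (inner_conj_symm _ _).symm
    simp only [this]
    rw [integral_conj, integral_inner hi, inner_self_eq_norm_sq_to_K]
    simp [← Complex.ofReal_pow, Complex.conj_ofReal]
  · exact (integrable_timeForm hV hw).congr (ae_timeForm_eq_inner hV hw)

theorem IsCutoff.integrable_mul_norm_sq (hV : IsCutoff V M) (hw : IsVersion w u) :
    Integrable (fun p => V p * ‖w p‖ ^ 2) := by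
  have hM := hV.bound_nonneg
  refine ⟨(hV.measurable.mul (hw.measurable.norm.pow_const 2)).aestronglyMeasurable, ?_⟩
  have hm : Measurable fun p => ‖V p * ‖w p‖ ^ 2‖ₑ :=
    (hV.measurable.mul (hw.measurable.norm.pow_const 2)).enorm
  rw [HasFiniteIntegral, Measure.volume_eq_prod, lintegral_prod _ hm.aemeasurable]
  have hne : ∀ᵐ t : ℝ, t ≠ 0 := by simp [ae_iff]
  calc ∫⁻ t, ∫⁻ x, ‖V (t, x) * ‖w (t, x)‖ ^ 2‖ₑ
      ≤ ∫⁻ t, (Set.Icc (-M) M).indicator (fun _ => ENNReal.ofReal M * ‖u‖ₑ ^ 2) t := by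
        refine lintegral_mono_ae ?_
        filter_upwards [hne] with t ht
        by_cases htM : t ∈ Set.Icc (-M) M
        · rw [Set.indicator_of_mem htM, ← hw.lintegral_slice ht,
            ← lintegral_const_mul _ ((hw.measurable_slice t).enorm.pow_const 2)]
          refine lintegral_mono fun x => ?_
          rw [enorm_mul, enorm_pow, enorm_norm, Real.enorm_of_nonneg (hV.nonneg _)]
          gcongr
          exact hV.le _
        · rw [Set.indicator_of_notMem htM]
          have : ∀ x, V (t, x) = 0 := fun x =>
            hV.eq_zero_of_time (t, x) (by rw [← not_le, abs_le]; exact htM)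
          simp [this]
    _ < ∞ := by
        rw [lintegral_indicator measurableSet_Icc, setLIntegral_const]
        refine ENNReal.mul_lt_top (ENNReal.mul_lt_top ENNReal.ofReal_lt_top ?_) (by simp)
        exact ENNReal.pow_lt_top enorm_lt_top

theorem inner_integral_pullback (hV : IsCutoff V M) (hw : IsVersion w u) :
    inner ℂ u (∫ t, pullback hV u t) = ((∫ p, V p * ‖w p‖ ^ 2 : ℝ) : ℂ) := by
  have hne : ∀ᵐ t : ℝ, t ≠ 0 := by simp [ae_iff]
  rw [← integral_inner (integrable_pullback hV u), Measure.volume_eq_prod,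
    integral_prod _ (hV.integrable_mul_norm_sq hw), ← integral_complex_ofReal]
  refine integral_congr_ae ?_
  filter_upwards [hne] with t ht
  rw [pullback, if_neg ht, ← inner_propagator_left, inner_eq_integral, ← integral_complex_ofReal]
  refine integral_congr_ae ?_
  filter_upwards [MemLp.coeFn_toLp (hV.memLp_mul t (Lp.memLp (propagator d t u))), hw.ae_eq t ht]
    with x h1 h2
  rw [h1, h2, mul_left_comm, Complex.conj_mul']
  push_cast
  rfl

/-- The `TT*` inequality `⟨u, A u⟩² ≤ ‖u‖² ‖A u‖²` for `A = ∫ e^{-itΔ} V(t) e^{itΔ} dt`. -/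
theorem sq_integral_le_norm_integral_timeForm (hV : IsCutoff V M) (hw : IsVersion w u)
    (hu : ‖u‖ = 1) : (∫ p, V p * ‖w p‖ ^ 2) ^ 2 ≤ ‖∫ z, timeForm V w z‖ := by
  have h := norm_inner_le_norm (𝕜 := ℂ) u (∫ t, pullback hV u t)
  rw [inner_integral_pullback hV hw, Complex.norm_real, hu, one_mul] at h
  rw [integral_timeForm hV hw, Complex.norm_real, Real.norm_of_nonneg (by positivity), ← sq_abs]
  gcongr
  exact h

end

/-! ### Bessel's inequality and the low/high splitting -/

/-- The tensors eᵢ ⊗ ēᵢ are orthonormal in L²(X × X), and the diagonal matrix elements of the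
operator with kernel k are the inner products of k with them; Bessel's inequality bounds their
squares by the squared Hilbert–Schmidt norm. -/
theorem sum_enorm_integral_tensor_sq_le {X ι : Type*} [MeasurableSpace X] {μ : Measure X}
    [SigmaFinite μ] [Fintype ι] [DecidableEq ι] {e : ι → X → ℂ} (he : ∀ i, MemLp (e i) 2 μ)
    (hon : ∀ i j, ∫ x, conj (e i x) * e j x ∂μ = if i = j then 1 else 0) {k : X × X → ℂ}
    (hk : AEStronglyMeasurable k (μ.prod μ)) :
    ∑ i, ‖∫ q, conj (e i q.1) * e i q.2 * k q ∂(μ.prod μ)‖ₑ ^ 2 ≤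
      ∫⁻ q, ‖k q‖ₑ ^ 2 ∂(μ.prod μ) := by
  by_cases hfin : ∫⁻ q, ‖k q‖ₑ ^ 2 ∂(μ.prod μ) = ∞
  · rw [hfin]; exact le_top
  have hk2 : MemLp k 2 (μ.prod μ) := by
    refine ⟨hk, ?_⟩
    rw [eLpNorm_eq_lintegral_rpow_enorm_toReal (by simp) (by simp)]
    refine ENNReal.rpow_lt_top_of_nonneg (by simp) ?_
    simpa using hfin
  have hP : ∀ i, MemLp (fun q : X × X => e i q.1 * conj (e i q.2)) 2 (μ.prod μ) := by
    intro i
    have h1 : AEStronglyMeasurable (fun q : X × X => e i q.1 * conj (e i q.2)) (μ.prod μ) :=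
      (he i).1.comp_fst.mul (he i).star.1.comp_snd
    rw [memLp_two_iff_integrable_sq_norm h1]
    have h2 := ((memLp_two_iff_integrable_sq_norm (he i).1).1 (he i)).mul_prod
      ((memLp_two_iff_integrable_sq_norm (he i).1).1 (he i))
    refine h2.congr (.of_forall fun q => ?_)
    simp [mul_pow]
  have hinner : ∀ i j, inner ℂ (hP i).toLp (hP j).toLp = if i = j then (1 : ℂ) else 0 := by
    intro i j
    rw [inner_toLp_eq_integral]
    have : ∀ q : X × X, conj (e i q.1 * conj (e i q.2)) * (e j q.1 * conj (e j q.2)) =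
        (conj (e i q.1) * e j q.1) * conj (conj (e i q.2) * e j q.2) := by
      intro q
      simp only [map_mul, Complex.conj_conj]
      ring
    simp_rw [this]
    rw [integral_prod_mul (fun x => conj (e i x) * e j x) (fun x => conj (conj (e i x) * e j x)),
      integral_conj, hon]
    split_ifs <;> simp
  have hON : Orthonormal ℂ fun i => (hP i).toLp := by
    rw [orthonormal_iff_ite]
    exact hinner
  have h := hON.sum_inner_products_le (s := Finset.univ) hk2.toLp
  have h' : ∀ i, inner ℂ (hP i).toLp hk2.toLp =
      ∫ q, conj (e i q.1) * e i q.2 * k q ∂(μ.prod μ) := by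
    intro i
    rw [inner_toLp_eq_integral]
    refine integral_congr_ae (.of_forall fun q => ?_)
    simp
  simp only [h'] at h
  rw [← enorm_sq_toLp hk2]
  simp only [← ofReal_norm, ← ENNReal.ofReal_pow (norm_nonneg _)]
  rw [← ENNReal.ofReal_sum_of_nonneg (fun i _ => by positivity)]
  exact ENNReal.ofReal_le_ofReal h

/-- Used to pass between pairs of times together with pairs of positions, as in `timeForm`, and
pairs of space-time points, as in the Hilbert–Schmidt norm. -/
theorem measurePreserving_prod_prod_comm {A B : Type*} [MeasurableSpace A] [MeasurableSpace B]
    (μ : Measure A) (ν : Measure B) [SFinite μ] [SFinite ν] :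
    MeasurePreserving (fun z : (A × A) × (B × B) => ((z.1.1, z.2.1), (z.1.2, z.2.2)))
      ((μ.prod μ).prod (ν.prod ν)) ((μ.prod ν).prod (μ.prod ν)) := by
  have hm : Measurable (fun z : (A × A) × (B × B) => ((z.1.1, z.2.1), (z.1.2, z.2.2))) := by
    fun_prop
  refine ⟨hm, Measure.ext fun S hS => ?_⟩
  have hf : Measurable (S.indicator (1 : (A × B) × (A × B) → ℝ≥0∞)) := measurable_one.indicator hS
  have hf' : Measurable fun z : (A × A) × (B × B) =>
      S.indicator (1 : (A × B) × (A × B) → ℝ≥0∞) ((z.1.1, z.2.1), (z.1.2, z.2.2)) := hf.comp hm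
  rw [← lintegral_indicator_one hS, ← lintegral_indicator_one hS, lintegral_map hf hm,
    lintegral_prod _ hf'.aemeasurable, lintegral_prod _ hf'.lintegral_prod_right'.aemeasurable,
    lintegral_prod _ hf.aemeasurable, lintegral_prod _ hf.lintegral_prod_right'.aemeasurable]
  refine lintegral_congr fun t => ?_
  have e1 : ∀ s, ∫⁻ p : B × B, S.indicator (1 : (A × B) × (A × B) → ℝ≥0∞) ((t, p.1), (s, p.2))
      ∂(ν.prod ν) = ∫⁻ x, ∫⁻ y, S.indicator 1 ((t, x), (s, y)) ∂ν ∂ν := by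
    intro s
    exact lintegral_prod _ (hf'.comp (measurable_prodMk_left (x := (t, s)))).aemeasurable
  have e2 : ∀ x, ∫⁻ q : A × B, S.indicator (1 : (A × B) × (A × B) → ℝ≥0∞) ((t, x), q)
      ∂(μ.prod ν) = ∫⁻ s, ∫⁻ y, S.indicator 1 ((t, x), (s, y)) ∂ν ∂μ := by
    intro x
    exact lintegral_prod _ (hf.comp (measurable_prodMk_left (x := (t, x)))).aemeasurable
  simp only [e1, e2]
  rw [lintegral_lintegral_swap]
  refine Measurable.aemeasurable ?_
  exact Measurable.lintegral_prod_right' (f := fun q : (A × B) × B =>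
    S.indicator (1 : (A × B) × (A × B) → ℝ≥0∞) ((t, q.1.2), (q.1.1, q.2)))
    (hf.comp (by fun_prop))

section

variable {d : ℕ} {V : ℝ × EuclideanSpace ℝ (Fin d) → ℝ} {M : ℝ}
  {w : ℝ × EuclideanSpace ℝ (Fin d) → ℂ} {u : L2 d}

/-- The part of `timeForm` with `V(t, x) V(s, y)` truncated at height `m(t, s)²`. -/
noncomputable def lowForm (V : ℝ × EuclideanSpace ℝ (Fin d) → ℝ) (m : ℝ × ℝ → ℝ)
    (w : ℝ × EuclideanSpace ℝ (Fin d) → ℂ) (z : ℝ × ℝ) : ℂ :=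
  ∫ p : EuclideanSpace ℝ (Fin d) × EuclideanSpace ℝ (Fin d),
    conj (w (z.1, p.1)) * schrodingerKernel d (z.1 - z.2) (p.1 - p.2) * w (z.2, p.2) *
      (min (V (z.1, p.1) * V (z.2, p.2)) (m z ^ 2) : ℝ)

/-- The integral kernel of the complementary part of `timeForm`, divided by `√(V(t, x) V(s, y))`. -/
noncomputable def highKernel (V : ℝ × EuclideanSpace ℝ (Fin d) → ℝ) (m : ℝ × ℝ → ℝ)
    (q : (ℝ × EuclideanSpace ℝ (Fin d)) × (ℝ × EuclideanSpace ℝ (Fin d))) : ℂ :=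
  schrodingerKernel d (q.1.1 - q.2.1) (q.1.2 - q.2.2) *
    ((max (V q.1 * V q.2 - m (q.1.1, q.2.1) ^ 2) 0 / (√(V q.1) * √(V q.2)) : ℝ) : ℂ)

theorem measurable_kernel_pair (d : ℕ) :
    Measurable fun q : (ℝ × EuclideanSpace ℝ (Fin d)) × (ℝ × EuclideanSpace ℝ (Fin d)) =>
      schrodingerKernel d (q.1.1 - q.2.1) (q.1.2 - q.2.2) :=
  (measurable_schrodingerKernel d).comp (f := fun q : (ℝ × EuclideanSpace ℝ (Fin d)) ×
    (ℝ × EuclideanSpace ℝ (Fin d)) => (q.1.1 - q.2.1, q.1.2 - q.2.2)) (by fun_prop)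

theorem measurable_highKernel (hV : IsCutoff V M) {m : ℝ × ℝ → ℝ} (hm : Measurable m) :
    Measurable (highKernel V m) := by
  have := hV.measurable
  refine (measurable_kernel_pair d).mul ?_
  fun_prop

/-- Where V vanishes the quotient in `highKernel` is 0/0 = 0 and the right side is 0 too, so nothing
is lost by dividing. -/
theorem sqrt_mul_highKernel (hV : IsCutoff V M) (m : ℝ × ℝ → ℝ)
    (q : (ℝ × EuclideanSpace ℝ (Fin d)) × (ℝ × EuclideanSpace ℝ (Fin d))) :
    ((√(V q.1) * √(V q.2) : ℝ) : ℂ) * highKernel V m q =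
      schrodingerKernel d (q.1.1 - q.2.1) (q.1.2 - q.2.2) *
        ((V q.1 * V q.2 - min (V q.1 * V q.2) (m (q.1.1, q.2.1) ^ 2) : ℝ) : ℂ) := by
  rw [highKernel, mul_left_comm, ← Complex.ofReal_mul]
  congr 2
  have h0 : V q.1 * V q.2 - min (V q.1 * V q.2) (m (q.1.1, q.2.1) ^ 2) =
      max (V q.1 * V q.2 - m (q.1.1, q.2.1) ^ 2) 0 := by
    rcases le_total (V q.1 * V q.2) (m (q.1.1, q.2.1) ^ 2) with h | h
    · rw [min_eq_left h, max_eq_right (by linarith), sub_self]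
    · rw [min_eq_right h, max_eq_left (by linarith)]
  rw [h0]
  by_cases hz : √(V q.1) * √(V q.2) = 0
  · have : V q.1 * V q.2 = 0 := by
      rcases mul_eq_zero.1 hz with h | h
      · rw [(Real.sqrt_eq_zero (hV.nonneg _)).1 h, zero_mul]
      · rw [(Real.sqrt_eq_zero (hV.nonneg _)).1 h, mul_zero]
    rw [hz, zero_mul, this, max_eq_right]
    nlinarith [sq_nonneg (m (q.1.1, q.2.1))]
  · exact mul_div_cancel₀ _ hz

/-- The excess over m² is supported where V V > m² and there is at most V V; dividing by its square
root and squaring leaves V V. The factor |t-s|^{-d} is the squared dispersive bound. -/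
theorem enorm_highKernel_sq_le (hV : IsCutoff V M) (m : ℝ × ℝ → ℝ)
    (q : (ℝ × EuclideanSpace ℝ (Fin d)) × (ℝ × EuclideanSpace ℝ (Fin d))) (hq : q.1.1 ≠ q.2.1) :
    ‖highKernel V m q‖ₑ ^ 2 ≤
      if m (q.1.1, q.2.1) ^ 2 < V q.1 * V q.2 then
        ENNReal.ofReal (|q.1.1 - q.2.1| ^ (-(d : ℝ)) * (V q.1 * V q.2)) else 0 := by
  have hK := norm_schrodingerKernel_le d (sub_ne_zero.2 hq) (q.1.2 - q.2.2)
  have hv1 := hV.nonneg q.1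
  have hv2 := hV.nonneg q.2
  split_ifs with h
  · rw [← ofReal_norm, ← ENNReal.ofReal_pow (norm_nonneg _)]
    refine ENNReal.ofReal_le_ofReal ?_
    have hpos : 0 < V q.1 * V q.2 := (sq_nonneg _).trans_lt h
    have h1 : max (V q.1 * V q.2 - m (q.1.1, q.2.1) ^ 2) 0 ≤ V q.1 * V q.2 :=
      max_le (by nlinarith [sq_nonneg (m (q.1.1, q.2.1))]) hpos.le
    have hs : √(V q.1) * √(V q.2) = √(V q.1 * V q.2) := (Real.sqrt_mul hv1 _).symm
    have h2 : max (V q.1 * V q.2 - m (q.1.1, q.2.1) ^ 2) 0 / (√(V q.1) * √(V q.2)) ≤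
        √(V q.1 * V q.2) := by
      rw [hs, div_le_iff₀ (Real.sqrt_pos.2 hpos), Real.mul_self_sqrt hpos.le]
      exact h1
    have h20 : 0 ≤ max (V q.1 * V q.2 - m (q.1.1, q.2.1) ^ 2) 0 / (√(V q.1) * √(V q.2)) := by
      positivity
    rw [highKernel, norm_mul, Complex.norm_real, Real.norm_of_nonneg h20, mul_pow]
    calc _ ≤ (|q.1.1 - q.2.1| ^ (-((d : ℝ) / 2))) ^ 2 * √(V q.1 * V q.2) ^ 2 := by gcongr
      _ = _ := by
        rw [Real.sq_sqrt hpos.le, ← Real.rpow_natCast, ← Real.rpow_mul (abs_nonneg _)]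
        congr 2
        push_cast
        ring
  · rw [highKernel, max_eq_right (by linarith)]
    simp

theorem integrable_timeForm_integrand (hV : IsCutoff V M) (hw : IsVersion w u) {t s : ℝ}
    (ht : t ≠ 0) (hs : s ≠ 0) (hts : t ≠ s) :
    Integrable fun p : EuclideanSpace ℝ (Fin d) × EuclideanSpace ℝ (Fin d) =>
      conj (w (t, p.1)) * schrodingerKernel d (t - s) (p.1 - p.2) * w (s, p.2) *
        ((V (t, p.1) * V (s, p.2) : ℝ) : ℂ) := by
  have h := integrable_conj_mul_schrodingerKernel_mul (hV.integrable_mul t (hw.memLp ht))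
    (hV.integrable_mul s (hw.memLp hs)) (sub_ne_zero.2 hts)
  refine h.congr (.of_forall fun p => ?_)
  simp only [map_mul, Complex.conj_ofReal]
  push_cast
  ring

theorem measurable_form_integrand (hw : IsVersion w u) :
    Measurable fun z : (ℝ × ℝ) × (EuclideanSpace ℝ (Fin d) × EuclideanSpace ℝ (Fin d)) =>
      conj (w (z.1.1, z.2.1)) * schrodingerKernel d (z.1.1 - z.1.2) (z.2.1 - z.2.2) *
        w (z.1.2, z.2.2) := by
  have h1 := hw.measurable
  have h2 := (measurable_schrodingerKernel d).comp
    (f := fun z : (ℝ × ℝ) × (EuclideanSpace ℝ (Fin d) × EuclideanSpace ℝ (Fin d)) =>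
      (z.1.1 - z.1.2, z.2.1 - z.2.2)) (by fun_prop)
  refine Measurable.mul (Measurable.mul ?_ h2) (h1.comp (by fun_prop))
  exact Complex.continuous_conj.measurable.comp (h1.comp (by fun_prop))

theorem integrable_lowForm_integrand (hV : IsCutoff V M) (hw : IsVersion w u) (m : ℝ × ℝ → ℝ)
    {t s : ℝ} (ht : t ≠ 0) (hs : s ≠ 0) (hts : t ≠ s) :
    Integrable fun p : EuclideanSpace ℝ (Fin d) × EuclideanSpace ℝ (Fin d) =>
      conj (w (t, p.1)) * schrodingerKernel d (t - s) (p.1 - p.2) * w (s, p.2) *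
        ((min (V (t, p.1) * V (s, p.2)) (m (t, s) ^ 2) : ℝ) : ℂ) := by
  refine (integrable_timeForm_integrand hV hw ht hs hts).mono ?_ (.of_forall fun p => ?_)
  · have h1 := (measurable_form_integrand hw).comp
      (measurable_prodMk_left (x := (t, s)))
    have h2 := hV.measurable_slice t
    have h3 := hV.measurable_slice s
    refine (h1.mul ?_).aestronglyMeasurable
    exact Complex.measurable_ofReal.comp
      (((h2.comp measurable_fst).mul (h3.comp measurable_snd)).min measurable_const)
  · have h1 := mul_nonneg (hV.nonneg (t, p.1)) (hV.nonneg (s, p.2))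
    rw [norm_mul, norm_mul _ ((V (t, p.1) * V (s, p.2) : ℝ) : ℂ), Complex.norm_real,
      Complex.norm_real, Real.norm_of_nonneg h1, Real.norm_of_nonneg (le_min h1 (sq_nonneg _))]
    gcongr
    exact min_le_left _ _

/-- The local mass `(∫ V(t, x) |w(t, x)|² dx)^{1/2}`. -/
noncomputable def localMass (V : ℝ × EuclideanSpace ℝ (Fin d) → ℝ)
    (w : ℝ × EuclideanSpace ℝ (Fin d) → ℂ) (t : ℝ) : ℝ≥0∞ :=
  (∫⁻ x, ‖w (t, x)‖ₑ ^ 2 * ENNReal.ofReal (V (t, x))) ^ (1 / 2 : ℝ)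

theorem measurable_localMass (hV : IsCutoff V M) (hw : IsVersion w u) :
    Measurable (localMass V w) := by
  refine Measurable.pow_const ?_ _
  exact Measurable.lintegral_prod_right' (f := fun p : ℝ × EuclideanSpace ℝ (Fin d) =>
    ‖w p‖ₑ ^ 2 * ENNReal.ofReal (V p))
    ((hw.measurable.enorm.pow_const 2).mul (ENNReal.measurable_ofReal.comp hV.measurable))

theorem lintegral_localMass_sq (hV : IsCutoff V M) (hw : IsVersion w u) :
    ∫⁻ t, localMass V w t ^ (2 : ℝ) = ENNReal.ofReal (∫ p, V p * ‖w p‖ ^ 2) := by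
  rw [ofReal_integral_eq_lintegral_ofReal (hV.integrable_mul_norm_sq hw)
    (.of_forall fun p => mul_nonneg (hV.nonneg p) (sq_nonneg _)), Measure.volume_eq_prod,
    lintegral_prod]
  · refine lintegral_congr fun t => ?_
    rw [localMass, ← ENNReal.rpow_mul]
    norm_num
    refine lintegral_congr fun x => ?_
    rw [mul_comm, ENNReal.ofReal_mul (hV.nonneg _), ← ofReal_norm, ENNReal.ofReal_pow (norm_nonneg _)]
  · exact (ENNReal.measurable_ofReal.comp
      (hV.measurable.mul (hw.measurable.norm.pow_const 2))).aemeasurable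

theorem enorm_lowForm_le (hV : IsCutoff V M) (hw : IsVersion w u) {m : ℝ × ℝ → ℝ} {t s : ℝ}
    (ht : t ≠ 0) (hs : s ≠ 0) (hts : t ≠ s) (hm : 0 < m (t, s)) :
    ‖lowForm V m w (t, s)‖ₑ ≤
      ENNReal.ofReal (m (t, s)) * (localMass V w t * localMass V w s) := by
  refine enorm_integral_kernel_min_le (V₁ := fun x => V (t, x)) (V₂ := fun x => V (s, x))
    (hV.measurable_slice t) (hV.measurable_slice s) (M := M) (fun x => hV.nonneg _)
    (fun x => hV.nonneg _) (fun x => hV.le _) (fun x => hV.le _)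
    (S := Metric.closedBall 0 M) Metric.isClosed_closedBall.measurableSet
    measure_closedBall_lt_top.ne (fun x hx => hV.eq_zero_of_space _ (by simpa using hx))
    (fun x hx => hV.eq_zero_of_space _ (by simpa using hx)) (hw.memLp ht) (hw.memLp hs)
    (hw.measurable_slice t) (hw.measurable_slice s) (sub_ne_zero.2 hts) hm

theorem stronglyMeasurable_lowForm (hV : IsCutoff V M) (hw : IsVersion w u) {m : ℝ × ℝ → ℝ}
    (hm : Measurable m) : StronglyMeasurable (lowForm V m w) := by
  refine StronglyMeasurable.integral_prod_right' (f := fun z : (ℝ × ℝ) ×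
    (EuclideanSpace ℝ (Fin d) × EuclideanSpace ℝ (Fin d)) =>
    conj (w (z.1.1, z.2.1)) * schrodingerKernel d (z.1.1 - z.1.2) (z.2.1 - z.2.2) *
        w (z.1.2, z.2.2) * (min (V (z.1.1, z.2.1) * V (z.1.2, z.2.2)) (m z.1 ^ 2) : ℝ)) ?_
  refine ((measurable_form_integrand hw).mul (Complex.measurable_ofReal.comp
    (Measurable.min ?_ ?_))).stronglyMeasurable
  · exact (hV.measurable.comp (by fun_prop)).mul (hV.measurable.comp (by fun_prop))
  · exact (hm.comp measurable_fst).pow_const 2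

/-- `timeForm` splits into its low part and the pairing with `highKernel`. -/
theorem ae_timeForm_sub_lowForm (hV : IsCutoff V M) (hw : IsVersion w u) (m : ℝ × ℝ → ℝ) :
    ∀ᵐ z : ℝ × ℝ, timeForm V w z - lowForm V m w z =
      ∫ p : EuclideanSpace ℝ (Fin d) × EuclideanSpace ℝ (Fin d),
        conj (√(V (z.1, p.1)) * w (z.1, p.1)) * (√(V (z.2, p.2)) * w (z.2, p.2)) *
          highKernel V m ((z.1, p.1), (z.2, p.2)) := by
  filter_upwards [ae_time_pair_ne] with z hz
  rw [timeForm, lowForm, ← integral_sub (integrable_timeForm_integrand hV hw hz.1 hz.2.1 hz.2.2)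
    (integrable_lowForm_integrand hV hw m hz.1 hz.2.1 hz.2.2)]
  refine integral_congr_ae (.of_forall fun p => ?_)
  have h := sqrt_mul_highKernel hV m ((z.1, p.1), (z.2, p.2))
  simp only [map_mul, Complex.conj_ofReal] at h ⊢
  calc _ = conj (w (z.1, p.1)) * w (z.2, p.2) * (schrodingerKernel d (z.1 - z.2) (p.1 - p.2) *
        ((V (z.1, p.1) * V (z.2, p.2) - min (V (z.1, p.1) * V (z.2, p.2)) (m (z.1, z.2) ^ 2) : ℝ) : ℂ)) := by
        rw [Complex.ofReal_sub]
        ring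
    _ = _ := by
        rw [← h]
        push_cast
        ring

end

/-! ### Hardy–Littlewood–Sobolev with weights -/

/-- A weighted form of the Hardy–Littlewood–Sobolev inequality. -/
theorem exists_weighted_hardyLittlewoodSobolev {δ : ℝ} (hδ0 : 0 < δ) (hδ1 : δ < 1) :
    ∃ C : ℝ, 0 < C ∧
      (∀ ν : ℝ → ℝ≥0∞, Measurable ν →
        ∫⁻ t, ∫⁻ s, ν t ^ (1 - δ / 2) * ν s ^ (1 - δ / 2) * ENNReal.ofReal (|t - s| ^ (-δ)) ≤
          ENNReal.ofReal C * (∫⁻ t, ν t) ^ (2 - δ)) ∧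
      ∀ φ ν : ℝ → ℝ≥0∞, Measurable φ → Measurable ν →
        ∫⁻ t, ∫⁻ s, (φ t * ν t ^ ((1 - δ) / 2)) * (φ s * ν s ^ ((1 - δ) / 2)) *
          ENNReal.ofReal (|t - s| ^ (-δ)) ≤
          ENNReal.ofReal C * ((∫⁻ t, φ t ^ (2 : ℝ)) * (∫⁻ t, ν t) ^ (1 - δ)) := by
  obtain ⟨C, hC, h⟩ := exists_hardyLittlewoodSobolev hδ0 hδ1
  have h1 : 0 < 1 - δ := by linarith
  have h2 : 0 < 2 - δ := by linarith
  refine ⟨C, hC, fun ν hν => ?_, fun φ ν hφ hν => ?_⟩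
  · refine (h (fun t => ν t ^ (1 - δ / 2)) (hν.pow_const _)).trans (le_of_eq ?_)
    congr 3 with t
    rw [← ENNReal.rpow_mul]
    have : (1 - δ / 2) * (2 / (2 - δ)) = 1 := by field_simp
    rw [this, ENNReal.rpow_one]
  · refine (h (fun t => φ t * ν t ^ ((1 - δ) / 2)) (hφ.mul (hν.pow_const _))).trans ?_
    gcongr
    -- These Hölder exponents turn the factors φ^{2/(2-δ)} and ν^{(1-δ)/(2-δ)} into exactly φ² and
    -- ν.
    have hconj : (2 - δ).HolderConjugate ((2 - δ) / (1 - δ)) := by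
      rw [Real.holderConjugate_iff]
      refine ⟨by linarith, ?_⟩
      field_simp
      ring
    have hH := ENNReal.lintegral_mul_le_Lp_mul_Lq volume hconj
      (f := fun t => φ t ^ (2 / (2 - δ))) (g := fun t => (ν t ^ ((1 - δ) / 2)) ^ (2 / (2 - δ)))
      (hφ.pow_const _).aemeasurable ((hν.pow_const _).pow_const _).aemeasurable
    have e1 : ∀ t, (φ t ^ (2 / (2 - δ))) ^ (2 - δ) = φ t ^ (2 : ℝ) := fun t => by
      rw [← ENNReal.rpow_mul, div_mul_cancel₀ _ h2.ne']
    have e2 : ∀ t, ((ν t ^ ((1 - δ) / 2)) ^ (2 / (2 - δ))) ^ ((2 - δ) / (1 - δ)) = ν t := fun t => by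
      rw [← ENNReal.rpow_mul, ← ENNReal.rpow_mul]
      have : (1 - δ) / 2 * (2 / (2 - δ) * ((2 - δ) / (1 - δ))) = 1 := by field_simp
      rw [this, ENNReal.rpow_one]
    simp only [e1, e2] at hH
    have e3 : ∀ t, (φ t * ν t ^ ((1 - δ) / 2)) ^ (2 / (2 - δ)) =
        φ t ^ (2 / (2 - δ)) * (ν t ^ ((1 - δ) / 2)) ^ (2 / (2 - δ)) := fun t =>
      ENNReal.mul_rpow_of_nonneg _ _ (by positivity)
    simp only [e3]
    calc _ ≤ ((∫⁻ t, φ t ^ (2 : ℝ)) ^ (1 / (2 - δ)) *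
          (∫⁻ t, ν t) ^ (1 / ((2 - δ) / (1 - δ)))) ^ (2 - δ) := by gcongr; exact hH
      _ = _ := by
        rw [ENNReal.mul_rpow_of_nonneg _ _ h2.le, ← ENNReal.rpow_mul, ← ENNReal.rpow_mul,
          one_div_mul_cancel h2.ne', ENNReal.rpow_one]
        congr 2
        field_simp

/-! ### Counting the values above a threshold -/

section

variable {d : ℕ} {V : ℝ × EuclideanSpace ℝ (Fin d) → ℝ} {M : ℝ}

theorem memLp_sqrt_mul {w : ℝ × EuclideanSpace ℝ (Fin d) → ℂ} {u : L2 d}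
    (hV : IsCutoff V M) (hw : IsVersion w u) : MemLp (fun q => (√(V q) : ℂ) * w q) 2 := by
  have hm : Measurable (fun q => (√(V q) : ℂ) * w q) := by
    have := hV.measurable
    have := hw.measurable
    fun_prop
  rw [memLp_two_iff_integrable_sq_norm hm.aestronglyMeasurable]
  refine (hV.integrable_mul_norm_sq hw).congr (.of_forall fun q => ?_)
  simp only [norm_mul, Complex.norm_real, Real.norm_of_nonneg (Real.sqrt_nonneg _), mul_pow,
    Real.sq_sqrt (hV.nonneg q)]

/-- If the low part of the form is at most half of the eigenvalue then the high part is large. -/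
theorem le_enorm_integral_high {w : ℝ × EuclideanSpace ℝ (Fin d) → ℂ} {u : L2 d}
    (hV : IsCutoff V M) (hw : IsVersion w u) (hu : ‖u‖ = 1) {m : ℝ × ℝ → ℝ} (hm : Measurable m)
    (hmpos : ∀ t s, t ≠ s → 0 < m (t, s)) {lam : ℝ} (hlam : 0 < lam)
    (hle : lam ≤ ∫ p, V p * ‖w p‖ ^ 2)
    (hlow : ∫⁻ z : ℝ × ℝ, ENNReal.ofReal (m z) * (localMass V w z.1 * localMass V w z.2) ≤
      ENNReal.ofReal (lam * (∫ p, V p * ‖w p‖ ^ 2) / 2))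
    (hfin : ∫⁻ q, ‖highKernel V m q‖ₑ ^ 2 ≠ ∞) :
    lam * (∫ p, V p * ‖w p‖ ^ 2) / 2 ≤
      ‖∫ q : (ℝ × EuclideanSpace ℝ (Fin d)) × (ℝ × EuclideanSpace ℝ (Fin d)),
        conj ((√(V q.1) : ℂ) * w q.1) * ((√(V q.2) : ℂ) * w q.2) * highKernel V m q‖ := by
  set α := ∫ p, V p * ‖w p‖ ^ 2 with hα
  have hα0 : 0 < α := hlam.trans_le hle
  have h1 := sq_integral_le_norm_integral_timeForm hV hw hu
  rw [← hα] at h1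
  have hlowint : ∫⁻ z, ‖lowForm V m w z‖ₑ ≤ ENNReal.ofReal (lam * α / 2) := by
    refine (lintegral_mono_ae ?_).trans hlow
    filter_upwards [ae_time_pair_ne] with z hz
    exact enorm_lowForm_le hV hw hz.1 hz.2.1 hz.2.2 (hmpos _ _ hz.2.2)
  have hlowI : Integrable (lowForm V m w) :=
    ⟨(stronglyMeasurable_lowForm hV hw hm).aestronglyMeasurable,
      hlowint.trans_lt ENNReal.ofReal_lt_top⟩
  have h2 : ‖∫ z, lowForm V m w z‖ ≤ lam * α / 2 := by
    have := (enorm_integral_le_lintegral_enorm (lowForm V m w)).trans hlowint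
    rw [← ofReal_norm] at this
    exact (ENNReal.ofReal_le_ofReal_iff (by positivity)).1 this
  have h3 : ∫ z, timeForm V w z = (∫ z, lowForm V m w z) +
      ∫ z, (timeForm V w z - lowForm V m w z) := by
    rw [integral_sub (integrable_timeForm hV hw) hlowI]
    ring
  have h4 : ∫ z, (timeForm V w z - lowForm V m w z) =
      ∫ q : (ℝ × EuclideanSpace ℝ (Fin d)) × (ℝ × EuclideanSpace ℝ (Fin d)),
        conj ((√(V q.1) : ℂ) * w q.1) * ((√(V q.2) : ℂ) * w q.2) * highKernel V m q := by
    have hP := memLp_sqrt_mul hV hw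
    have hk2 : MemLp (highKernel V m) 2 := by
      refine ⟨(measurable_highKernel hV hm).aestronglyMeasurable, ?_⟩
      rw [eLpNorm_eq_lintegral_rpow_enorm_toReal (by simp) (by simp)]
      refine ENNReal.rpow_lt_top_of_nonneg (by simp) ?_
      simpa using hfin
    have hPP : MemLp (fun q : (ℝ × EuclideanSpace ℝ (Fin d)) × (ℝ × EuclideanSpace ℝ (Fin d)) =>
        conj ((√(V q.1) : ℂ) * w q.1) * ((√(V q.2) : ℂ) * w q.2)) 2 := by
      have hmm : AEStronglyMeasurable (fun q : (ℝ × EuclideanSpace ℝ (Fin d)) ×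
          (ℝ × EuclideanSpace ℝ (Fin d)) =>
          conj ((√(V q.1) : ℂ) * w q.1) * ((√(V q.2) : ℂ) * w q.2)) volume := hP.star.1.comp_fst.mul hP.1.comp_snd
      rw [memLp_two_iff_integrable_sq_norm hmm]
      have h2 := ((memLp_two_iff_integrable_sq_norm hP.1).1 hP).mul_prod
        ((memLp_two_iff_integrable_sq_norm hP.1).1 hP)
      refine h2.congr (.of_forall fun q => ?_)
      simp [mul_pow]
    -- The finite Hilbert–Schmidt norm makes the high part absolutely integrable over pairs of
    -- space-time points, which justifies the reordering of variables below.
    have hint := hPP.integrable_mul hk2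
    have hmp := measurePreserving_prod_prod_comm (volume : Measure ℝ)
      (volume : Measure (EuclideanSpace ℝ (Fin d)))
    have hint' : Integrable (fun q : (ℝ × EuclideanSpace ℝ (Fin d)) ×
        (ℝ × EuclideanSpace ℝ (Fin d)) => conj ((√(V q.1) : ℂ) * w q.1) *
        ((√(V q.2) : ℂ) * w q.2) * highKernel V m q) (Measure.map
        (fun z : (ℝ × ℝ) × (EuclideanSpace ℝ (Fin d) × EuclideanSpace ℝ (Fin d)) =>
        ((z.1.1, z.2.1), (z.1.2, z.2.2))) ((volume.prod volume).prod (volume.prod volume))) := by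
      rw [hmp.map_eq]
      exact hint
    calc _ = ∫ z : ℝ × ℝ, ∫ p : EuclideanSpace ℝ (Fin d) × EuclideanSpace ℝ (Fin d),
          conj (√(V (z.1, p.1)) * w (z.1, p.1)) * (√(V (z.2, p.2)) * w (z.2, p.2)) *
          highKernel V m ((z.1, p.1), (z.2, p.2)) :=
          integral_congr_ae (ae_timeForm_sub_lowForm hV hw m)
      _ = _ := (integral_prod _ (hint'.comp_measurable hmp.measurable)).symm
      _ = _ := (integral_map hmp.measurable.aemeasurable hint'.1).symm
      _ = _ := by rw [hmp.map_eq]; rfl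
  rw [← h4]
  have h5 : ‖∫ z, timeForm V w z‖ ≤ ‖∫ z, lowForm V m w z‖ +
      ‖∫ z, (timeForm V w z - lowForm V m w z)‖ := by
    rw [h3]; exact norm_add_le _ _
  -- α² ≤ λα/2 + |high| and α ≥ λ give |high| ≥ α² - λα/2 ≥ λα/2.
  nlinarith

/-- A Chebyshev bound: each index with αᵢ ≥ λ contributes a diagonal matrix element of size at least
λ/2 to the high part, and the squares of these elements are controlled by its Hilbert–Schmidt norm.
-/
theorem sum_threshold_le {ι : Type*} [Fintype ι] {w : ι → ℝ × EuclideanSpace ℝ (Fin d) → ℂ}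
    {u : ι → L2 d} (hV : IsCutoff V M) (hw : ∀ i, IsVersion (w i) (u i)) (hu : ∀ i, ‖u i‖ = 1)
    (horth : ∀ i j, i ≠ j → ∫ p, (V p : ℂ) * (conj (w i p) * w j p) = 0)
    {m : ℝ × ℝ → ℝ} (hm : Measurable m)
    (hmpos : ∀ t s, t ≠ s → 0 < m (t, s)) {lam : ℝ} (hlam : 0 < lam)
    (hlow : ∀ i, ∫⁻ z : ℝ × ℝ, ENNReal.ofReal (m z) *
        (localMass V (w i) z.1 * localMass V (w i) z.2) ≤
      ENNReal.ofReal (lam * (∫ p, V p * ‖w i p‖ ^ 2) / 2)) :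
    ∑ i, (if lam ≤ ∫ p, V p * ‖w i p‖ ^ 2 then ENNReal.ofReal (lam ^ 2 / 4) else 0) ≤
      ∫⁻ q, ‖highKernel V m q‖ₑ ^ 2 := by
  classical
  by_cases hfin : ∫⁻ q, ‖highKernel V m q‖ₑ ^ 2 = ∞
  · rw [hfin]; exact le_top
  let α : ι → ℝ := fun i => ∫ p, V p * ‖w i p‖ ^ 2
  let J := {i : ι // lam ≤ α i}
  -- √V wᵢ has squared norm αᵢ ≥ λ > 0 on J, so it can be normalised; the hypothesis `horth` then
  -- makes the system orthonormal.
  let e : J → ℝ × EuclideanSpace ℝ (Fin d) → ℂ := fun i q =>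
    (((√(α i))⁻¹ : ℝ) : ℂ) * ((√(V q) : ℂ) * w i q)
  have he : ∀ i : J, MemLp (e i) 2 := fun i => (memLp_sqrt_mul hV (hw i)).const_mul _
  have hpos : ∀ i : J, 0 < α i := fun i => hlam.trans_le i.2
  have hee : ∀ (i j : J) q, conj (e i q) * e j q = (((√(α i))⁻¹ * (√(α j))⁻¹ : ℝ) : ℂ) *
      ((V q : ℂ) * (conj (w i q) * w j q)) := by
    intro i j q
    simp only [e, map_mul, Complex.conj_ofReal]
    have : (V q : ℂ) = (√(V q) : ℂ) * (√(V q) : ℂ) := by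
      rw [← Complex.ofReal_mul, Real.mul_self_sqrt (hV.nonneg q)]
    rw [this]
    push_cast
    ring
  have hon : ∀ i j : J, ∫ q, conj (e i q) * e j q = if i = j then 1 else 0 := by
    intro i j
    simp_rw [hee]
    rw [integral_const_mul]
    split_ifs with h
    · subst h
      have : ∫ q, (V q : ℂ) * (conj (w i q) * w i q) = ((α i : ℝ) : ℂ) := by
        simp only [α]
        rw [← integral_complex_ofReal]
        refine integral_congr_ae (.of_forall fun q => ?_)
        simp [Complex.conj_mul']
      rw [this, ← Complex.ofReal_mul, ← mul_inv, Real.mul_self_sqrt (hpos i).le,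
        inv_mul_cancel₀ (hpos i).ne']
      simp
    · rw [horth i j (fun h' => h (Subtype.ext h')), mul_zero]
  have hB := sum_enorm_integral_tensor_sq_le he hon
    (measurable_highKernel hV hm).aestronglyMeasurable
  refine le_trans ?_ hB
  rw [← Finset.sum_filter]
  rw [← Finset.sum_subtype_eq_sum_filter]
  have hcard : ∀ i : J, ENNReal.ofReal (lam ^ 2 / 4) ≤
      ‖∫ q, conj (e i q.1) * e i q.2 * highKernel V m q ∂(Measure.prod volume volume)‖ₑ ^ 2 := by
    intro i
    have h1 := le_enorm_integral_high hV (hw i) (hu i) hm hmpos hlam i.2 (hlow i) hfin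
    have h2 : ∫ q, conj (e i q.1) * e i q.2 * highKernel V m q ∂(Measure.prod volume volume) =
        (((α i)⁻¹ : ℝ) : ℂ) *
        ∫ q : (ℝ × EuclideanSpace ℝ (Fin d)) × (ℝ × EuclideanSpace ℝ (Fin d)),
        conj ((√(V q.1) : ℂ) * w i q.1) * ((√(V q.2) : ℂ) * w i q.2) * highKernel V m q := by
      rw [← integral_const_mul]
      refine integral_congr_ae (.of_forall fun q => ?_)
      simp only [e, map_mul, Complex.conj_ofReal]
      rw [show ((α i)⁻¹ : ℝ) = (√(α i))⁻¹ * (√(α i))⁻¹ by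
        rw [← mul_inv, Real.mul_self_sqrt (hpos i).le]]
      push_cast
      ring
    rw [h2, ← ofReal_norm, ← ENNReal.ofReal_pow (norm_nonneg _)]
    refine ENNReal.ofReal_le_ofReal ?_
    rw [norm_mul, Complex.norm_real, Real.norm_of_nonneg (inv_nonneg.2 (hpos i).le)]
    have h3 : lam / 2 ≤ (α i)⁻¹ * ‖∫ q : (ℝ × EuclideanSpace ℝ (Fin d)) ×
        (ℝ × EuclideanSpace ℝ (Fin d)),
        conj ((√(V q.1) : ℂ) * w i q.1) * ((√(V q.2) : ℂ) * w i q.2) * highKernel V m q‖ := by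
      rw [← div_eq_inv_mul, le_div_iff₀ (hpos i)]
      calc lam / 2 * α i = lam * α i / 2 := by ring
        _ ≤ _ := h1
    calc lam ^ 2 / 4 = (lam / 2) ^ 2 := by ring
      _ ≤ _ := by gcongr
  calc _ = ∑ i : J, ENNReal.ofReal (lam ^ 2 / 4) := by
        simp only [J, α]
        congr 1
        ext i
        simp
    _ ≤ _ := Finset.sum_le_sum fun i _ => hcard i

end

/-! ### Integration over thresholds and the dual estimate -/

theorem lintegral_Ioi_ite_le_rpow {a R : ℝ} (ha : 0 < a) (hR : 0 ≤ R) :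
    ∫⁻ x in Set.Ioi (0 : ℝ), (if x ≤ R then ENNReal.ofReal (x ^ (a - 1)) else 0) =
      ENNReal.ofReal (R ^ a / a) := by
  have h1 : ∀ x : ℝ, (if x ≤ R then ENNReal.ofReal (x ^ (a - 1)) else 0) =
      (Set.Iic R).indicator (fun x => ENNReal.ofReal (x ^ (a - 1))) x := by
    intro x; simp [Set.indicator_apply]
  simp_rw [h1]
  rw [setLIntegral_indicator measurableSet_Iic, Set.inter_comm, Set.Ioi_inter_Iic]
  rcases hR.eq_or_lt with rfl | hR
  · simp [ha.ne']
  · have := lintegral_Ioc_rpow_neg (δ := 1 - a) (by linarith) hR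
    simpa using this

section

variable {d : ℕ} {V : ℝ × EuclideanSpace ℝ (Fin d) → ℝ} {M : ℝ}

/-- Integrating the threshold bounds against `λ^{d-1} dλ`. -/
theorem lintegral_threshold_highKernel_le (hd : 1 ≤ d) (hV : IsCutoff V M) {κ : ℝ × ℝ → ℝ}
    (hκ : Measurable κ) (hκpos : ∀ t s, t ≠ s → 0 < κ (t, s)) :
    ∫⁻ lam in Set.Ioi (0 : ℝ), ENNReal.ofReal (lam ^ ((d : ℝ) - 1)) *
        ∫⁻ q, ‖highKernel V (fun z => lam * κ z) q‖ₑ ^ 2 ≤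
      ∫⁻ z : ℝ × ℝ, ENNReal.ofReal (|z.1 - z.2| ^ (-(d : ℝ)) * (κ z ^ (d : ℝ))⁻¹ / d) *
        ((∫⁻ x, ENNReal.ofReal (V (z.1, x) ^ (1 + (d : ℝ) / 2))) *
          ∫⁻ x, ENNReal.ofReal (V (z.2, x) ^ (1 + (d : ℝ) / 2))) := by
  have hd0 : (0 : ℝ) < d := by exact_mod_cast hd
  have hVm := hV.measurable
  have hne : ∀ᵐ q : (ℝ × EuclideanSpace ℝ (Fin d)) × (ℝ × EuclideanSpace ℝ (Fin d)),
      q.1.1 ≠ q.2.1 := by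
    have hms : MeasurableSet {q : (ℝ × EuclideanSpace ℝ (Fin d)) ×
        (ℝ × EuclideanSpace ℝ (Fin d)) | q.1.1 ≠ q.2.1} :=
      (measurableSet_eq_fun (measurable_fst.comp measurable_fst)
        (measurable_fst.comp measurable_snd)).compl
    rw [Measure.volume_eq_prod, Measure.ae_prod_iff_ae_ae hms]
    refine .of_forall fun a => ?_
    have h1 : ∀ᵐ t : ℝ, t ≠ a.1 := by simp [ae_iff]
    exact (Measure.quasiMeasurePreserving_fst.ae h1).mono fun b hb => hb.symm
  let A : (ℝ × EuclideanSpace ℝ (Fin d)) × (ℝ × EuclideanSpace ℝ (Fin d)) → ℝ≥0∞ := fun q =>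
    ENNReal.ofReal (|q.1.1 - q.2.1| ^ (-(d : ℝ)) * (V q.1 * V q.2))
  have hA : Measurable A := by fun_prop
  let F : ℝ → (ℝ × EuclideanSpace ℝ (Fin d)) × (ℝ × EuclideanSpace ℝ (Fin d)) → ℝ≥0∞ :=
    fun lam q => if (lam * κ (q.1.1, q.2.1)) ^ 2 < V q.1 * V q.2 then
      ENNReal.ofReal (lam ^ ((d : ℝ) - 1)) * A q else 0
  have hF : Measurable (Function.uncurry F) := by
    refine Measurable.ite (measurableSet_lt ?_ ?_) ?_ measurable_const
    · exact (measurable_fst.mul (hκ.comp (by fun_prop))).pow_const 2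
    · exact (hVm.comp (by fun_prop)).mul (hVm.comp (by fun_prop))
    · exact Measurable.mul (by fun_prop) (hA.comp measurable_snd)
  let G : (ℝ × EuclideanSpace ℝ (Fin d)) × (ℝ × EuclideanSpace ℝ (Fin d)) → ℝ≥0∞ := fun q =>
    ENNReal.ofReal (|q.1.1 - q.2.1| ^ (-(d : ℝ)) * (κ (q.1.1, q.2.1) ^ (d : ℝ))⁻¹ / d) *
      (ENNReal.ofReal (V q.1 ^ (1 + (d : ℝ) / 2)) * ENNReal.ofReal (V q.2 ^ (1 + (d : ℝ) / 2)))
  have hG : Measurable G := by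
    have h1 : Measurable fun q : (ℝ × EuclideanSpace ℝ (Fin d)) × (ℝ × EuclideanSpace ℝ (Fin d)) =>
        κ (q.1.1, q.2.1) := hκ.comp (by fun_prop)
    fun_prop
  have step1 : ∀ lam : ℝ, ENNReal.ofReal (lam ^ ((d : ℝ) - 1)) *
      ∫⁻ q, ‖highKernel V (fun z => lam * κ z) q‖ₑ ^ 2 ≤ ∫⁻ q, F lam q := by
    intro lam
    rw [← lintegral_const_mul _ ((measurable_highKernel hV (hκ.const_mul lam)).enorm.pow_const 2)]
    refine lintegral_mono_ae ?_
    filter_upwards [hne] with q hq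
    have := enorm_highKernel_sq_le hV (fun z => lam * κ z) q hq
    simp only [F]
    split_ifs with h
    · rw [if_pos h] at this
      gcongr
    · rw [if_neg h] at this
      rw [nonpos_iff_eq_zero.1 this, mul_zero]
  -- For a fixed pair of points the high kernel is present only for λ < √(V V)/κ. Integrating
  -- λ^{d-1} up to there gives (V V)^{d/2} κ^{-d}/d, which raises the factor V V to the power 1 +
  -- d/2.
  have step2 : ∀ᵐ q : (ℝ × EuclideanSpace ℝ (Fin d)) × (ℝ × EuclideanSpace ℝ (Fin d)),
      ∫⁻ lam in Set.Ioi (0 : ℝ), F lam q ≤ G q := by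
    filter_upwards [hne] with q hq
    have hk := hκpos _ _ hq
    have hv1 := hV.nonneg q.1
    have hv2 := hV.nonneg q.2
    have hR : 0 ≤ √(V q.1 * V q.2) / κ (q.1.1, q.2.1) := by positivity
    calc ∫⁻ lam in Set.Ioi (0 : ℝ), F lam q
        ≤ ∫⁻ lam in Set.Ioi (0 : ℝ), A q * (if lam ≤ √(V q.1 * V q.2) / κ (q.1.1, q.2.1) then
            ENNReal.ofReal (lam ^ ((d : ℝ) - 1)) else 0) := by
          refine setLIntegral_mono' measurableSet_Ioi fun lam hlam => ?_
          simp only [F]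
          by_cases h : (lam * κ (q.1.1, q.2.1)) ^ 2 < V q.1 * V q.2
          · rw [if_pos h, if_pos, mul_comm]
            rw [le_div_iff₀ hk]
            exact Real.le_sqrt_of_sq_le h.le
          · rw [if_neg h]; exact zero_le
      _ = A q * ENNReal.ofReal ((√(V q.1 * V q.2) / κ (q.1.1, q.2.1)) ^ (d : ℝ) / d) := by
          rw [lintegral_const_mul, lintegral_Ioi_ite_le_rpow hd0 hR]
          exact Measurable.ite (measurableSet_le measurable_id measurable_const) (by fun_prop)
            measurable_const
      _ = G q := by
          simp only [A, G]
          rw [← ENNReal.ofReal_mul (by positivity), ← ENNReal.ofReal_mul (by positivity),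
            ← ENNReal.ofReal_mul (by positivity)]
          congr 1
          have hvv : 0 ≤ V q.1 * V q.2 := mul_nonneg hv1 hv2
          rw [Real.div_rpow (Real.sqrt_nonneg _) hk.le, Real.sqrt_eq_rpow, ← Real.rpow_mul hvv,
            ← Real.mul_rpow hv1 hv2]
          have : (V q.1 * V q.2) ^ (1 + (d : ℝ) / 2) =
              (V q.1 * V q.2) * (V q.1 * V q.2) ^ ((1 : ℝ) / 2 * d) := by
            rw [Real.rpow_add_of_nonneg hvv zero_le_one (by positivity), Real.rpow_one]
            congr 2
            ring
          rw [this]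
          ring
  calc _ ≤ ∫⁻ lam in Set.Ioi (0 : ℝ), ∫⁻ q, F lam q := lintegral_mono fun lam => step1 lam
    _ = ∫⁻ q, ∫⁻ lam in Set.Ioi (0 : ℝ), F lam q := lintegral_lintegral_swap hF.aemeasurable
    _ ≤ ∫⁻ q, G q := lintegral_mono_ae step2
    _ = ∫⁻ z : ℝ × ℝ, ∫⁻ p : EuclideanSpace ℝ (Fin d) × EuclideanSpace ℝ (Fin d),
          G ((z.1, p.1), (z.2, p.2)) := by
        have hmp := measurePreserving_prod_prod_comm (volume : Measure ℝ)
          (volume : Measure (EuclideanSpace ℝ (Fin d)))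
        exact (hmp.lintegral_comp hG).symm.trans
          (lintegral_prod _ (hG.comp hmp.measurable).aemeasurable)
    _ = _ := by
        refine lintegral_congr fun z => ?_
        simp only [G]
        have hm1 : ∀ t, Measurable fun x => ENNReal.ofReal (V (t, x) ^ (1 + (d : ℝ) / 2)) := by
          intro t
          have := hV.measurable_slice t
          fun_prop
        rw [lintegral_const_mul _ (show Measurable fun p : EuclideanSpace ℝ (Fin d) ×
            EuclideanSpace ℝ (Fin d) => ENNReal.ofReal (V (z.1, p.1) ^ (1 + (d : ℝ) / 2)) *
              ENNReal.ofReal (V (z.2, p.2) ^ (1 + (d : ℝ) / 2)) from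
            ((hm1 _).comp measurable_fst).mul ((hm1 _).comp measurable_snd)),
          Measure.volume_eq_prod,
          lintegral_prod_mul (hm1 z.1).aemeasurable (hm1 z.2).aemeasurable]

end

/-- The dual Strichartz estimate for systems whose Gram matrix with respect to `V` is diagonal,
in terms of a positive majorant `ν` of `t ↦ ∫ V(t, x)^{1+d/2} dx`. -/
theorem exists_sum_rpow_le_of_orthogonal (d : ℕ) (hd : 1 ≤ d) :
    ∃ C : ℝ, 0 < C ∧ ∀ (V : ℝ × EuclideanSpace ℝ (Fin d) → ℝ) (M : ℝ), IsCutoff V M →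
      ∀ ν : ℝ → ℝ, Measurable ν → (∀ t, 0 < ν t) →
      (∀ t, ∫⁻ x, ENNReal.ofReal (V (t, x) ^ (1 + (d : ℝ) / 2)) ≤ ENNReal.ofReal (ν t)) →
      ∫⁻ t, ENNReal.ofReal (ν t) ≠ ∞ →
      ∀ (ι : Type) [Fintype ι] (w : ι → ℝ × EuclideanSpace ℝ (Fin d) → ℂ) (u : ι → L2 d),
      (∀ i, IsVersion (w i) (u i)) → (∀ i, ‖u i‖ = 1) →
      (∀ i j, i ≠ j → ∫ p, (V p : ℂ) * (conj (w i p) * w j p) = 0) →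
      ∑ i, ENNReal.ofReal ((∫ p, V p * ‖w i p‖ ^ 2) ^ ((d : ℝ) + 2)) ≤
        ENNReal.ofReal C * (∫⁻ t, ENNReal.ofReal (ν t)) ^ 2 := by
  have hd0 : (0 : ℝ) < d := by exact_mod_cast hd
  -- With κ ~ |t-s|^{-δ} the high part carries |t-s|^{-d(1-δ)}; this δ makes d(1-δ) = δ, so one
  -- Hardy–Littlewood–Sobolev exponent serves both parts.
  set δ : ℝ := d / (d + 1) with hδ
  have hδ0 : 0 < δ := by positivity
  have hδ1 : δ < 1 := by rw [hδ, div_lt_one (by positivity)]; linarith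
  have hδd : (1 - δ) * d = δ := by rw [hδ]; field_simp; ring
  obtain ⟨C₁, hC₁, hls1, hls2⟩ := exists_weighted_hardyLittlewoodSobolev hδ0 hδ1
  refine ⟨4 * (d + 2) * ((2 * C₁) ^ (d : ℝ) / d * C₁), by positivity, ?_⟩
  intro V M hV ν hν hνpos hνV hfin ι _ w u hw hu horth
  set B := ∫⁻ t, ENNReal.ofReal (ν t) with hB
  have hνe : Measurable fun t => ENNReal.ofReal (ν t) := ENNReal.measurable_ofReal.comp hν
  have hB0 : B ≠ 0 := by
    rw [hB, Ne, lintegral_eq_zero_iff hνe]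
    intro h
    have h2 : ∀ᵐ t : ℝ, False := by
      filter_upwards [h] with t ht
      have := hνpos t
      simp only [Pi.zero_apply, ENNReal.ofReal_eq_zero] at ht
      linarith
    simp only [Filter.eventually_false_iff_eq_bot, ae_eq_bot] at h2
    exact NeZero.ne _ h2
  have hb : 0 < B.toReal := ENNReal.toReal_pos hB0 hfin
  have hBb : B = ENNReal.ofReal B.toReal := (ENNReal.ofReal_toReal hfin).symm
  set b := B.toReal with hbdef
  -- Chosen so that c C₁ B^{1-δ} = 1/2: the low part at level λ is then bounded by exactly λα/2.
  set c : ℝ := (2 * C₁ * b ^ (1 - δ))⁻¹ with hc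
  have hc0 : 0 < c := by positivity
  let κ : ℝ × ℝ → ℝ := fun z => c * |z.1 - z.2| ^ (-δ) * (ν z.1 * ν z.2) ^ ((1 - δ) / 2)
  have hκ : Measurable κ := by fun_prop
  have hκpos : ∀ t s, t ≠ s → 0 < κ (t, s) := by
    intro t s hts
    have := abs_pos.2 (sub_ne_zero.2 hts)
    have := hνpos t
    have := hνpos s
    simp only [κ]
    positivity
  have hk : Measurable fun z : ℝ × ℝ => ENNReal.ofReal (|z.1 - z.2| ^ (-δ)) := by fun_prop
  let α : ι → ℝ := fun i => ∫ p, V p * ‖w i p‖ ^ 2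
  have hα : ∀ i, 0 ≤ α i := fun i =>
    integral_nonneg fun p => mul_nonneg (hV.nonneg p) (sq_nonneg _)
  have hlow : ∀ lam : ℝ, 0 < lam → ∀ i, ∫⁻ z : ℝ × ℝ, ENNReal.ofReal (lam * κ z) *
        (localMass V (w i) z.1 * localMass V (w i) z.2) ≤ ENNReal.ofReal (lam * α i / 2) := by
    intro lam hlam i
    have hφ := measurable_localMass hV (hw i)
    have e1 : ∀ z : ℝ × ℝ, ENNReal.ofReal (lam * κ z) *
        (localMass V (w i) z.1 * localMass V (w i) z.2) = ENNReal.ofReal (lam * c) *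
        ((localMass V (w i) z.1 * ENNReal.ofReal (ν z.1) ^ ((1 - δ) / 2)) *
          (localMass V (w i) z.2 * ENNReal.ofReal (ν z.2) ^ ((1 - δ) / 2)) *
          ENNReal.ofReal (|z.1 - z.2| ^ (-δ))) := by
      intro z
      have h1 := hνpos z.1
      have h2 := hνpos z.2
      simp only [κ]
      rw [show lam * (c * |z.1 - z.2| ^ (-δ) * (ν z.1 * ν z.2) ^ ((1 - δ) / 2)) =
        (lam * c) * (|z.1 - z.2| ^ (-δ) * (ν z.1 ^ ((1 - δ) / 2) * ν z.2 ^ ((1 - δ) / 2))) by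
          rw [Real.mul_rpow h1.le h2.le]; ring,
        ENNReal.ofReal_mul (p := lam * c) (by positivity),
        ENNReal.ofReal_mul (p := |z.1 - z.2| ^ (-δ)) (by positivity),
        ENNReal.ofReal_mul (p := ν z.1 ^ ((1 - δ) / 2)) (by positivity), ENNReal.ofReal_rpow_of_pos h1,
        ENNReal.ofReal_rpow_of_pos h2]
      ring
    have hmeas : Measurable fun z : ℝ × ℝ =>
        (localMass V (w i) z.1 * ENNReal.ofReal (ν z.1) ^ ((1 - δ) / 2)) *
          (localMass V (w i) z.2 * ENNReal.ofReal (ν z.2) ^ ((1 - δ) / 2)) *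
          ENNReal.ofReal (|z.1 - z.2| ^ (-δ)) := by fun_prop
    simp_rw [e1]
    rw [lintegral_const_mul _ hmeas, Measure.volume_eq_prod, lintegral_prod _ hmeas.aemeasurable]
    calc _ ≤ ENNReal.ofReal (lam * c) * (ENNReal.ofReal C₁ *
          ((∫⁻ t, localMass V (w i) t ^ (2 : ℝ)) * B ^ (1 - δ))) := by
          gcongr
          exact hls2 _ _ hφ hνe
      _ = ENNReal.ofReal (lam * α i / 2) := by
          rw [lintegral_localMass_sq hV (hw i), hBb, ENNReal.ofReal_rpow_of_pos hb,
            ← ENNReal.ofReal_mul (hα i), ← ENNReal.ofReal_mul hC₁.le,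
            ← ENNReal.ofReal_mul (by positivity)]
          congr 1
          rw [hc]
          have : b ^ (1 - δ) ≠ 0 := (by positivity : 0 < b ^ (1 - δ)).ne'
          simp only [α]
          field_simp
  have hthr : ∀ lam : ℝ, 0 < lam →
      ∑ i, (if lam ≤ α i then ENNReal.ofReal (lam ^ 2 / 4) else 0) ≤
      ∫⁻ q, ‖highKernel V (fun z => lam * κ z) q‖ₑ ^ 2 := fun lam hlam =>
    sum_threshold_le hV hw hu horth (hκ.const_mul lam)
      (fun t s hts => mul_pos hlam (hκpos t s hts)) hlam (hlow lam hlam)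
  -- Layer cake: ∫₀^α λ^{d-1} · λ²/4 dλ = α^{d+2}/(4(d+2)).
  have hL : ∫⁻ lam in Set.Ioi (0 : ℝ), ENNReal.ofReal (lam ^ ((d : ℝ) - 1)) *
      ∑ i, (if lam ≤ α i then ENNReal.ofReal (lam ^ 2 / 4) else 0) =
      ∑ i, ENNReal.ofReal (α i ^ ((d : ℝ) + 2)) * ENNReal.ofReal (4 * (d + 2))⁻¹ := by
    have e1 : ∀ lam ∈ Set.Ioi (0 : ℝ), ENNReal.ofReal (lam ^ ((d : ℝ) - 1)) *
        ∑ i, (if lam ≤ α i then ENNReal.ofReal (lam ^ 2 / 4) else 0) =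
        ∑ i, ENNReal.ofReal (1 / 4) *
          (if lam ≤ α i then ENNReal.ofReal (lam ^ ((d : ℝ) + 2 - 1)) else 0) := by
      intro lam hlam
      have hlam : 0 < lam := hlam
      rw [Finset.mul_sum]
      refine Finset.sum_congr rfl fun i _ => ?_
      split_ifs
      · rw [← ENNReal.ofReal_mul (by positivity), ← ENNReal.ofReal_mul (by positivity)]
        congr 1
        rw [show (d : ℝ) + 2 - 1 = ((d : ℝ) - 1) + 2 by ring, Real.rpow_add hlam, Real.rpow_two]
        ring
      · simp
    have hmi : ∀ i, Measurable fun lam : ℝ =>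
        (if lam ≤ α i then ENNReal.ofReal (lam ^ ((d : ℝ) + 2 - 1)) else 0) := fun i =>
      Measurable.ite (measurableSet_le measurable_id measurable_const) (by fun_prop)
        measurable_const
    rw [setLIntegral_congr_fun measurableSet_Ioi e1,
      lintegral_finsetSum _ (fun i _ => (hmi i).const_mul _)]
    refine Finset.sum_congr rfl fun i _ => ?_
    rw [lintegral_const_mul _ (hmi i), lintegral_Ioi_ite_le_rpow (by positivity) (hα i),
      ← ENNReal.ofReal_mul (by positivity), ← ENNReal.ofReal_mul (Real.rpow_nonneg (hα i) _)]
    congr 1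
    field_simp
  have hH : ∫⁻ lam in Set.Ioi (0 : ℝ), ENNReal.ofReal (lam ^ ((d : ℝ) - 1)) *
        ∫⁻ q, ‖highKernel V (fun z => lam * κ z) q‖ₑ ^ 2 ≤
      ENNReal.ofReal ((2 * C₁) ^ (d : ℝ) / d * C₁) * B ^ 2 := by
    refine (lintegral_threshold_highKernel_le hd hV hκ hκpos).trans ?_
    have hmeas : Measurable fun z : ℝ × ℝ => ENNReal.ofReal (ν z.1) ^ (1 - δ / 2) *
        ENNReal.ofReal (ν z.2) ^ (1 - δ / 2) * ENNReal.ofReal (|z.1 - z.2| ^ (-δ)) := by fun_prop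
    calc _ ≤ ∫⁻ z : ℝ × ℝ, ENNReal.ofReal ((2 * C₁) ^ (d : ℝ) / d * b ^ δ) *
          (ENNReal.ofReal (ν z.1) ^ (1 - δ / 2) *
          ENNReal.ofReal (ν z.2) ^ (1 - δ / 2) * ENNReal.ofReal (|z.1 - z.2| ^ (-δ))) := by
          refine lintegral_mono_ae ?_
          filter_upwards [ae_time_pair_ne] with z hz
          have h1 := hνpos z.1
          have h2 := hνpos z.2
          have h3 := abs_pos.2 (sub_ne_zero.2 hz.2.2)
          refine (mul_le_mul_right (mul_le_mul' (hνV z.1) (hνV z.2)) _).trans (le_of_eq ?_)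
          rw [ENNReal.ofReal_rpow_of_pos h1, ENNReal.ofReal_rpow_of_pos h2,
            ← ENNReal.ofReal_mul (by positivity), ← ENNReal.ofReal_mul (by positivity),
            ← ENNReal.ofReal_mul (by positivity), ← ENNReal.ofReal_mul (by positivity),
            ← ENNReal.ofReal_mul (by positivity)]
          congr 1
          have e1 : κ z ^ (d : ℝ) = c ^ (d : ℝ) * |z.1 - z.2| ^ (-δ * d) *
              (ν z.1 ^ (δ / 2) * ν z.2 ^ (δ / 2)) := by
            simp only [κ]
            rw [Real.mul_rpow (by positivity) (by positivity),
              Real.mul_rpow (by positivity) (by positivity), ← Real.rpow_mul h3.le,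
              ← Real.rpow_mul (by positivity), Real.mul_rpow h1.le h2.le]
            have : (1 - δ) / 2 * d = δ / 2 := by rw [div_mul_eq_mul_div, hδd]
            rw [this]
          have e2 : c ^ (d : ℝ) = ((2 * C₁) ^ (d : ℝ) * b ^ δ)⁻¹ := by
            rw [hc, Real.inv_rpow (by positivity), Real.mul_rpow (by positivity) (by positivity),
              ← Real.rpow_mul hb.le, hδd]
          have e3 : ∀ x : ℝ, 0 < x → x ^ (1 - δ / 2) = x * (x ^ (δ / 2))⁻¹ := by
            intro x hx
            rw [sub_eq_add_neg, Real.rpow_add hx, Real.rpow_one, Real.rpow_neg hx.le]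
          -- The balance δ + δd = d: the second factor cancels against κ^{-d}, leaving the kernel
          -- |t-s|^{-δ}.
          have e4 : |z.1 - z.2| ^ (-(d : ℝ)) = |z.1 - z.2| ^ (-δ) * |z.1 - z.2| ^ (-δ * d) := by
            rw [← Real.rpow_add h3]
            congr 1
            linarith
          have h4 : |z.1 - z.2| ^ (-δ * d) ≠ 0 := (Real.rpow_pos_of_pos h3 _).ne'
          rw [e1, e2, e3 _ h1, e3 _ h2, e4]
          field_simp
      _ ≤ ENNReal.ofReal ((2 * C₁) ^ (d : ℝ) / d * b ^ δ) *
          (ENNReal.ofReal C₁ * B ^ (2 - δ)) := by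
          rw [lintegral_const_mul _ hmeas, Measure.volume_eq_prod,
            lintegral_prod _ hmeas.aemeasurable]
          gcongr
          exact hls1 _ hνe
      _ = _ := by
          rw [hBb, ENNReal.ofReal_rpow_of_pos hb, ← ENNReal.ofReal_pow hb.le,
            ← ENNReal.ofReal_mul (by positivity), ← ENNReal.ofReal_mul (by positivity),
            ← ENNReal.ofReal_mul (by positivity)]
          congr 1
          have : b ^ 2 = b ^ δ * b ^ (2 - δ) := by
            rw [← Real.rpow_add hb, add_sub_cancel, Real.rpow_two]
          rw [this]
          ring
  have hmain : ∑ i, ENNReal.ofReal (α i ^ ((d : ℝ) + 2)) * ENNReal.ofReal (4 * (d + 2))⁻¹ ≤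
      ENNReal.ofReal ((2 * C₁) ^ (d : ℝ) / d * C₁) * B ^ 2 := by
    rw [← hL]
    refine le_trans (setLIntegral_mono' measurableSet_Ioi fun lam hlam => ?_) hH
    gcongr
    exact hthr lam hlam
  rw [← Finset.sum_mul] at hmain
  have hpos4 : (0 : ℝ) < 4 * (d + 2) := by positivity
  calc ∑ i, ENNReal.ofReal (α i ^ ((d : ℝ) + 2))
      = ENNReal.ofReal (4 * (d + 2)) * ((∑ i, ENNReal.ofReal (α i ^ ((d : ℝ) + 2))) *
          ENNReal.ofReal (4 * (d + 2))⁻¹) := by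
        rw [mul_comm (∑ i, _), ← mul_assoc, ← ENNReal.ofReal_mul hpos4.le,
          mul_inv_cancel₀ hpos4.ne', ENNReal.ofReal_one, one_mul]
    _ ≤ ENNReal.ofReal (4 * (d + 2)) * (ENNReal.ofReal ((2 * C₁) ^ (d : ℝ) / d * C₁) * B ^ 2) := by
        gcongr
    _ = _ := by
        rw [← mul_assoc, ← ENNReal.ofReal_mul hpos4.le]

/-! ### From orthogonal systems to arbitrary orthonormal ones -/

theorem IsVersion.zero {d : ℕ} : IsVersion (fun _ => 0) (0 : L2 d) where
  measurable := measurable_const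
  ae_eq t _ := by
    rw [map_zero]
    exact Lp.coeFn_zero _ _ _

theorem IsVersion.add {d : ℕ} {w w' : ℝ × EuclideanSpace ℝ (Fin d) → ℂ} {u u' : L2 d}
    (h : IsVersion w u) (h' : IsVersion w' u') : IsVersion (fun p => w p + w' p) (u + u') where
  measurable := h.measurable.add h'.measurable
  ae_eq t ht := by
    rw [map_add]
    filter_upwards [Lp.coeFn_add (propagator d t u) (propagator d t u'), h.ae_eq t ht,
      h'.ae_eq t ht] with x h1 h2 h3
    rw [h1, Pi.add_apply, h2, h3]

theorem IsVersion.const_smul {d : ℕ} {w : ℝ × EuclideanSpace ℝ (Fin d) → ℂ} {u : L2 d}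
    (h : IsVersion w u) (c : ℂ) : IsVersion (fun p => c * w p) (c • u) where
  measurable := h.measurable.const_mul c
  ae_eq t ht := by
    rw [map_smul]
    filter_upwards [Lp.coeFn_smul c (propagator d t u), h.ae_eq t ht] with x h1 h2
    rw [h1, Pi.smul_apply, h2, smul_eq_mul]

theorem IsVersion.sum {d : ℕ} {κ : Type*} {w : κ → ℝ × EuclideanSpace ℝ (Fin d) → ℂ}
    {u : κ → L2 d} (h : ∀ i, IsVersion (w i) (u i)) (c : κ → ℂ) (s : Finset κ) :
    IsVersion (fun p => ∑ i ∈ s, c i * w i p) (∑ i ∈ s, c i • u i) := by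
  classical
  induction s using Finset.induction_on with
  | empty => simpa using IsVersion.zero
  | insert a s ha ih =>
    simp only [Finset.sum_insert ha]
    exact ((h a).const_smul (c a)).add ih

section

variable {ι H : Type*} [Fintype ι] [NormedAddCommGroup H] [InnerProductSpace ℂ H]

theorem inner_sum_smul_sum_smul (U : Matrix ι ι ℂ) (e : ι → H) (a b : ι) :
    inner ℂ (∑ j, U j a • e j) (∑ j, U j b • e j) =
      (star U * Matrix.of (fun j k => inner ℂ (e j) (e k)) * U) a b := by
  simp only [sum_inner, inner_sum, inner_smul_left, inner_smul_right, Matrix.mul_apply,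
    Matrix.of_apply, Matrix.star_apply, Finset.sum_mul, Finset.mul_sum, RCLike.star_def]
  refine Finset.sum_congr rfl fun j _ => Finset.sum_congr rfl fun k _ => ?_
  ring

/-- The columns of U are an orthonormal eigenbasis of the Gram matrix of e, so mixing by U
diagonalises it. -/
theorem exists_unitary_orthogonal [DecidableEq ι] (e : ι → H) :
    ∃ U : Matrix ι ι ℂ, star U * U = 1 ∧ U * star U = 1 ∧
      ∀ a b, a ≠ b → inner ℂ (∑ j, U j a • e j) (∑ j, U j b • e j) = 0 := by
  have hG : (Matrix.of (fun j k => inner ℂ (e j) (e k)) : Matrix ι ι ℂ).IsHermitian := by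
    ext j k
    simp [Matrix.conjTranspose_apply]
  refine ⟨hG.eigenvectorUnitary, Unitary.coe_star_mul_self _, Unitary.coe_mul_star_self _,
    fun a b hab => ?_⟩
  have h := hG.conjStarAlgAut_star_eigenvectorUnitary
  rw [Unitary.conjStarAlgAut_star_apply] at h
  rw [inner_sum_smul_sum_smul]
  rw [h, Matrix.diagonal_apply_ne _ hab]

/-- Unitary mixing towards an orthogonal family does not decrease power sums. -/
theorem sum_norm_rpow_le_of_unitary [DecidableEq ι] {U : Matrix ι ι ℂ} (h1 : star U * U = 1) (h2 : U * star U = 1)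
    (e : ι → H) (horth : ∀ a b, a ≠ b → inner ℂ (∑ j, U j a • e j) (∑ j, U j b • e j) = 0)
    {s : ℝ} (hs : 1 ≤ s) :
    ∑ j, (‖e j‖ ^ 2) ^ s ≤ ∑ a, (‖∑ j, U j a • e j‖ ^ 2) ^ s := by
  set f : ι → H := fun a => ∑ j, U j a • e j with hf
  have hrow : ∀ j k, ∑ a, U j a * conj (U k a) = if j = k then 1 else 0 := by
    intro j k
    have := congrFun (congrFun h2 j) k
    simpa [Matrix.mul_apply, Matrix.one_apply] using this
  have hcol : ∀ a, ∑ j, ‖U j a‖ ^ 2 = 1 := by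
    intro a
    have := congrFun (congrFun h1 a) a
    simp only [Matrix.mul_apply, Matrix.star_apply, Matrix.one_apply_eq, RCLike.star_def,
      Complex.conj_mul'] at this
    exact_mod_cast this
  have hrow1 : ∀ j, ∑ a, ‖U j a‖ ^ 2 = 1 := by
    intro j
    have := hrow j j
    simp only [Complex.mul_conj', if_true] at this
    exact_mod_cast this
  have he : ∀ j, e j = ∑ a, conj (U j a) • f a := by
    intro j
    simp only [hf, Finset.smul_sum, smul_smul]
    rw [Finset.sum_comm]
    simp only [← Finset.sum_smul]
    have : ∀ k, ∑ a, conj (U j a) * U k a = if k = j then 1 else 0 := by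
      intro k; rw [← hrow k j]; exact Finset.sum_congr rfl fun _ _ => mul_comm _ _
    simp [this]
  have hn : ∀ j, ‖e j‖ ^ 2 = ∑ a, ‖U j a‖ ^ 2 * ‖f a‖ ^ 2 := by
    intro j
    have : (inner ℂ (e j) (e j) : ℂ) = ∑ a, ((‖U j a‖ ^ 2 * ‖f a‖ ^ 2 : ℝ) : ℂ) := by
      rw [he j, sum_inner]
      refine Finset.sum_congr rfl fun a _ => ?_
      rw [inner_sum, Finset.sum_eq_single a]
      · rw [inner_smul_left, inner_smul_right, inner_self_eq_norm_sq_to_K, Complex.conj_conj,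
          ← mul_assoc, Complex.mul_conj']
        push_cast; rfl
      · intro b _ hb
        rw [inner_smul_left, inner_smul_right, horth a b hb.symm]; simp
      · simp
    rw [inner_self_eq_norm_sq_to_K, ← Complex.ofReal_sum] at this
    exact Complex.ofReal_injective (by rw [← this]; norm_cast)
  calc ∑ j, (‖e j‖ ^ 2) ^ s = ∑ j, (∑ a, ‖U j a‖ ^ 2 * ‖f a‖ ^ 2) ^ s := by simp only [hn]
    _ ≤ ∑ j, ∑ a, ‖U j a‖ ^ 2 * (‖f a‖ ^ 2) ^ s := by
        refine Finset.sum_le_sum fun j _ => ?_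
        -- The matrix |U_{ja}|² is doubly stochastic: its rows provide the weights for Jensen's
        -- inequality, its columns collapse the double sum afterwards.
        exact Real.rpow_arith_mean_le_arith_mean_rpow _ _ _ (fun _ _ => by positivity)
          (hrow1 j) (fun _ _ => by positivity) hs
    _ = ∑ a, (‖f a‖ ^ 2) ^ s := by
        rw [Finset.sum_comm]
        refine Finset.sum_congr rfl fun a _ => ?_
        rw [← Finset.sum_mul, hcol, one_mul]

end

/-- A unitary mixing of the uᵢ keeps them orthonormal and can be chosen to make the √V wᵢ
orthogonal; the sum of powers for the original system is at most that for the mixed one. -/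
theorem exists_sum_rpow_le (d : ℕ) (hd : 1 ≤ d) :
    ∃ C : ℝ, 0 < C ∧ ∀ (V : ℝ × EuclideanSpace ℝ (Fin d) → ℝ) (M : ℝ), IsCutoff V M →
      ∀ (N : ℕ) (w : Fin N → ℝ × EuclideanSpace ℝ (Fin d) → ℂ) (u : Fin N → L2 d),
      (∀ i, IsVersion (w i) (u i)) → Orthonormal ℂ u →
      ∑ i, ENNReal.ofReal ((∫ p, V p * ‖w i p‖ ^ 2) ^ ((d : ℝ) + 2)) ≤
        ENNReal.ofReal C * (∫⁻ p, ENNReal.ofReal (V p ^ (1 + (d : ℝ) / 2))) ^ 2 := by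
  obtain ⟨C, hC, H⟩ := exists_sum_rpow_le_of_orthogonal d hd
  refine ⟨C * 4, by positivity, fun V M hV N w u hw hu => ?_⟩
  have hm : Measurable fun p => ENNReal.ofReal (V p ^ (1 + (d : ℝ) / 2)) :=
    (hV.measurable.pow_const _).ennreal_ofReal
  set n : ℝ → ℝ≥0∞ := fun t => ∫⁻ x, ENNReal.ofReal (V (t, x) ^ (1 + (d : ℝ) / 2)) with hn
  have hnm : Measurable n := hm.lintegral_prod_right'
  have hI : ∫⁻ p, ENNReal.ofReal (V p ^ (1 + (d : ℝ) / 2)) = ∫⁻ t, n t := by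
    rw [Measure.volume_eq_prod, lintegral_prod _ hm.aemeasurable]
  set I := ∫⁻ p, ENNReal.ofReal (V p ^ (1 + (d : ℝ) / 2)) with hIdef
  have hM := hV.bound_nonneg
  have hs : (1 + (d : ℝ) / 2) ≠ 0 := by positivity
  set B := Metric.closedBall (0 : EuclideanSpace ℝ (Fin d)) M with hB
  have hnle : ∀ t, n t ≤ (Set.Icc (-M) M).indicator
      (fun _ => ENNReal.ofReal (M ^ (1 + (d : ℝ) / 2)) * volume B) t := by
    intro t
    by_cases ht : t ∈ Set.Icc (-M) M
    · rw [Set.indicator_of_mem ht]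
      calc n t ≤ ∫⁻ x, B.indicator (fun _ => ENNReal.ofReal (M ^ (1 + (d : ℝ) / 2))) x := by
            refine lintegral_mono fun x => ?_
            by_cases hx : x ∈ B
            · rw [Set.indicator_of_mem hx]
              gcongr
              · exact hV.nonneg _
              · exact hV.le _
            · rw [hV.eq_zero_of_space _ (by simpa [hB] using hx)]
              simp [Real.zero_rpow hs]
        _ = _ := lintegral_indicator_const Metric.isClosed_closedBall.measurableSet _
    · have : n t = 0 := by
        have : ∀ x, V (t, x) = 0 := fun x => hV.eq_zero_of_time _ (by
          simp only [Set.mem_Icc, ← abs_le, not_le] at ht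
          exact ht)
        simp [hn, this, Real.zero_rpow hs]
      simp [this]
  have hBfin : volume B ≠ ∞ := measure_closedBall_lt_top.ne
  have hnfin : ∀ t, n t ≠ ∞ := fun t => ne_top_of_le_ne_top
    (ENNReal.mul_ne_top ENNReal.ofReal_ne_top hBfin)
    ((hnle t).trans (Set.indicator_le_self' (fun _ _ => zero_le) t))
  have hIfin : I ≠ ∞ := by
    rw [hI]
    refine ne_top_of_le_ne_top ?_ (lintegral_mono hnle)
    rw [lintegral_indicator_const measurableSet_Icc]
    exact ENNReal.mul_ne_top (ENNReal.mul_ne_top ENNReal.ofReal_ne_top hBfin) (by simp)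
  rcases eq_or_ne I 0 with hI0 | hI0
  · have hV0 : ∀ᵐ p, V p = 0 := by
      rw [hIdef, lintegral_eq_zero_iff hm] at hI0
      filter_upwards [hI0] with p hp
      rw [Pi.zero_apply, ENNReal.ofReal_eq_zero] at hp
      by_contra h
      exact absurd hp (not_le.2 (Real.rpow_pos_of_pos ((hV.nonneg p).lt_of_ne' h) _))
    have : ∀ i, ∫ p, V p * ‖w i p‖ ^ 2 = 0 := fun i =>
      integral_eq_zero_of_ae (by filter_upwards [hV0] with p hp; simp [hp])
    simp [this, Real.zero_rpow (show (d : ℝ) + 2 ≠ 0 by positivity)]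
  have hIpos : 0 < I.toReal := ENNReal.toReal_pos hI0 hIfin
  -- A Cauchy density of total mass I is added so that ν is positive at every time, also where V(t)
  -- vanishes. The total mass becomes 2I, whence the factor 4 in the constant.
  set ν : ℝ → ℝ := fun t => (n t).toReal + I.toReal * (Real.pi⁻¹ * (1 + t ^ 2)⁻¹) with hν
  have hνint : ∫⁻ t, ENNReal.ofReal (ν t) = 2 * I := by
    have h1 : ∀ t, ENNReal.ofReal (ν t) =
        n t + ENNReal.ofReal I.toReal * ENNReal.ofReal (Real.pi⁻¹ * (1 + t ^ 2)⁻¹) := by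
      intro t
      rw [hν, ENNReal.ofReal_add ENNReal.toReal_nonneg (by positivity),
        ENNReal.ofReal_toReal (hnfin t), ENNReal.ofReal_mul hIpos.le]
    simp only [h1]
    rw [lintegral_add_left hnm, lintegral_const_mul _ (by fun_prop),
      ← ofReal_integral_eq_lintegral_ofReal (integrable_inv_one_add_sq.const_mul _)
        (.of_forall fun t => by positivity), integral_const_mul, integral_univ_inv_one_add_sq,
      inv_mul_cancel₀ Real.pi_pos.ne', ENNReal.ofReal_toReal hIfin, ← hI]
    simp [two_mul]
  let e : Fin N → Lp ℂ 2 (volume : Measure (ℝ × EuclideanSpace ℝ (Fin d))) :=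
    fun i => (memLp_sqrt_mul hV (hw i)).toLp
  obtain ⟨U, h1, h2, horth⟩ := exists_unitary_orthogonal e
  let w' : Fin N → ℝ × EuclideanSpace ℝ (Fin d) → ℂ := fun a p => ∑ j, U j a * w j p
  let u' : Fin N → L2 d := fun a => ∑ j, U j a • u j
  have hw' : ∀ a, IsVersion (w' a) (u' a) := fun a => IsVersion.sum hw _ _
  have hu' : ∀ a, ‖u' a‖ = 1 := by
    intro a
    have h3 : inner ℂ (u' a) (u' a) = 1 := by
      rw [inner_sum_smul_sum_smul, show (Matrix.of fun j k => inner ℂ (u j) (u k)) =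
        (1 : Matrix (Fin N) (Fin N) ℂ) from by
          ext j k; simp [Matrix.one_apply, orthonormal_iff_ite.1 hu], mul_one, h1, Matrix.one_apply_eq]
    rw [inner_self_eq_norm_sq_to_K] at h3
    have h4 : ‖u' a‖ ^ 2 = 1 := Complex.ofReal_injective (by push_cast; exact h3)
    exact (pow_eq_one_iff_of_nonneg (norm_nonneg _) two_ne_zero).1 h4
  have he' : ∀ a, ∑ j, U j a • e j = (memLp_sqrt_mul hV (hw' a)).toLp := by
    intro a
    refine Lp.ext ?_
    have h3 : ∀ j, (U j a • e j : Lp ℂ 2 _) =ᵐ[volume] fun p => U j a * ((√(V p) : ℂ) * w j p) := by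
      intro j
      filter_upwards [Lp.coeFn_smul (U j a) (e j), (memLp_sqrt_mul hV (hw j)).coeFn_toLp]
        with p h4 h5
      rw [h4, Pi.smul_apply, smul_eq_mul, h5]
    filter_upwards [Lp.coeFn_finsetSum Finset.univ (fun j => U j a • e j), ae_all_iff.2 h3,
      (memLp_sqrt_mul hV (hw' a)).coeFn_toLp] with p h4 h5 h6
    rw [h4, h6, Finset.sum_apply]
    simp only [h5, w', Finset.mul_sum]
    exact Finset.sum_congr rfl fun j _ => by ring
  have hVV : ∀ p, (√(V p) : ℂ) * (√(V p) : ℂ) = V p := fun p => by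
    rw [← Complex.ofReal_mul, Real.mul_self_sqrt (hV.nonneg p)]
  have hnorm : ∀ {v : ℝ × EuclideanSpace ℝ (Fin d) → ℂ} {g : L2 d} (hv : IsVersion v g),
      ∫ p, V p * ‖v p‖ ^ 2 = ‖(memLp_sqrt_mul hV hv).toLp‖ ^ 2 := by
    intro v g hv
    have h3 := inner_toLp_eq_integral (memLp_sqrt_mul hV hv) (memLp_sqrt_mul hV hv)
    rw [inner_self_eq_norm_sq_to_K] at h3
    have h4 : ∀ p, conj ((√(V p) : ℂ) * v p) * ((√(V p) : ℂ) * v p) =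
        ((V p * ‖v p‖ ^ 2 : ℝ) : ℂ) := by
      intro p
      rw [map_mul, Complex.conj_ofReal, mul_mul_mul_comm, hVV, Complex.conj_mul']
      push_cast; rfl
    simp only [h4] at h3
    rw [integral_complex_ofReal] at h3
    exact (Complex.ofReal_injective (by rw [← h3]; norm_cast)).symm
  have key := H V M hV ν (by fun_prop) (fun t => by positivity) (fun t => by
      rw [hν, ENNReal.ofReal_add ENNReal.toReal_nonneg (by positivity),
        ENNReal.ofReal_toReal (hnfin t)]
      exact le_self_add) (by rw [hνint]; exact ENNReal.mul_ne_top (by simp) hIfin)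
    (Fin N) w' u' hw' hu' (by
      intro a b hab
      have h3 := horth a b hab
      rw [he', he', inner_toLp_eq_integral] at h3
      rw [← h3]
      congr 1 with p
      rw [map_mul, Complex.conj_ofReal, mul_mul_mul_comm, hVV])
  rw [hνint] at key
  have hsum := sum_norm_rpow_le_of_unitary h1 h2 e horth
    (s := (d : ℝ) + 2) (by linarith [(Nat.cast_nonneg d : (0 : ℝ) ≤ d)])
  calc ∑ i, ENNReal.ofReal ((∫ p, V p * ‖w i p‖ ^ 2) ^ ((d : ℝ) + 2))
      = ENNReal.ofReal (∑ j, (‖e j‖ ^ 2) ^ ((d : ℝ) + 2)) := by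
        rw [ENNReal.ofReal_sum_of_nonneg fun _ _ => by positivity]
        simp only [hnorm (hw _), e]
    _ ≤ ENNReal.ofReal (∑ a, (‖∑ j, U j a • e j‖ ^ 2) ^ ((d : ℝ) + 2)) :=
        ENNReal.ofReal_le_ofReal hsum
    _ = ∑ i, ENNReal.ofReal ((∫ p, V p * ‖w' i p‖ ^ 2) ^ ((d : ℝ) + 2)) := by
        rw [ENNReal.ofReal_sum_of_nonneg fun _ _ => by positivity]
        simp only [hnorm (hw' _), he']
    _ ≤ ENNReal.ofReal C * (2 * I) ^ 2 := key
    _ = ENNReal.ofReal (C * 4) * I ^ 2 := by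
        rw [mul_pow, ← mul_assoc, ENNReal.ofReal_mul hC.le]
        norm_num

/-! ### Duality: the endpoint inequality -/

theorem le_rpow_of_le_mul_rpow {K B : ℝ≥0∞} {a b : ℝ} (ha : 0 ≤ a) (hb : 0 < b) (hab : a + b = 1)
    (hK : K ≠ ∞) (h : K ≤ B * K ^ a) : K ≤ B ^ (1 / b) := by
  rcases eq_or_ne K 0 with rfl | h0
  · exact zero_le
  have h1 : K ^ b ≤ B := by
    have h2 : K ^ b * K ^ a ≤ B * K ^ a := by
      rwa [← ENNReal.rpow_add _ _ h0 hK, add_comm, hab, ENNReal.rpow_one]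
    exact (ENNReal.mul_le_mul_iff_left (by simp [h0, hK]) (ENNReal.rpow_ne_top_of_nonneg ha hK)).1 h2
  calc K = (K ^ b) ^ (1 / b) := by rw [← ENNReal.rpow_mul, mul_one_div_cancel hb.ne', ENNReal.rpow_one]
    _ ≤ B ^ (1 / b) := by gcongr

/-- A truncation of `f ^ (2 / d)`. -/
noncomputable def truncatedPower {d : ℕ} (f : ℝ × EuclideanSpace ℝ (Fin d) → ℝ) (M : ℝ)
    (p : ℝ × EuclideanSpace ℝ (Fin d)) : ℝ :=
  if |p.1| ≤ M ∧ ‖p.2‖ ≤ M then min (f p ^ (2 / (d : ℝ))) M else 0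

section

variable {d : ℕ} {f : ℝ × EuclideanSpace ℝ (Fin d) → ℝ}

theorem isCutoff_truncatedPower (hf : Measurable f) (h0 : ∀ p, 0 ≤ f p) {M : ℝ} (hM : 0 ≤ M) :
    IsCutoff (truncatedPower f M) M where
  measurable := by
    refine Measurable.ite ?_ ((hf.pow_const _).min measurable_const) measurable_const
    exact (measurableSet_le (continuous_abs.measurable.comp measurable_fst) measurable_const).inter
      (measurableSet_le measurable_snd.norm measurable_const)
  nonneg p := by
    have := Real.rpow_nonneg (h0 p) (2 / (d : ℝ))
    unfold truncatedPower
    split_ifs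
    · exact le_min this hM
    · exact le_rfl
  le p := by
    unfold truncatedPower
    split_ifs
    · exact min_le_right _ _
    · exact hM
  eq_zero_of_time p hp := if_neg fun h => absurd h.1 (not_le.2 hp)
  eq_zero_of_space p hp := if_neg fun h => absurd h.2 (not_le.2 hp)

/-- V ≤ f^{2/d} gives V^{d/2} ≤ f. This makes the norm of V in the dual estimate controllable by the
pairing ∫ V f itself. -/
theorem truncatedPower_rpow_le (hd : 1 ≤ d) (hf : Measurable f) (h0 : ∀ p, 0 ≤ f p) {M : ℝ}
    (hM : 0 ≤ M) (p : ℝ × EuclideanSpace ℝ (Fin d)) :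
    truncatedPower f M p ^ (1 + (d : ℝ) / 2) ≤ truncatedPower f M p * f p := by
  have hd0 : (0 : ℝ) < d := by exact_mod_cast hd
  have hV := (isCutoff_truncatedPower hf h0 hM).nonneg p
  rw [Real.rpow_add' hV (by positivity), Real.rpow_one]
  gcongr
  unfold truncatedPower at hV ⊢
  split_ifs with h
  · rw [if_pos h] at hV
    calc (min (f p ^ (2 / (d : ℝ))) M) ^ ((d : ℝ) / 2) ≤ (f p ^ (2 / (d : ℝ))) ^ ((d : ℝ) / 2) := by
          gcongr
          exact min_le_left _ _
      _ = f p := by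
          rw [← Real.rpow_mul (h0 p)]
          field_simp
          simp
  · rw [Real.zero_rpow (by positivity)]
    exact h0 p

theorem eventually_truncatedPower_eq (p : ℝ × EuclideanSpace ℝ (Fin d)) :
    ∀ᶠ k : ℕ in atTop, truncatedPower f k p = f p ^ (2 / (d : ℝ)) := by
  filter_upwards [tendsto_natCast_atTop_atTop.eventually_ge_atTop |p.1|,
    tendsto_natCast_atTop_atTop.eventually_ge_atTop ‖p.2‖,
    tendsto_natCast_atTop_atTop.eventually_ge_atTop (f p ^ (2 / (d : ℝ)))] with k h1 h2 h3
  rw [truncatedPower, if_pos ⟨h1, h2⟩, min_eq_left h3]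

end

/-- The density f is tested against its own truncated power V, the extremiser of the duality pairing
up to truncation. The dual estimate bounds K = ∫ V f by a constant times K^{2/(d+2)}; absorbing that
factor and removing the truncation gives the claim. -/
theorem exists_lintegral_rpow_le_of_fin (d : ℕ) (hd : 1 ≤ d) :
    ∃ C : ℝ, 0 < C ∧ ∀ (N : ℕ) (w : Fin N → ℝ × EuclideanSpace ℝ (Fin d) → ℂ) (u : Fin N → L2 d),
      (∀ i, IsVersion (w i) (u i)) → Orthonormal ℂ u → ∀ m : Fin N → ℝ, (∀ i, 0 ≤ m i) →
      ∫⁻ p, ENNReal.ofReal ((∑ i, m i * ‖w i p‖ ^ 2) ^ (1 + 2 / (d : ℝ))) ≤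
        ENNReal.ofReal C *
          (∑ i, ENNReal.ofReal (m i) ^ (((d : ℝ) + 2) / (d + 1))) ^ (((d : ℝ) + 1) / d) := by
  have hd0 : (0 : ℝ) < d := by exact_mod_cast hd
  obtain ⟨C, hC, H⟩ := exists_sum_rpow_le d hd
  refine ⟨C ^ (1 / (d : ℝ)), by positivity, fun N w u hw hu m hm => ?_⟩
  set f : ℝ × EuclideanSpace ℝ (Fin d) → ℝ := fun p => ∑ i, m i * ‖w i p‖ ^ 2 with hf
  have hwm := fun i => (hw i).measurable
  have hfm : Measurable f := by fun_prop
  have hf0 : ∀ p, 0 ≤ f p := fun p => Finset.sum_nonneg fun i _ => by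
    have := hm i
    positivity
  set S := ∑ i, ENNReal.ofReal (m i) ^ (((d : ℝ) + 2) / (d + 1)) with hS
  have hcut := fun k : ℕ => isCutoff_truncatedPower hfm hf0 (M := k) (Nat.cast_nonneg k)
  have key : ∀ k : ℕ, ∫⁻ p, ENNReal.ofReal (truncatedPower f k p * f p) ≤
      ENNReal.ofReal (C ^ (1 / (d : ℝ))) * S ^ (((d : ℝ) + 1) / d) := by
    intro k
    set V := truncatedPower f k with hV
    have hi := fun i => (hcut k).integrable_mul_norm_sq (hw i)
    set α : Fin N → ℝ := fun i => ∫ p, V p * ‖w i p‖ ^ 2 with hα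
    have hα0 : ∀ i, 0 ≤ α i := fun i => integral_nonneg fun p =>
      mul_nonneg ((hcut k).nonneg p) (by positivity)
    set K := ∫⁻ p, ENNReal.ofReal (V p * f p) with hK
    have hVf : ∀ p, V p * f p = ∑ i, m i * (V p * ‖w i p‖ ^ 2) := fun p => by
      rw [hf, Finset.mul_sum]
      exact Finset.sum_congr rfl fun i _ => by ring
    have hKsum : K = ∑ i, ENNReal.ofReal (m i) * ENNReal.ofReal (α i) := by
      rw [hK, ← ofReal_integral_eq_lintegral_ofReal]
      · simp only [hVf]
        rw [integral_finsetSum _ fun i _ => (hi i).const_mul (m i),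
          ENNReal.ofReal_sum_of_nonneg]
        · exact Finset.sum_congr rfl fun i _ => by
            rw [integral_const_mul, ENNReal.ofReal_mul (hm i)]
        · intro i _
          rw [integral_const_mul]
          exact mul_nonneg (hm i) (hα0 i)
      · simp only [hVf]
        exact integrable_finsetSum _ fun i _ => (hi i).const_mul (m i)
      · exact .of_forall fun p => mul_nonneg ((hcut k).nonneg p) (hf0 p)
    have hKfin : K ≠ ∞ := by
      rw [hKsum]
      exact (ENNReal.sum_lt_top.2 fun i _ => ENNReal.mul_lt_top (by simp) (by simp)).ne
    have hJ : ∫⁻ p, ENNReal.ofReal (V p ^ (1 + (d : ℝ) / 2)) ≤ K := lintegral_mono fun p =>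
      ENNReal.ofReal_le_ofReal (truncatedPower_rpow_le hd hfm hf0 (Nat.cast_nonneg k) p)
    have hconj : (((d : ℝ) + 2) / (d + 1)).HolderConjugate ((d : ℝ) + 2) := by
      rw [Real.holderConjugate_iff]
      constructor
      · rw [lt_div_iff₀ (by positivity)]; linarith
      · field_simp; ring
    have hle : K ≤ (S ^ (((d : ℝ) + 1) / (d + 2)) * ENNReal.ofReal C ^ (1 / ((d : ℝ) + 2))) *
        K ^ (2 / ((d : ℝ) + 2)) := by
      calc K ≤ S ^ (1 / (((d : ℝ) + 2) / (d + 1))) *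
            (∑ i, ENNReal.ofReal (α i) ^ ((d : ℝ) + 2)) ^ (1 / ((d : ℝ) + 2)) := by
            rw [hKsum]
            exact ENNReal.inner_le_Lp_mul_Lq _ _ _ hconj
        _ ≤ S ^ (1 / (((d : ℝ) + 2) / (d + 1))) *
            (ENNReal.ofReal C * K ^ 2) ^ (1 / ((d : ℝ) + 2)) := by
            gcongr
            calc ∑ i, ENNReal.ofReal (α i) ^ ((d : ℝ) + 2)
                = ∑ i, ENNReal.ofReal (α i ^ ((d : ℝ) + 2)) :=
                  Finset.sum_congr rfl fun i _ =>
                    ENNReal.ofReal_rpow_of_nonneg (hα0 i) (by positivity)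
              _ ≤ ENNReal.ofReal C * (∫⁻ p, ENNReal.ofReal (V p ^ (1 + (d : ℝ) / 2))) ^ 2 :=
                  H V k (hcut k) N w u hw hu
              _ ≤ _ := by gcongr
        _ = _ := by
            rw [ENNReal.mul_rpow_of_nonneg _ _ (by positivity), ← ENNReal.rpow_natCast,
              ← ENNReal.rpow_mul, one_div_div, ← mul_assoc]
            congr 2
            push_cast; ring
    -- The absorption divides by K^{2/(d+2)}, legitimate because the bounded cutoff makes K finite.
    refine (le_rpow_of_le_mul_rpow (by positivity) (b := (d : ℝ) / (d + 2)) (by positivity)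
      (by field_simp; ring) hKfin hle).trans (le_of_eq ?_)
    rw [ENNReal.mul_rpow_of_nonneg _ _ (by positivity), ← ENNReal.rpow_mul, ← ENNReal.rpow_mul,
      mul_comm, ← ENNReal.ofReal_rpow_of_pos hC]
    congr 2 <;> field_simp
  have hlim : ∀ p, ENNReal.ofReal (f p ^ (1 + 2 / (d : ℝ))) =
      liminf (fun k : ℕ => ENNReal.ofReal (truncatedPower f k p * f p)) atTop := by
    intro p
    refine (Tendsto.liminf_eq (tendsto_const_nhds.congr' ?_)).symm
    filter_upwards [eventually_truncatedPower_eq (f := f) p] with k hk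
    rw [hk, Real.rpow_add' (hf0 p) (by positivity), Real.rpow_one, mul_comm]
  refine (lintegral_congr hlim).le.trans ?_
  -- Fatou's lemma removes the truncation: at each point Vₖ f equals f^{1+2/d} for all large k.
  refine (lintegral_liminf_le fun k => ((hcut k).measurable.mul hfm).ennreal_ofReal).trans ?_
  exact liminf_le_of_frequently_le' (Frequently.of_forall key)

/-- The bound for finite subfamilies is uniform, and both the sum and its power are increasing
suprema over finite sets, so monotone convergence applies. -/
theorem exists_lintegral_tsum_rpow_le (d : ℕ) (hd : 1 ≤ d) :
    ∃ C : ℝ, 0 < C ∧ ∀ {ι : Type*} [Countable ι] (w : ι → ℝ × EuclideanSpace ℝ (Fin d) → ℂ)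
      (u : ι → L2 d), (∀ i, IsVersion (w i) (u i)) → Orthonormal ℂ u → ∀ m : ι → ℝ≥0∞,
      ∫⁻ p, (∑' i, m i * ‖w i p‖ₑ ^ 2) ^ (1 + 2 / (d : ℝ)) ≤
        ENNReal.ofReal C *
          (∑' i, m i ^ (((d : ℝ) + 2) / (d + 1))) ^ (((d : ℝ) + 1) / d) := by
  have hd0 : (0 : ℝ) < d := by exact_mod_cast hd
  obtain ⟨C, hC, H⟩ := exists_lintegral_rpow_le_of_fin d hd
  refine ⟨C, hC, fun {ι} _ w u hw hu m => ?_⟩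
  classical
  by_cases hS : ∑' i, m i ^ (((d : ℝ) + 2) / (d + 1)) = ∞
  · rw [hS, ENNReal.top_rpow_of_pos (by positivity), ENNReal.mul_top (by simpa using hC)]
    exact le_top
  have hmfin : ∀ i, m i ≠ ∞ := fun i hi => ENNReal.ne_top_of_tsum_ne_top hS i (by
    rw [hi, ENNReal.top_rpow_of_pos (by positivity)])
  have hwm := fun i => (hw i).measurable
  have hfin : ∀ s : Finset ι, ∫⁻ p, (∑ i ∈ s, m i * ‖w i p‖ₑ ^ 2) ^ (1 + 2 / (d : ℝ)) ≤
      ENNReal.ofReal C * (∑' i, m i ^ (((d : ℝ) + 2) / (d + 1))) ^ (((d : ℝ) + 1) / d) := by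
    intro s
    let e := s.equivFin.symm
    have h := H s.card (fun k => w (e k)) (fun k => u (e k)) (fun k => hw _)
      (hu.comp _ (Subtype.val_injective.comp e.injective)) (fun k => (m (e k)).toReal)
      (fun k => ENNReal.toReal_nonneg)
    have hsum : ∀ g : ι → ℝ≥0∞, ∑ k, g (e k) = ∑ i ∈ s, g i := fun g => by
      rw [e.sum_comp (fun i : s => g i), Finset.sum_coe_sort]
    simp only [ENNReal.ofReal_toReal (hmfin _)] at h
    rw [hsum fun i => m i ^ (((d : ℝ) + 2) / (d + 1))] at h
    have hint : ∀ p, ENNReal.ofReal ((∑ k, (m (e k)).toReal * ‖w (e k) p‖ ^ 2) ^ (1 + 2 / (d : ℝ))) =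
        (∑ i ∈ s, m i * ‖w i p‖ₑ ^ 2) ^ (1 + 2 / (d : ℝ)) := by
      intro p
      rw [← ENNReal.ofReal_rpow_of_nonneg (Finset.sum_nonneg fun k _ => by positivity)
        (by positivity), ENNReal.ofReal_sum_of_nonneg (fun k _ => by positivity),
        ← hsum fun i => m i * ‖w i p‖ₑ ^ 2]
      congr 1
      refine Finset.sum_congr rfl fun k _ => ?_
      rw [ENNReal.ofReal_mul ENNReal.toReal_nonneg, ENNReal.ofReal_toReal (hmfin _),
        ENNReal.ofReal_pow (norm_nonneg _), ofReal_norm]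
    simp only [hint] at h
    refine h.trans ?_
    gcongr
    exact ENNReal.sum_le_tsum s
  have hsup : ∀ p, (∑' i, m i * ‖w i p‖ₑ ^ 2) ^ (1 + 2 / (d : ℝ)) =
      ⨆ s : Finset ι, (∑ i ∈ s, m i * ‖w i p‖ₑ ^ 2) ^ (1 + 2 / (d : ℝ)) := by
    intro p
    rw [ENNReal.tsum_eq_iSup_sum]
    exact (ENNReal.orderIsoRpow (1 + 2 / (d : ℝ)) (by positivity)).map_iSup _
  simp only [hsup]
  rw [lintegral_iSup_directed (fun s => by fun_prop)]
  · exact iSup_le hfin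
  · refine directed_of_isDirected_le fun s t hst p => ?_
    dsimp only
    gcongr

/-! ### Interpolation with mass conservation -/

theorem ENNReal.tsum_rpow_mul_rpow_le {ι : Type*} (f g : ι → ℝ≥0∞) {a b : ℝ} (ha : 0 ≤ a)
    (hb : 0 ≤ b) (hab : a + b = 1) :
    ∑' i, f i ^ a * g i ^ b ≤ (∑' i, f i) ^ a * (∑' i, g i) ^ b := by
  let _ : MeasurableSpace ι := ⊤
  have h := ENNReal.lintegral_mul_norm_pow_le (μ := Measure.count) (f := f) (g := g)
    (Measurable.of_discrete).aemeasurable (Measurable.of_discrete).aemeasurable ha hb hab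
  simpa [lintegral_count] using h

/-- Hölder interpolation between mass conservation, uniform in t ≠ 0 with weights in ℓ¹, and the
endpoint with weights in ℓ^{(d+2)/(d+1)}. Splitting each weight m into two powers of itself replaces
interpolation of operators. -/
theorem exists_lintegral_lintegral_rpow_le (d : ℕ) (hd : 1 ≤ d) (q : ℝ) (hq : 1 < q)
    (hqd : q ≤ 1 + 2 / (d : ℝ)) :
    ∃ C : ℝ, 0 < C ∧ ∀ p : ℝ, 1 ≤ p → 2 / p + (d : ℝ) / q = (d : ℝ) →
      ∀ {ι : Type*} [Countable ι] (w : ι → ℝ × EuclideanSpace ℝ (Fin d) → ℂ) (u : ι → L2 d),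
      (∀ i, IsVersion (w i) (u i)) → Orthonormal ℂ u → ∀ m : ι → ℝ≥0∞,
      ∫⁻ t, (∫⁻ x, (∑' i, m i * ‖w i (t, x)‖ₑ ^ 2) ^ q) ^ (p / q) ≤
        ENNReal.ofReal C ^ p *
          (∑' i, m i ^ (2 * q / (q + 1))) ^ (p * (q + 1) / (2 * q)) := by
  have hd0 : (0 : ℝ) < d := by exact_mod_cast hd
  have hq0 : 0 < q := by linarith
  obtain ⟨C, hC, H⟩ := exists_lintegral_tsum_rpow_le d hd
  -- The exponent is 1/p by the scaling relation, written in terms of q because the constant is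
  -- fixed before p.
  refine ⟨C ^ ((d : ℝ) / 2 * (1 - 1 / q)), by positivity,
    fun p hp hpq {ι} _ w u hw hu m => ?_⟩
  have hp0 : 0 < p := by linarith
  -- θ solves 1/q = (1-θ) + θ d/(d+2); the condition q ≤ 1 + 2/d is what makes θ ≤ 1.
  set θ : ℝ := ((d : ℝ) + 2) / 2 * (1 - 1 / q) with hθ
  set r : ℝ := 2 * q / (q + 1) with hr
  have hr0 : 0 < r := by positivity
  have h1q : 0 < 1 - 1 / q := by
    rw [sub_pos, div_lt_one hq0]; exact hq
  have hθ0 : 0 ≤ θ := by positivity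
  have hθ1 : θ ≤ 1 := by
    have h1 : d * q ≤ d + 2 := by
      calc d * q ≤ d * (1 + 2 / (d : ℝ)) := by gcongr
        _ = d + 2 := by field_simp
    rw [hθ]
    have : 1 - 1 / q = (q - 1) / q := by field_simp
    rw [this, div_mul_div_comm, div_le_one (by positivity)]
    nlinarith
  have hp1 : 1 / p = (d : ℝ) / 2 * (1 - 1 / q) := by
    have : 1 / p = (2 / p) / 2 := by ring
    rw [this, eq_sub_of_add_eq hpq]; ring
  have hpθ : θ * p * d = d + 2 := by
    have : p * ((d : ℝ) / 2 * (1 - 1 / q)) = 1 := by rw [← hp1]; field_simp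
    rw [hθ]; linear_combination ((d : ℝ) + 2) * this
  have hrθ : r * (1 - θ) + r * (((d : ℝ) + 1) / (d + 2)) * θ = 1 := by
    rw [hr, hθ]; field_simp; ring
  have hqθ : (1 - θ) * q + θ * q * (d / (d + 2)) = 1 := by
    rw [hθ]; field_simp; ring
  -- The weights of F and G are tuned so that both reduce to S = ∑ mᵢ^r: those of F in ℓ¹, those of
  -- G after the power (d+2)/(d+1). The identity `hrθ` says that they recombine to mᵢ.
  set F : ℝ × EuclideanSpace ℝ (Fin d) → ℝ≥0∞ := fun z => ∑' i, m i ^ r * ‖w i z‖ₑ ^ 2 with hF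
  set G : ℝ × EuclideanSpace ℝ (Fin d) → ℝ≥0∞ :=
    fun z => ∑' i, m i ^ (r * (((d : ℝ) + 1) / (d + 2))) * ‖w i z‖ₑ ^ 2 with hG
  have hwm := fun i => (hw i).measurable
  have hFm : Measurable F := by fun_prop
  have hGm : Measurable G := by fun_prop
  set S := ∑' i, m i ^ r with hS
  have hpt : ∀ z, ∑' i, m i * ‖w i z‖ₑ ^ 2 ≤ F z ^ (1 - θ) * G z ^ θ := by
    intro z
    refine le_trans (le_of_eq (tsum_congr fun i => ?_))
      (ENNReal.tsum_rpow_mul_rpow_le _ _ (sub_nonneg.2 hθ1) hθ0 (by ring))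
    rw [ENNReal.mul_rpow_of_nonneg _ _ (sub_nonneg.2 hθ1), ENNReal.mul_rpow_of_nonneg _ _ hθ0,
      ← ENNReal.rpow_mul, ← ENNReal.rpow_mul, mul_mul_mul_comm,
      ← ENNReal.rpow_add_of_nonneg _ _ (mul_nonneg hr0.le (sub_nonneg.2 hθ1)) (by positivity),
      ← ENNReal.rpow_add_of_nonneg _ _ (sub_nonneg.2 hθ1) hθ0, hrθ, sub_add_cancel,
      ENNReal.rpow_one, ENNReal.rpow_one]
  have hFint : ∀ t, t ≠ 0 → ∫⁻ x, F (t, x) = S := by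
    intro t ht
    simp only [hF]
    rw [lintegral_tsum fun i =>
      (((hw i).measurable_slice t).enorm.pow_const 2).const_mul _ |>.aemeasurable]
    refine tsum_congr fun i => ?_
    rw [lintegral_const_mul _ (((hw i).measurable_slice t).enorm.pow_const 2),
      (hw i).lintegral_slice ht, ← ofReal_norm, hu.1 i]
    simp
  have hslice : ∀ t, t ≠ 0 → (∫⁻ x, (∑' i, m i * ‖w i (t, x)‖ₑ ^ 2) ^ q) ^ (p / q) ≤
      S ^ ((1 - θ) * p) * ∫⁻ x, G (t, x) ^ (1 + 2 / (d : ℝ)) := by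
    intro t ht
    have h1 : ∫⁻ x, (∑' i, m i * ‖w i (t, x)‖ₑ ^ 2) ^ q ≤
        S ^ ((1 - θ) * q) * (∫⁻ x, G (t, x) ^ (1 + 2 / (d : ℝ))) ^ (θ * q * (d / (d + 2))) := by
      calc ∫⁻ x, (∑' i, m i * ‖w i (t, x)‖ₑ ^ 2) ^ q
          ≤ ∫⁻ x, F (t, x) ^ ((1 - θ) * q) *
              (G (t, x) ^ (1 + 2 / (d : ℝ))) ^ (θ * q * (d / (d + 2))) := by
            refine lintegral_mono fun x => ?_
            refine (ENNReal.rpow_le_rpow (hpt (t, x)) hq0.le).trans (le_of_eq ?_)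
            rw [ENNReal.mul_rpow_of_nonneg _ _ hq0.le, ← ENNReal.rpow_mul, ← ENNReal.rpow_mul,
              ← ENNReal.rpow_mul]
            congr 2
            field_simp
        _ ≤ _ := by
            refine (ENNReal.lintegral_mul_norm_pow_le
              (hFm.comp measurable_prodMk_left).aemeasurable
              ((hGm.pow_const _).comp measurable_prodMk_left).aemeasurable
              (mul_nonneg (sub_nonneg.2 hθ1) hq0.le) (by positivity) hqθ).trans (le_of_eq ?_)
            rw [← hFint t ht]
            rfl
    refine (ENNReal.rpow_le_rpow h1 (by positivity)).trans (le_of_eq ?_)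
    rw [ENNReal.mul_rpow_of_nonneg _ _ (by positivity), ← ENNReal.rpow_mul, ← ENNReal.rpow_mul]
    have e1 : (1 - θ) * q * (p / q) = (1 - θ) * p := by field_simp
    -- The relation between p and q makes the space integral of the endpoint density appear to the
    -- first power, so that the time integral closes.
    have e2 : θ * q * (d / (d + 2)) * (p / q) = 1 := by
      rw [show θ * q * (d / (d + 2)) * (p / q) = (θ * p * d) / (d + 2) from by field_simp, hpθ,
        div_self (by positivity)]
    rw [e1, e2, ENNReal.rpow_one]
  have hne : ∀ᵐ t : ℝ, t ≠ 0 := by simp [ae_iff]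
  calc ∫⁻ t, (∫⁻ x, (∑' i, m i * ‖w i (t, x)‖ₑ ^ 2) ^ q) ^ (p / q)
      ≤ ∫⁻ t, S ^ ((1 - θ) * p) * ∫⁻ x, G (t, x) ^ (1 + 2 / (d : ℝ)) := by
        refine lintegral_mono_ae ?_
        filter_upwards [hne] with t ht using hslice t ht
    _ = S ^ ((1 - θ) * p) * ∫⁻ z, G z ^ (1 + 2 / (d : ℝ)) := by
        rw [lintegral_const_mul _ (hGm.pow_const _).lintegral_prod_right', Measure.volume_eq_prod,
          lintegral_prod _ (hGm.pow_const _).aemeasurable]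
    _ ≤ S ^ ((1 - θ) * p) * (ENNReal.ofReal C * S ^ (((d : ℝ) + 1) / d)) := by
        gcongr
        refine (H w u hw hu _).trans (le_of_eq ?_)
        congr 3
        funext i
        rw [← ENNReal.rpow_mul]
        congr 1
        field_simp
    _ = _ := by
        rw [mul_left_comm, ← ENNReal.rpow_add_of_nonneg _ _
          (mul_nonneg (sub_nonneg.2 hθ1) hp0.le) (by positivity),
          ENNReal.ofReal_rpow_of_pos (by positivity), ← hp1, ← Real.rpow_mul hC.le,
          one_div_mul_cancel hp0.ne', Real.rpow_one]
        congr 2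
        have e3 : p * (q + 1) / (2 * q) = p / r := by rw [hr]; field_simp
        have e4 : ((d : ℝ) + 1) / d = θ * p * (((d : ℝ) + 1) / (d + 2)) := by
          rw [div_eq_iff hd0.ne']
          have : (d : ℝ) + 2 ≠ 0 := by positivity
          rw [show θ * p * (((d : ℝ) + 1) / (d + 2)) * d = θ * p * d / (d + 2) * (d + 1) from by ring,
            hpθ, div_self this, one_mul]
        rw [e3, e4, eq_div_iff hr0.ne']
        linear_combination p * hrθ

/-! ### Eigenvalues and singular values -/

section

variable {H : Type*} [NormedAddCommGroup H] [InnerProductSpace ℂ H] {ι : Type*}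

theorem IsDiagonalSum.apply_eq_smul {T : H →L[ℂ] H} {n : ι → ℂ} {u : ι → H}
    (h : IsDiagonalSum T n u) (hu : Orthonormal ℂ u) (j : ι) : T (u j) = n j • u j := by
  have h1 : HasSum (fun i => (n i * inner ℂ (u i) (u j)) • u i)
      ((n j * inner ℂ (u j) (u j)) • u j) :=
    hasSum_single j fun i hi => by rw [hu.2 hi, mul_zero, zero_smul]
  rw [(h (u j)).unique h1, inner_self_eq_norm_sq_to_K, hu.1 j]
  simp

/-- The span of more than k eigenvectors meets the kernel of an operator of rank at most k. On a
nonzero vector there T - F acts as T, which stretches by at least the smallest of the |nⱼ|. -/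
theorem le_enorm_sub_of_rank_le {T F : H →L[ℂ] H} {n : ι → ℂ} {u : ι → H} (hu : Orthonormal ℂ u)
    (hT : ∀ j, T (u j) = n j • u j) {k : ℕ} (hF : (F : H →ₗ[ℂ] H).rank ≤ (k : Cardinal))
    {s : Finset ι} (hs : k < s.card) {a : ι} (ha : ∀ j ∈ s, ‖n a‖ ≤ ‖n j‖) :
    ‖n a‖ₑ ≤ ‖T - F‖ₑ := by
  have hrank : Module.rank ℂ (F : H →ₗ[ℂ] H).range ≤ (k : Cardinal) := hF
  have hfin : FiniteDimensional ℂ (F : H →ₗ[ℂ] H).range :=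
    Module.rank_lt_aleph0_iff.1 (hrank.trans_lt (Cardinal.natCast_lt_aleph0))
  let Φ : (s → ℂ) →ₗ[ℂ] H := ∑ j : s, (LinearMap.proj j).smulRight (u j)
  have hΦ : ∀ c, Φ c = ∑ j : s, c j • u j := fun c => by simp [Φ]
  let Ψ : (s → ℂ) →ₗ[ℂ] (F : H →ₗ[ℂ] H).range := (F : H →ₗ[ℂ] H).rangeRestrict ∘ₗ Φ
  have hker : Ψ.ker ≠ ⊥ := by
    refine LinearMap.ker_ne_bot_of_finrank_lt ?_
    rw [Module.finrank_fintype_fun_eq_card, Fintype.card_coe]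
    exact (Module.finrank_le_of_rank_le hrank).trans_lt hs
  obtain ⟨c, hc, hc0⟩ := (Submodule.ne_bot_iff _).1 hker
  have hFc : F (Φ c) = 0 := congrArg Subtype.val (LinearMap.mem_ker.1 hc)
  have hus : Orthonormal ℂ fun j : s => u j := hu.comp _ Subtype.val_injective
  have hnorm : ∀ b : s → ℂ, ‖∑ j : s, b j • u j‖ ^ 2 = ∑ j : s, ‖b j‖ ^ 2 := by
    intro b
    have h1 : (inner ℂ (∑ j : s, b j • u j) (∑ j : s, b j • u j) : ℂ) =
        ((∑ j : s, ‖b j‖ ^ 2 : ℝ) : ℂ) := by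
      rw [hus.inner_sum b b Finset.univ]
      push_cast
      exact Finset.sum_congr rfl fun j _ => Complex.conj_mul' _
    rw [inner_self_eq_norm_sq_to_K] at h1
    exact Complex.ofReal_injective (by rw [← h1]; norm_cast)
  have hpos : 0 < ‖Φ c‖ ^ 2 := by
    rw [hΦ, hnorm]
    obtain ⟨j, hj⟩ := Function.ne_iff.1 hc0
    exact Finset.sum_pos' (fun _ _ => by positivity)
      ⟨j, Finset.mem_univ _, by have := norm_pos_iff.2 hj; positivity⟩
  have hTc : (T - F) (Φ c) = ∑ j : s, (n j * c j) • u j := by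
    rw [sub_apply, hFc, sub_zero, hΦ, map_sum]
    exact Finset.sum_congr rfl fun j _ => by rw [map_smul, hT, smul_smul, mul_comm]
  have hle : ‖n a‖ * ‖Φ c‖ ≤ ‖(T - F) (Φ c)‖ := by
    refine le_of_sq_le_sq ?_ (norm_nonneg _)
    rw [hTc, hnorm, mul_pow, hΦ, hnorm, Finset.mul_sum]
    refine Finset.sum_le_sum fun j _ => ?_
    rw [norm_mul, mul_pow]
    gcongr
    exact ha j j.2
  have hΦpos : 0 < ‖Φ c‖ := by
    by_contra h
    rw [le_antisymm (not_lt.1 h) (norm_nonneg _)] at hpos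
    simp at hpos
  rw [← ofReal_norm, ← ofReal_norm]
  exact ENNReal.ofReal_le_ofReal
    (le_of_mul_le_mul_right (hle.trans ((T - F).le_opNorm _)) hΦpos)

/-- In a finite subfamily, adjoining elements in decreasing order of |nⱼ| pairs each new one with
the next singular value. -/
theorem tsum_enorm_rpow_le_tsum_singularValue {T : H →L[ℂ] H} {n : ι → ℂ} {u : ι → H}
    (hu : Orthonormal ℂ u) (hT : ∀ j, T (u j) = n j • u j) {r : ℝ} (hr : 0 ≤ r) :
    ∑' j, ‖n j‖ₑ ^ r ≤ ∑' k, singularValue T k ^ r := by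
  classical
  have h : ∀ s : Finset ι, ∑ j ∈ s, ‖n j‖ₑ ^ r ≤
      ∑ k ∈ Finset.range s.card, singularValue T k ^ r := by
    intro s
    induction s using Finset.induction_on_min_value (fun j => ‖n j‖) with
    | empty => simp
    | insert a s ha hmin ih =>
      rw [Finset.sum_insert ha, Finset.card_insert_of_notMem ha, Finset.sum_range_succ, add_comm]
      gcongr
      -- Counting from 0, the new term has index |s|, and the enlarged set has |s| + 1 elements with
      -- |n a| the smallest modulus.
      refine le_iInf₂ fun F hF => le_enorm_sub_of_rank_le hu hT hF (s := insert a s) ?_ ?_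
      · rw [Finset.card_insert_of_notMem ha]; exact Nat.lt_succ_self _
      · intro j hj
        rcases Finset.mem_insert.1 hj with rfl | hj
        · exact le_rfl
        · exact hmin j hj
  rw [ENNReal.tsum_eq_iSup_sum]
  exact iSup_le fun s => (h s).trans (ENNReal.sum_le_tsum _)

end

/-! ### The evolved operator and its density -/

theorem IsDiagonalSum.evolve {d : ℕ} {ι : Type*} {γ : L2 d →L[ℂ] L2 d} {n : ι → ℂ} {u : ι → L2 d}
    (h : IsDiagonalSum γ n u) (t : ℝ) :
    IsDiagonalSum (evolve d t γ) n (fun j => propagator d t (u j)) := by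
  intro f
  have h1 := (propagator d t).hasSum (h (propagator d (-t) f))
  simp only [map_smul] at h1
  simp only [inner_propagator_left]
  exact h1

section

variable {d : ℕ} {ι : Type*}

theorem aestronglyMeasurable_density {n : ι → ℂ} (hn : n.support.Countable) (v : ι → L2 d) :
    AEStronglyMeasurable (density n v) volume := by
  have := hn.to_subtype
  have h : density n v = fun x => ∑' j : n.support, n j * ((‖v j x‖ ^ 2 : ℝ) : ℂ) := by
    funext x
    refine (tsum_subtype_eq_of_support_subset (f := fun j => n j * ((‖v j x‖ ^ 2 : ℝ) : ℂ)) ?_).symm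
    exact Function.support_mul_subset_left _ _
  rw [h]
  refine AEStronglyMeasurable.tsum fun j => ?_
  exact (Complex.continuous_ofReal.comp_aestronglyMeasurable
    ((Lp.aestronglyMeasurable (v j)).norm.pow 2)).const_mul (n j)

theorem ae_propagator_eq {κ : Type*} [Countable κ] {w : κ → ℝ × EuclideanSpace ℝ (Fin d) → ℂ}
    {u : κ → L2 d} (hw : ∀ i, IsVersion (w i) (u i)) {t : ℝ} (ht : t ≠ 0) :
    ∀ᵐ x : EuclideanSpace ℝ (Fin d), ∀ i, propagator d t (u i) x = w i (t, x) :=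
  ae_all_iff.2 fun i => (hw i).ae_eq t ht

theorem exists_isVersion (u : L2 d) : ∃ w, IsVersion w u := by
  obtain ⟨w, h1, h2⟩ := exists_measurable_propagator u
  exact ⟨w, h1, h2⟩

theorem aemeasurable_lintegral_density_rpow {n : ι → ℂ} (hn : n.support.Countable) (u : ι → L2 d)
    (q : ℝ) : AEMeasurable (fun t : ℝ =>
      ∫⁻ x, ‖density n (fun j => propagator d t (u j)) x‖ₑ ^ q) volume := by
  have := hn.to_subtype
  choose w hw using fun j => exists_isVersion (u j)
  have hwm := fun j => (hw j).measurable
  have hm : Measurable fun z : ℝ × EuclideanSpace ℝ (Fin d) =>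
      ‖∑' j : n.support, n j * ((‖w j z‖ ^ 2 : ℝ) : ℂ)‖ₑ ^ q :=
    (Measurable.tsum fun j => by fun_prop).enorm.pow_const q
  refine ⟨fun t => ∫⁻ x, ‖∑' j : n.support, n j * ((‖w j (t, x)‖ ^ 2 : ℝ) : ℂ)‖ₑ ^ q,
    hm.lintegral_prod_right', ?_⟩
  have hne : ∀ᵐ t : ℝ, t ≠ 0 := by simp [ae_iff]
  filter_upwards [hne] with t ht
  refine lintegral_congr_ae ?_
  filter_upwards [ae_propagator_eq (fun j : n.support => hw j) ht] with x hx
  congr 2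
  rw [density, ← tsum_subtype_eq_of_support_subset
    (f := fun j => n j * ((‖propagator d t (u j) x‖ ^ 2 : ℝ) : ℂ))
    (Function.support_mul_subset_left _ _)]
  simp only [hx]

/-- A finite sum of powers forces countable support of n, so jointly measurable versions can be used
for all relevant j off one null set. Bounding the series of absolute values yields both its
convergence almost everywhere and the inequality. -/
theorem exists_lintegral_tsum_enorm_rpow_le (d : ℕ) (hd : 1 ≤ d) (q : ℝ) (hq : 1 < q)
    (hqd : q ≤ 1 + 2 / (d : ℝ)) :
    ∃ C : ℝ, 0 < C ∧ ∀ p : ℝ, 1 ≤ p → 2 / p + (d : ℝ) / q = (d : ℝ) →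
      ∀ {ι : Type*} (u : ι → L2 d) (n : ι → ℂ), Orthonormal ℂ u →
      (∑' j, ‖n j‖ₑ ^ (2 * q / (q + 1)) ≠ ∞ → ∀ᵐ t : ℝ, ∀ᵐ x : EuclideanSpace ℝ (Fin d),
        ∑' j, ‖n j‖ₑ * ‖propagator d t (u j) x‖ₑ ^ 2 ≠ ∞) ∧
      ∫⁻ t : ℝ, (∫⁻ x, (∑' j, ‖n j‖ₑ * ‖propagator d t (u j) x‖ₑ ^ 2) ^ q) ^ (p / q) ≤
        ENNReal.ofReal C ^ p *
          (∑' j, ‖n j‖ₑ ^ (2 * q / (q + 1))) ^ (p * (q + 1) / (2 * q)) := by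
  obtain ⟨C, hC, H⟩ := exists_lintegral_lintegral_rpow_le d hd q hq hqd
  refine ⟨C, hC, fun p hp hpq {ι} u n hu => ?_⟩
  have hq0 : 0 < q := by linarith
  have hp0 : 0 < p := by linarith
  have hr0 : 0 < 2 * q / (q + 1) := by positivity
  by_cases hS : ∑' j, ‖n j‖ₑ ^ (2 * q / (q + 1)) = ∞
  · refine ⟨fun h => absurd hS h, ?_⟩
    rw [hS, ENNReal.top_rpow_of_pos (by positivity), ENNReal.mul_top]
    · exact le_top
    · rw [ENNReal.ofReal_rpow_of_pos hC]
      simpa using Real.rpow_pos_of_pos hC p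
  have hsupp : (Function.support fun j => ‖n j‖ₑ ^ (2 * q / (q + 1))) = n.support := by
    ext j; simp [hr0, ENNReal.rpow_eq_zero_iff]
  have hn : n.support.Countable := hsupp ▸ Summable.countable_support_ennreal hS
  have := hn.to_subtype
  choose w hw using fun j => exists_isVersion (u j)
  have hwm := fun j => (hw j).measurable
  have key := H p hp hpq (fun j : n.support => w j) (fun j : n.support => u j) (fun j => hw j)
    (hu.comp _ Subtype.val_injective) (fun j => ‖n j‖ₑ)
  rw [tsum_subtype_eq_of_support_subset (f := fun j => ‖n j‖ₑ ^ (2 * q / (q + 1))) hsupp.le] at key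
  have hm : Measurable fun z : ℝ × EuclideanSpace ℝ (Fin d) =>
      ∑' j : n.support, ‖n j‖ₑ * ‖w j z‖ₑ ^ 2 := by fun_prop
  have heq : ∀ t, t ≠ 0 → ∀ᵐ x : EuclideanSpace ℝ (Fin d),
      ∑' j, ‖n j‖ₑ * ‖propagator d t (u j) x‖ₑ ^ 2 =
        ∑' j : n.support, ‖n j‖ₑ * ‖w j (t, x)‖ₑ ^ 2 := by
    intro t ht
    filter_upwards [ae_propagator_eq (fun j : n.support => hw j) ht] with x hx
    rw [← tsum_subtype_eq_of_support_subset
      (f := fun j => ‖n j‖ₑ * ‖propagator d t (u j) x‖ₑ ^ 2) (s := n.support)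
      ((Function.support_mul_subset_left _ _).trans fun j => by simp)]
    simp only [hx]
  have hne : ∀ᵐ t : ℝ, t ≠ 0 := by simp [ae_iff]
  refine ⟨fun _ => ?_, ?_⟩
  · have hfin : ∫⁻ t, (∫⁻ x, (∑' j : n.support, ‖n j‖ₑ * ‖w j (t, x)‖ₑ ^ 2) ^ q) ^ (p / q) ≠ ∞ := by
      refine ne_top_of_le_ne_top (ENNReal.mul_ne_top ?_ ?_) key
      · exact ENNReal.rpow_ne_top_of_nonneg hp0.le ENNReal.ofReal_ne_top
      · exact ENNReal.rpow_ne_top_of_nonneg (by positivity) hS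
    have hae := ae_lt_top ((hm.pow_const q).lintegral_prod_right'.pow_const (p / q)) hfin
    filter_upwards [hne, hae] with t ht hlt
    have h1 : ∫⁻ x, (∑' j : n.support, ‖n j‖ₑ * ‖w j (t, x)‖ₑ ^ 2) ^ q ≠ ∞ := by
      intro h
      rw [h, ENNReal.top_rpow_of_pos (by positivity)] at hlt
      exact lt_irrefl _ hlt
    filter_upwards [heq t ht, ae_lt_top ((hm.pow_const q).comp measurable_prodMk_left) h1]
      with x hx hlt
    rw [hx]
    intro h
    simp only [Function.comp_apply, h, ENNReal.top_rpow_of_pos hq0, lt_self_iff_false] at hlt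
  · refine le_trans (lintegral_mono_ae ?_) key
    filter_upwards [hne] with t ht
    refine ENNReal.rpow_le_rpow (le_of_eq (lintegral_congr_ae ?_)) (by positivity)
    filter_upwards [heq t ht] with x hx
    rw [hx]

end

end

/-! ### The theorem -/

theorem mainTheorem1 (d : ℕ) (hd : 1 ≤ d) (q : ℝ) (hq : 1 < q) (hqd : q ≤ 1 + 2 / (d : ℝ)) :
    ∃ C : ℝ, 0 < C ∧
      ∀ p : ℝ, 1 ≤ p → 2 / p + (d : ℝ) / q = (d : ℝ) →
      ∀ (ι : Type*) (u : ι → L2 d) (n : ι → ℂ), Orthonormal ℂ u →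
        -- the density is well defined as soon as the right-hand side is finite
        (Summable (fun j => ‖n j‖ ^ (2 * q / (q + 1))) →
          (∀ᵐ t : ℝ, ∀ᵐ x : EuclideanSpace ℝ (Fin d),
            Summable (fun j => n j * ((‖propagator d t (u j) x‖ ^ 2 : ℝ) : ℂ))) ∧
          (∀ t : ℝ, AEStronglyMeasurable (density n (fun j => propagator d t (u j))) volume) ∧
          AEMeasurable (fun t : ℝ =>
            ∫⁻ x, ‖density n (fun j => propagator d t (u j)) x‖ₑ ^ q) volume) ∧
        -- the inequality for orthonormal functions
        (∫⁻ t : ℝ, (∫⁻ x, ‖∑' j, n j * ((‖propagator d t (u j) x‖ ^ 2 : ℝ) : ℂ)‖ₑ ^ q) ^ (p / q)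
          ≤ ENNReal.ofReal C ^ p *
            (∑' j, ‖n j‖ₑ ^ (2 * q / (q + 1))) ^ (p * (q + 1) / (2 * q))) ∧
        -- the same inequality for the operator `γ = ∑ⱼ nⱼ |uⱼ⟩⟨uⱼ|`
        (∀ γ : L2 d →L[ℂ] L2 d, IsDiagonalSum γ n u →
          (∀ t : ℝ, IsDiagonalSum (evolve d t γ) n (fun j => propagator d t (u j))) ∧
          mixedNorm p q (fun t => density n (fun j => propagator d t (u j)))
            ≤ ENNReal.ofReal C * schattenNorm (2 * q / (q + 1)) γ) := by
  have hq0 : 0 < q := by linarith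
  have hr0 : 0 < 2 * q / (q + 1) := by positivity
  obtain ⟨C, hC, H⟩ := exists_lintegral_tsum_enorm_rpow_le d hd q hq hqd
  refine ⟨C, hC, fun p hp hpq ι u n hu => ?_⟩
  have hp0 : 0 < p := by linarith
  obtain ⟨H1, H2⟩ := H p hp hpq u n hu
  have hterm : ∀ (t : ℝ) (x : EuclideanSpace ℝ (Fin d)) (j : ι),
      ‖n j * ((‖propagator d t (u j) x‖ ^ 2 : ℝ) : ℂ)‖ₑ =
        ‖n j‖ₑ * ‖propagator d t (u j) x‖ₑ ^ 2 := by
    intro t x j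
    rw [enorm_mul, ← ofReal_norm ((_ : ℝ) : ℂ), Complex.norm_real,
      Real.norm_of_nonneg (by positivity), ENNReal.ofReal_pow (norm_nonneg _), ofReal_norm]
  have hineq : ∫⁻ t : ℝ,
      (∫⁻ x, ‖∑' j, n j * ((‖propagator d t (u j) x‖ ^ 2 : ℝ) : ℂ)‖ₑ ^ q) ^ (p / q)
        ≤ ENNReal.ofReal C ^ p *
          (∑' j, ‖n j‖ₑ ^ (2 * q / (q + 1))) ^ (p * (q + 1) / (2 * q)) := by
    refine le_trans ?_ H2
    gcongr with t x
    -- Where the series diverges the sum takes the default value 0, so this bound needs no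
    -- summability and complex coefficients reduce to their moduli.
    refine enorm_tsum_le_tsum_enorm.trans (le_of_eq ?_)
    simp only [hterm]
  refine ⟨fun hsum => ?_, hineq, fun γ hγ => ⟨hγ.evolve, ?_⟩⟩
  · have hS : ∑' j, ‖n j‖ₑ ^ (2 * q / (q + 1)) ≠ ∞ := by
      have h : ∀ j, ‖n j‖ₑ ^ (2 * q / (q + 1)) = ENNReal.ofReal (‖n j‖ ^ (2 * q / (q + 1))) :=
        fun j => by rw [← ofReal_norm, ENNReal.ofReal_rpow_of_nonneg (norm_nonneg _) hr0.le]
      simp only [h]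
      exact hsum.tsum_ofReal_ne_top
    have hn : n.support.Countable := by
      refine hsum.countable_support.mono fun j hj => ?_
      exact (Real.rpow_pos_of_pos (norm_pos_iff.2 hj) _).ne'
    refine ⟨?_, fun t => aestronglyMeasurable_density hn _,
      aemeasurable_lintegral_density_rpow hn u q⟩
    filter_upwards [H1 hS] with t ht
    filter_upwards [ht] with x hx
    refine Summable.of_norm ?_
    simpa only [← hterm, toReal_enorm] using ENNReal.summable_toReal hx
  · have hle := tsum_enorm_rpow_le_tsum_singularValue hu (hγ.apply_eq_smul hu) hr0.le
    have hmix : mixedNorm p q (fun t => density n (fun j => propagator d t (u j))) =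
        (∫⁻ t : ℝ, (∫⁻ x, ‖∑' j, n j * ((‖propagator d t (u j) x‖ ^ 2 : ℝ) : ℂ)‖ₑ ^ q) ^
          (p / q)) ^ (1 / p) := by
      simp only [mixedNorm, density, ← ENNReal.rpow_mul, one_div_mul_eq_div]
    rw [hmix]
    calc _ ≤ (ENNReal.ofReal C ^ p *
          (∑' j, ‖n j‖ₑ ^ (2 * q / (q + 1))) ^ (p * (q + 1) / (2 * q))) ^ (1 / p) := by
          gcongr
      _ = ENNReal.ofReal C * (∑' j, ‖n j‖ₑ ^ (2 * q / (q + 1))) ^ (1 / (2 * q / (q + 1))) := by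
          rw [ENNReal.mul_rpow_of_nonneg _ _ (by positivity), ← ENNReal.rpow_mul,
            ← ENNReal.rpow_mul, mul_one_div_cancel hp0.ne', ENNReal.rpow_one]
          congr 2
          field_simp
      _ ≤ _ := by
          unfold schattenNorm
          gcongr
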